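/- **Setting.** Let $\tau_1,\tau_2\in\mathbb C$ be linearly independent over $\mathbb R$ and let $\Lambda=\{2m\tau_1+2n\tau_2 : m,n\in\mathbb Z\}$. Around every $P\in\Lambda$ put a coated circular tube with inner radius $b$ and outer radius $a$, where $0\le b<a$ and $2a\le|P|$ for all $P\in\Lambda\setminus\{0\}$. Let $\varepsilon(z)$ be the $\Lambda$-periodic function equal to $\varepsilon_c$ for $|z-P|<b$, to $\varepsilon_i$ for $b<|z-P|<a$, and to $\varepsilon_e$ outside the tubes. Here $\varepsilon_e,\varepsilon_i,\varepsilon_c\in\mathbb C\setminus\{0\}$, $\varepsilon_i+\varepsilon_e\ne0$, $\varepsilon_i+\varepsilon_c\ne 0$. A *potential* is a Lipschitz function $u:\mathbb C\to\mathbb C$ that satisfies $\nabla\cdot(\varepsilon\nabla u)=0$ in the plane in the sense of distributions (this contains the continuity of $u$ and $\varepsilon\,\partial u/\partial n$ across the interfaces) and whose gradient is $\Lambda$-periodic. Let $\langle\cdot\rangle$ be the average over the parallelogram of periods centred at $0$, of area $S$. For a potential $u$ put $\mathbf E=-\nabla u$ and $\mathbf D=\varepsilon\mathbf E$. A complex $2\times2$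 matrix $T$ is an *effective permittivity tensor* if $\langle\mathbf D\rangle=T\langle\mathbf E\rangle$ for every potential; if there is exactly one, it is denoted by $\boldsymbol\varepsilon^*$. Put $$\alpha=\frac{\varepsilon_i-\varepsilon_e}{\varepsilon_i+\varepsilon_e},\quad \tilde\alpha=\frac{\varepsilon_i-\varepsilon_c}{\varepsilon_i+\varepsilon_c},\quad \nu=\frac ba,\quad \gamma_n=\frac{\alpha-\tilde\alpha\nu^{4n+2}}{1-\alpha\tilde\alpha\nu^{4n+2}},\quad s_1=0,\quad s_k=\sum_{P\in\Lambda\setminus\{0\}}P^{-2k}\ (k\ge2),$$ $$\zeta(z)=\frac1z+\sum_{P\in\Lambda\setminus\{0\}}\Big[\frac1{z-P}+\frac1P+\frac z{P^2}\Big],\qquad \eta_1=\zeta(\tau_1),\qquad \eta=\frac{2a^2\gamma_0}{S}.$$ **(1) The tensor formula.** Assume that $2a<|P|$ for all $P\in\Lambda\setminus\{0\}$, that $\operatorname{Im}\tau_1=0$ and $\operatorname{Im}(\tau_2/\tau_1)>0$, that all $s_k$ are real, and that $1-\alpha\tilde\alpha\nu^{4n+2}\neq0$ for all $n\ge0$.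 Let $(x_n)_{n\ge0}$ and $(y_n)_{n\ge0}$ be bounded complex solutions of $$x_n-\gamma_n\sum_{k\ge0}s_{n+k+1}\frac{(2n+2k+1)!}{(2k)!(2n+1)!}x_ka^{2n+2k+2}=\gamma_0\delta_{n,0},\qquad y_n+\gamma_n\sum_{k\ge0}s_{n+k+1}\frac{(2n+2k+1)!}{(2k)!(2n+1)!}y_ka^{2n+2k+2}=\gamma_0\delta_{n,0},$$ let $\lambda,\mu$ satisfy $x_0=\gamma_0\lambda$, $y_0=\gamma_0\mu$, and put $G_n=\tfrac12(x_n-y_n)$, $H_n=\tfrac12(x_n+y_n)$, $$\mathbf M=\begin{pmatrix}\lambda&0\\0&\mu\end{pmatrix},\qquad \boldsymbol\Psi=\begin{pmatrix}\operatorname{Re}\eta_1\operatorname{Im}2\tau_2&-\operatorname{Im}\eta_1\operatorname{Im}2\tau_2\\-\operatorname{Im}\eta_1\operatorname{Im}2\tau_2&\pi-\operatorname{Re}\eta_1\operatorname{Im}2\tau_2\end{pmatrix}.$$ * For every $\mathbf F=(F_1,F_2)\in\mathbb C^2$, with $p=\frac12(F_1-iF_2)$ and $q=\frac12(F_1+iF_2)$,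 there is a potential $u$ that outside the tubes (for $|z-P|\ge a$, all $P\in\Lambda$) is given by the absolutely convergent expansion $$u(z)=-(pz+q\bar z)+a\sum_{n\ge0}\frac{a^{2n+1}}{(2n)!}\Big[(pG_n+qH_n)\,\zeta^{(2n)}(z)+(pH_n+qG_n)\,\zeta^{(2n)}(\bar z)\Big],$$ and it satisfies $\langle\mathbf E\rangle=(\mathbf I-\eta\boldsymbol\Psi\mathbf M)\mathbf F$ and $\langle\mathbf D\rangle=\varepsilon_e(\mathbf I+\pi\eta\mathbf M-\eta\boldsymbol\Psi\mathbf M)\mathbf F$. (For $\mathbf F=E(1,i)$ one has $p=E$, $q=0$.) * If $\mathbf I-\eta\boldsymbol\Psi\mathbf M$ is invertible, there is exactly one effective permittivity tensor, namely $$\boldsymbol\varepsilon^*=\varepsilon_e\big[\mathbf I+\pi\eta\,\mathbf M(\mathbf I-\eta\boldsymbol\Psi\mathbf M)^{-1}\big].$$ **(2)** For every lattice and every $a$ as in the setting (tubes may touch, no symmetry is assumed): if $1-\alpha\tilde\alpha\nu^2\ne0$ and $\gamma_0=0$, there is exactly one effective permittivity tensor, namely $\boldsymbol\varepsilon^*=\varepsilon_e\mathbf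 I$. **(3)** If $\varepsilon_i\ne\varepsilon_c$, then the condition of (2), "$1-\alpha\tilde\alpha\nu^2\ne0$ and $\gamma_0=0$", is equivalent to $$\frac{b^2}{a^2}=\frac{(\varepsilon_i-\varepsilon_e)(\varepsilon_i+\varepsilon_c)}{(\varepsilon_i+\varepsilon_e)(\varepsilon_i-\varepsilon_c)}.$$ -/

import Mathlib

open scoped ContDiff ComplexConjugate

noncomputable section

namespace CoatedTubes

/-- A doubly periodic array of coated circular tubes in the plane. The tubes are centred at the
points of the lattice generated by `L.ω₁ = 2τ₁` and `L.ω₂ = 2τ₂`, have outer radius `a` and inner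
radius `b`; the permittivities of host, tube wall and core are `εe`, `εi`, `εc`. -/
structure TubeArray where
  L : PeriodPair
  a : ℝ
  b : ℝ
  εe : ℂ
  εi : ℂ
  εc : ℂ
  a_pos : 0 < a
  b_nonneg : 0 ≤ b
  b_lt_a : b < a
  εe_ne_zero : εe ≠ 0
  εi_ne_zero : εi ≠ 0
  εc_ne_zero : εc ≠ 0
  εi_add_εe_ne_zero : εi + εe ≠ 0
  εi_add_εc_ne_zero : εi + εc ≠ 0
  /-- Distinct tubes do not overlap: `a ≤ ℓ / 2`, with `ℓ` the least distance between centres. -/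
  two_mul_a_le : ∀ P ∈ L.lattice, P ≠ 0 → 2 * a ≤ ‖P‖

/-- Weierstrass' `ζ(z) = 1/z + ∑_{P ≠ 0} (1/(z - P) + 1/P + z/P²)`. The term `P = 0` of the sum
below is `1/z`, since `1/0 = 0`. -/
def weierstrassZeta (L : PeriodPair) (z : ℂ) : ℂ :=
  ∑' P : L.lattice, (1 / (z - P) + 1 / (P : ℂ) + z / (P : ℂ) ^ 2)

/-- The lattice sums `s_k = ∑_{P ≠ 0} 1/P^{2k}` for `k ≥ 2`, with the convention `s_1 = 0`. -/
def latticeSum (L : PeriodPair) (k : ℕ) : ℂ :=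
  if k = 1 then 0 else L.G (2 * k)

namespace TubeArray

variable (X : TubeArray)

/-! ### Field equations -/

open Classical in
/-- The permittivity at a point of the plane. -/
def permittivity (z : ℂ) : ℂ :=
  if ∃ P ∈ X.L.lattice, ‖z - P‖ < X.b then X.εc
  else if ∃ P ∈ X.L.lattice, ‖z - P‖ < X.a then X.εi
  else X.εe

/-- `u` is an electric potential of the array: `∇ · (ε ∇u) = 0` in the plane, with `∇u` periodic.
The equation is understood in the sense of distributions, so that it contains the continuity of
`u` and of `ε ∂u/∂n` across the interfaces. A potential that is smooth up to the interfaces in each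
phase and continuous across them, and has a periodic gradient, is Lipschitz. -/
structure IsPotential (u : ℂ → ℂ) : Prop where
  lipschitz : ∃ K, LipschitzWith K u
  periodic : ∀ P ∈ X.L.lattice, ∀ z, fderiv ℝ u (z + P) = fderiv ℝ u z
  weak_eq : ∀ φ : ℂ → ℝ, ContDiff ℝ ∞ φ → HasCompactSupport φ →
    ∫ z, X.permittivity z *
      (fderiv ℝ u z 1 * (fderiv ℝ φ z 1 : ℝ)
        + fderiv ℝ u z Complex.I * (fderiv ℝ φ z Complex.I : ℝ)) = 0

/-- The parallelogram of periods centred at the origin. -/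
def cell : Set ℂ :=
  {z | ∃ s ∈ Set.Ico (-1 / 2 : ℝ) (1 / 2), ∃ t ∈ Set.Ico (-1 / 2 : ℝ) (1 / 2),
    z = s * X.L.ω₁ + t * X.L.ω₂}

/-- The area `S` of the parallelogram of periods. -/
def area : ℝ := MeasureTheory.volume.real X.cell

/-- The average over the parallelogram of periods of the electric field `𝐄 = -∇u`. -/
def avgE (u : ℂ → ℂ) : Fin 2 → ℂ :=
  ![(X.area : ℂ)⁻¹ * ∫ z in X.cell, -fderiv ℝ u z 1,
    (X.area : ℂ)⁻¹ * ∫ z in X.cell, -fderiv ℝ u z Complex.I]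

/-- The average over the parallelogram of periods of the displacement `𝐃 = ε 𝐄 = -ε ∇u`. -/
def avgD (u : ℂ → ℂ) : Fin 2 → ℂ :=
  ![(X.area : ℂ)⁻¹ * ∫ z in X.cell, -(X.permittivity z * fderiv ℝ u z 1),
    (X.area : ℂ)⁻¹ * ∫ z in X.cell, -(X.permittivity z * fderiv ℝ u z Complex.I)]

/-- `T` is the effective permittivity tensor: `⟨𝐃⟩ = T ⟨𝐄⟩` for every potential. -/
def IsEffectiveTensor (T : Matrix (Fin 2) (Fin 2) ℂ) : Prop :=
  ∀ u : ℂ → ℂ, X.IsPotential u → X.avgD u = T.mulVec (X.avgE u)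

/-! ### Material and geometric parameters -/

/-- `α = (ε_i - ε_e) / (ε_i + ε_e)`. -/
def α : ℂ := (X.εi - X.εe) / (X.εi + X.εe)

/-- `α̃ = (ε_i - ε_c) / (ε_i + ε_c)`. -/
def α' : ℂ := (X.εi - X.εc) / (X.εi + X.εc)

/-- `ν = b / a`. -/
def ν : ℝ := X.b / X.a

/-- The denominator `1 - α α̃ ν^{4n+2}` of `γ_n`. -/
def γden (n : ℕ) : ℂ := 1 - X.α * X.α' * (X.ν : ℂ) ^ (4 * n + 2)

/-- `γ_n = (α - α̃ ν^{4n+2}) / (1 - α α̃ ν^{4n+2})`. -/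
def γ (n : ℕ) : ℂ := (X.α - X.α' * (X.ν : ℂ) ^ (4 * n + 2)) / X.γden n

/-- The sum `∑_k s_{n+k+1} (2n+2k+1)! / ((2k)! (2n+1)!) v_k a^{2n+2k+2}` of the infinite systems. -/
def interaction (v : ℕ → ℂ) (n : ℕ) : ℂ :=
  ∑' k : ℕ, latticeSum X.L (n + k + 1)
    * (((2 * n + 2 * k + 1).factorial : ℂ)
        / (((2 * k).factorial : ℂ) * ((2 * n + 1).factorial : ℂ)))
    * v k * (X.a : ℂ) ^ (2 * n + 2 * k + 2)

/-- `x` is a bounded solution of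
`x_n - γ_n ∑_k s_{n+k+1} (2n+2k+1)! / ((2k)! (2n+1)!) x_k a^{2n+2k+2} = γ_0 δ_{n,0}`. -/
def SolvesX (x : ℕ → ℂ) : Prop :=
  (∃ K : ℝ, ∀ n, ‖x n‖ ≤ K) ∧
    ∀ n, x n - X.γ n * X.interaction x n = if n = 0 then X.γ 0 else 0

/-- `y` is a bounded solution of
`y_n + γ_n ∑_k s_{n+k+1} (2n+2k+1)! / ((2k)! (2n+1)!) y_k a^{2n+2k+2} = γ_0 δ_{n,0}`. -/
def SolvesY (y : ℕ → ℂ) : Prop :=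
  (∃ K : ℝ, ∀ n, ‖y n‖ ≤ K) ∧
    ∀ n, y n + X.γ n * X.interaction y n = if n = 0 then X.γ 0 else 0

/-- The `n`-th term `a^{2n+1} / (2n)! (g_n ζ^{(2n)}(z) + h_n ζ^{(2n)}(z̄))` of the expansion of the
potential outside the tubes. -/
def zetaTerm (g h : ℕ → ℂ) (z : ℂ) (n : ℕ) : ℂ :=
  (X.a : ℂ) ^ (2 * n + 1) / ((2 * n).factorial : ℂ)
    * (g n * iteratedDeriv (2 * n) (weierstrassZeta X.L) z
      + h n * iteratedDeriv (2 * n) (weierstrassZeta X.L) (conj z))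

/-- `u` has, outside the tubes, the expansion with coefficients `G`, `H` that corresponds to the
applied field `F = (F₁, F₂)`. Here `F₁ x + F₂ y = p z + q z̄`. For `F = (E, iE)` one has `p = E` and
`q = 0`, and the expansion is
`u(z) = -E z + E a ∑ a^{2n+1} / (2n)! (G_n ζ^{(2n)}(z) + H_n ζ^{(2n)}(z̄))`; the one for
`F = (E, -iE)` has `z` and `z̄` exchanged, and the general one is their superposition. -/
def HasZetaExpansion (u : ℂ → ℂ) (G H : ℕ → ℂ) (F : Fin 2 → ℂ) : Prop :=
  let p := (F 0 - Complex.I * F 1) / 2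
  let q := (F 0 + Complex.I * F 1) / 2
  let g := fun n => p * G n + q * H n
  let h := fun n => p * H n + q * G n
  ∀ z : ℂ, (∀ P ∈ X.L.lattice, X.a ≤ ‖z - P‖) →
    Summable (X.zetaTerm g h z) ∧
      u z = -(p * z + q * conj z) + X.a * ∑' n, X.zetaTerm g h z n

/-- `η₁ = ζ(τ₁)`. -/
def η₁ : ℂ := weierstrassZeta X.L (X.L.ω₁ / 2)

/-- `η = 2 a² γ₀ / S`. -/
def η : ℂ := 2 * (X.a : ℂ) ^ 2 * X.γ 0 / X.area

/-- The matrix `Ψ` built from `η₁` and `2τ₂`. -/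
def Ψ : Matrix (Fin 2) (Fin 2) ℂ :=
  !![((X.η₁.re * X.L.ω₂.im : ℝ) : ℂ), ((-(X.η₁.im * X.L.ω₂.im) : ℝ) : ℂ);
     ((-(X.η₁.im * X.L.ω₂.im) : ℝ) : ℂ), ((Real.pi - X.η₁.re * X.L.ω₂.im : ℝ) : ℂ)]

end TubeArray

end CoatedTubes

end

namespace CoatedTubes

open MeasureTheory Filter Topology Set Metric

/-! ### Lipschitz functions on the plane -/

/-! Existence. In each phase the constructed potentials have the form `f(z) + g(z̄)` with `f`, `g`
holomorphic, and `ε(-i f(z) + i g(z̄))` is the conjugate function: `ε∇u` is its gradient turned by a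
right angle. If both functions are continuous across the interfaces and have bounded gradients, they
are Lipschitz, and the weak equation only says that a turned gradient is divergence free
(`isPotential_of_stream`). Their increments over the periods then give `⟨𝐄⟩` and `⟨𝐃⟩`.

In a tube, the coating carries arbitrary holomorphic `Φ`, `Φ'` together with their images in the
core circle, weighted by `α̃`; this settles the inner interface (`tubePotential_of_le`,
`tubeStream_of_le`) and leaves two conditions on `|z| = a` (`exists_potential`). For the mode
`w^(2n+1)` they say that an incident amplitude `R` is scattered with amplitude `-γ_n R`
(`coeff_match`). Outside, the field is a uniform one plus multipoles `ζ^(2n)`. Expanding the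
multipoles of all tubes about one centre produces the lattice sums, so that the scattering condition
becomes the infinite system (`exists_hasSum_interaction`, `exists_multipole_potential`).

The multipoles in `z̄` need a lattice invariant under conjugation; this follows from the reality of
the lattice sums (`conj_mem_lattice`). Among the multipoles only `ζ` itself fails to be periodic.
Its increments are `A P + B P̄` with `S B = π` and, for real `τ₁`, `ω₁ (A + B) = 2 η₁`
(`exists_wirtinger_quasiPeriod`); these two relations produce `Ψ` and the term `π η M`.

All potentials. An arbitrary potential is compared with the constructed ones by reciprocity,
`⟨𝐃⟩·⟨𝐄'⟩ = ⟨𝐃'⟩·⟨𝐄⟩`. Once the constructed mean fields fill `ℂ²`, this determines `⟨𝐃⟩` from `⟨𝐄⟩`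
(`isEffectiveTensor_iff`). Uniqueness of the field for a given mean field is never used, so complex
permittivities without any sign condition are allowed.

If `γ₀ = 0`, a uniform field is not scattered at all: the exterior potential stays linear whatever
the lattice is (`exists_neutral_potential`). -/

theorem measurable_fderiv_apply {F : Type*} [NormedAddCommGroup F] [NormedSpace ℝ F]
    [CompleteSpace F] [MeasurableSpace F] [BorelSpace F] (f : ℂ → F) (v : ℂ) :
    Measurable fun z => fderiv ℝ f z v :=
  measurable_fderiv_apply_const ℝ f v

/-- The derivative is put on `w`, which is differentiable almost everywhere by Rademacher. So the
gradient of a mollification is the mollified gradient: it converges almost everywhere and vanishes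
if `∇w` does. -/
theorem hasFDerivAt_convolution_of_lipschitz {K : NNReal} {w : ℂ → ℝ} (hw : LipschitzWith K w)
    {ρ : ℂ → ℝ} (hρ : Continuous ρ) (hρc : HasCompactSupport ρ) (x : ℂ) :
    HasFDerivAt (fun x => ∫ t, ρ t * w (x - t)) (∫ t, ρ t • fderiv ℝ w (x - t)) x := by
  refine (hasFDerivAt_integral_of_dominated_loc_of_lip (F := fun x t => ρ t * w (x - t))
    (F' := fun t => ρ t • fderiv ℝ w (x - t)) (bound := fun t => ‖ρ t‖ * K) (s := univ)
    univ_mem ?_ ?_ ?_ ?_ ?_ ?_).2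
  · refine .of_forall fun y => ?_
    exact (hρ.mul (hw.continuous.comp (by fun_prop))).aestronglyMeasurable
  · exact (hρ.mul (hw.continuous.comp (by fun_prop))).integrable_of_hasCompactSupport hρc.mul_right
  · exact (hρ.measurable.smul ((measurable_fderiv ℝ w).comp (by fun_prop))).aestronglyMeasurable
  · refine .of_forall fun t => LipschitzOnWith.of_dist_le_mul fun y _ z _ => ?_
    have := hw.dist_le_mul (y - t) (z - t)
    rw [dist_sub_right] at this
    simp only [Real.dist_eq, ← mul_sub, abs_mul] at this ⊢
    simp only [Real.coe_nnabs, Real.norm_eq_abs, abs_mul, abs_abs, NNReal.abs_eq, mul_assoc]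
    gcongr
  · exact (hρ.norm.integrable_of_hasCompactSupport hρc.norm).mul_const _
  · have h := (quasiMeasurePreserving_sub_left (volume : Measure ℂ) x).ae
      hw.ae_differentiableAt
    filter_upwards [h] with t ht
    have h2 : HasFDerivAt (fun y => w (y - t)) (fderiv ℝ w (x - t)) x :=
      ht.hasFDerivAt.comp x ((hasFDerivAt_id x).sub_const t)
    exact h2.const_mul (ρ t)

/-- Lipschitz functions are approximated by their mollifications. -/
theorem exists_smooth_approx {K : NNReal} {w : ℂ → ℝ} (hw : LipschitzWith K w) :
    ∃ W : ℕ → ℂ → ℝ, (∀ n, ContDiff ℝ ∞ (W n)) ∧ (∀ n, LipschitzWith K (W n)) ∧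
      (∀ z, Tendsto (fun n => W n z) atTop (𝓝 (w z))) ∧
      (∀ v, ∀ᵐ z, Tendsto (fun n => fderiv ℝ (W n) z v) atTop (𝓝 (fderiv ℝ w z v))) ∧
      (∀ P, (∀ z, w (z + P) = w z) → ∀ n z, W n (z + P) = W n z) ∧
      ((∀ᵐ z, fderiv ℝ w z = 0) → ∀ n z, fderiv ℝ (W n) z = 0) := by
  -- The fixed ratio 2 of outer to inner radius is what the Lebesgue differentiation theorem needs
  -- below (`K := 2`).
  let b : ℕ → ContDiffBump (0 : ℂ) := fun n =>
    ⟨1 / ((n : ℝ) + 1), 2 * (1 / ((n : ℝ) + 1)), by positivity, by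
      have : 0 < 1 / ((n : ℝ) + 1) := by positivity
      linarith⟩
  have hb0 : Tendsto (fun n => (b n).rOut) atTop (𝓝 0) := by
    have := (tendsto_one_div_add_atTop_nhds_zero_nat (𝕜 := ℝ)).const_mul 2
    simpa [b] using this
  let ρ : ℕ → ℂ → ℝ := fun n => (b n).normed volume
  have hρ : ∀ n, Continuous (ρ n) := fun n => (b n).continuous_normed
  have hρc : ∀ n, HasCompactSupport (ρ n) := fun n => (b n).hasCompactSupport_normed
  have hρi : ∀ n, ∫ t, ρ n t = 1 := fun n => (b n).integral_normed
  have hρp : ∀ n t, 0 ≤ ρ n t := fun n t => (b n).nonneg_normed t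
  have hint : ∀ n x, Integrable fun t => ρ n t * w (x - t) := fun n x =>
    ((hρ n).mul (hw.continuous.comp (by fun_prop))).integrable_of_hasCompactSupport
      (hρc n).mul_right
  have hconv : ∀ n, (fun x => ∫ t, ρ n t * w (x - t)) =
      convolution (ρ n) w (ContinuousLinearMap.lsmul ℝ ℝ) volume := fun n => rfl
  have hder := fun n x => hasFDerivAt_convolution_of_lipschitz hw (hρ n) (hρc n) x
  refine ⟨fun n x => ∫ t, ρ n t * w (x - t), fun n => ?_, fun n => ?_, fun z => ?_, fun v => ?_,
    fun P hP n z => ?_, fun h0 n z => ?_⟩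
  · beta_reduce
    rw [hconv]
    exact (hρc n).contDiff_convolution_left _ (b n).contDiff_normed hw.continuous.locallyIntegrable
  · refine LipschitzWith.of_dist_le_mul fun x y => ?_
    rw [dist_eq_norm, ← integral_sub (hint n x) (hint n y)]
    calc ‖∫ t, (ρ n t * w (x - t) - ρ n t * w (y - t))‖
        ≤ ∫ t, ρ n t * (K * dist x y) := by
          refine norm_integral_le_of_norm_le
            (((hρ n).integrable_of_hasCompactSupport (hρc n)).mul_const _) (.of_forall fun t => ?_)
          rw [← mul_sub, norm_mul, Real.norm_of_nonneg (hρp n t)]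
          have := hw.dist_le_mul (x - t) (y - t)
          rw [dist_sub_right, dist_eq_norm] at this
          exact mul_le_mul_of_nonneg_left this (hρp n t)
      _ = K * dist x y := by rw [integral_mul_const, hρi, one_mul]
  · beta_reduce
    exact ContDiffBump.convolution_tendsto_right_of_continuous hb0 hw.continuous z
  · have hloc : LocallyIntegrable (fun z => fderiv ℝ w z v) volume := by
      refine (locallyIntegrable_const (K * ‖v‖ : ℝ)).mono
        (measurable_fderiv_apply w v).aestronglyMeasurable (.of_forall fun z => ?_)
      rw [Real.norm_of_nonneg (r := K * ‖v‖) (by positivity)]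
      exact ((fderiv ℝ w z).le_opNorm v).trans
        (mul_le_mul_of_nonneg_right (norm_fderiv_le_of_lipschitz ℝ hw) (norm_nonneg v))
    have := ContDiffBump.ae_convolution_tendsto_right_of_locallyIntegrable (φ := b) (K := 2)
      hb0 (.of_forall fun n => le_rfl) hloc
    filter_upwards [this] with z hz
    refine hz.congr fun n => ?_
    have hI : Integrable fun t => ρ n t • fderiv ℝ w (z - t) := by
      refine (((hρ n).norm.integrable_of_hasCompactSupport (hρc n).norm).mul_const (K : ℝ)).mono'
        ((hρ n).measurable.smul ((measurable_fderiv ℝ w).comp (by fun_prop))).aestronglyMeasurable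
        (.of_forall fun t => ?_)
      rw [norm_smul]
      exact mul_le_mul_of_nonneg_left (norm_fderiv_le_of_lipschitz ℝ hw) (norm_nonneg _)
    rw [(hder n z).fderiv, ContinuousLinearMap.integral_apply hI]
    rfl
  · simp only [add_sub_right_comm z P, hP]
  · rw [(hder n z).fderiv]
    have := (quasiMeasurePreserving_sub_left (volume : Measure ℂ) z).ae h0
    rw [← integral_zero ℂ (ℂ →L[ℝ] ℝ)]
    exact integral_congr_ae (by filter_upwards [this] with t ht; simp [ht])

theorem lipschitz_re {K : NNReal} {w : ℂ → ℂ} (hw : LipschitzWith K w) :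
    LipschitzWith K fun z => (w z).re :=
  LipschitzWith.of_dist_le_mul fun x y => le_trans (by
    rw [Real.dist_eq, dist_eq_norm, ← Complex.sub_re]; exact Complex.abs_re_le_norm _)
    (hw.dist_le_mul x y)

theorem lipschitz_im {K : NNReal} {w : ℂ → ℂ} (hw : LipschitzWith K w) :
    LipschitzWith K fun z => (w z).im :=
  LipschitzWith.of_dist_le_mul fun x y => le_trans (by
    rw [Real.dist_eq, dist_eq_norm, ← Complex.sub_im]; exact Complex.abs_im_le_norm _)
    (hw.dist_le_mul x y)

theorem hasFDerivAt_re {w : ℂ → ℂ} {L : ℂ →L[ℝ] ℂ} {z : ℂ} (h : HasFDerivAt w L z) :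
    HasFDerivAt (fun z => (w z).re) (Complex.reCLM.comp L) z :=
  Complex.reCLM.hasFDerivAt.comp z h

theorem hasFDerivAt_im {w : ℂ → ℂ} {L : ℂ →L[ℝ] ℂ} {z : ℂ} (h : HasFDerivAt w L z) :
    HasFDerivAt (fun z => (w z).im) (Complex.imCLM.comp L) z :=
  Complex.imCLM.hasFDerivAt.comp z h

/-- The mollifications have zero gradient everywhere, hence are constant, and they converge
pointwise to `w`. -/
theorem eq_of_lipschitz_of_fderiv_ae_zero_real {K : NNReal} {w : ℂ → ℝ} (hw : LipschitzWith K w)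
    (h0 : ∀ᵐ z, fderiv ℝ w z = 0) (x y : ℂ) : w x = w y := by
  obtain ⟨W, hs, -, hlim, -, -, hz⟩ := exists_smooth_approx hw
  have hW : ∀ n, W n x = W n y := fun n =>
    is_const_of_fderiv_eq_zero ((hs n).differentiable (by simp)) (hz h0 n) x y
  exact tendsto_nhds_unique (hlim x) ((hlim y).congr fun n => (hW n).symm)

theorem eq_of_lipschitz_of_fderiv_ae_zero {K : NNReal} {w : ℂ → ℂ} (hw : LipschitzWith K w)
    (h0 : ∀ᵐ z, fderiv ℝ w z = 0) (x y : ℂ) : w x = w y := by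
  apply Complex.ext
  · refine eq_of_lipschitz_of_fderiv_ae_zero_real (lipschitz_re hw) ?_ x y
    filter_upwards [h0, hw.ae_differentiableAt] with z hz hd
    rw [(hasFDerivAt_re hd.hasFDerivAt).fderiv, hz, ContinuousLinearMap.comp_zero]
  · refine eq_of_lipschitz_of_fderiv_ae_zero_real (lipschitz_im hw) ?_ x y
    filter_upwards [h0, hw.ae_differentiableAt] with z hz hd
    rw [(hasFDerivAt_im hd.hasFDerivAt).fderiv, hz, ContinuousLinearMap.comp_zero]

theorem integrable_fderiv_mul {F : Type*} [NormedRing F] [NormedAlgebra ℝ F]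
    [CompleteSpace F] [MeasurableSpace F] [BorelSpace F] [SecondCountableTopology F]
    {K : NNReal} {w : ℂ → F} (hw : LipschitzWith K w)
    {g : ℂ → F} (hg : Integrable g) (v : ℂ) : Integrable fun z => fderiv ℝ w z v * g z := by
  refine hg.bdd_mul (c := K * ‖v‖) (measurable_fderiv_apply w v).aestronglyMeasurable
    (.of_forall fun z => ?_)
  exact ((fderiv ℝ w z).le_opNorm v).trans
    (mul_le_mul_of_nonneg_right (norm_fderiv_le_of_lipschitz ℝ hw) (norm_nonneg v))

theorem hasCompactSupport_fderiv_apply {φ : ℂ → ℝ} (hc : HasCompactSupport φ) (v : ℂ) :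
    HasCompactSupport fun z => fderiv ℝ φ z v := hc.fderiv_apply (𝕜 := ℝ) v

theorem integral_fderiv_mul_fderiv_real {K : NNReal} {w : ℂ → ℝ} (hw : LipschitzWith K w)
    {φ : ℂ → ℝ} (hφ : ContDiff ℝ ∞ φ) (hc : HasCompactSupport φ) (u v : ℂ) :
    ∫ z, fderiv ℝ w z v * fderiv ℝ φ z u = -∫ z, fderiv ℝ (fun y => fderiv ℝ φ y u) z v * w z := by
  have hg : ContDiff ℝ ∞ fun z => fderiv ℝ φ z u :=
    (hφ.fderiv_right (m := ∞) (by simp)).clm_apply contDiff_const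
  have hgc := hasCompactSupport_fderiv_apply hc u
  obtain ⟨C, hC⟩ := (hg.of_le (m := 1) (by simp)).lipschitzWith_of_hasCompactSupport hgc (by simp)
  have := hw.integral_lineDeriv_mul_eq (μ := volume) hC hgc v
  rw [← integral_neg]
  convert this using 1
  · refine integral_congr_ae ?_
    filter_upwards [hw.ae_differentiableAt] with z hz
    rw [hz.lineDeriv_eq_fderiv]
  · congr 1
    ext z
    rw [(hg.differentiable (by simp) z).lineDeriv_eq_fderiv]
    simp

/-- After one integration by parts both sides are integrals of `w` against a mixed second derivative
of `φ`, which is symmetric. For the directions `1` and `I` this says that a gradient turned by a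
right angle is divergence free. -/
theorem integral_curl_eq_zero_real {K : NNReal} {w : ℂ → ℝ} (hw : LipschitzWith K w)
    {φ : ℂ → ℝ} (hφ : ContDiff ℝ ∞ φ) (hc : HasCompactSupport φ) (u v : ℂ) :
    ∫ z, fderiv ℝ w z v * fderiv ℝ φ z u = ∫ z, fderiv ℝ w z u * fderiv ℝ φ z v := by
  rw [integral_fderiv_mul_fderiv_real hw hφ hc, integral_fderiv_mul_fderiv_real hw hφ hc]
  congr 2
  ext z
  congr 1
  have hd : DifferentiableAt ℝ (fderiv ℝ φ) z :=
    (hφ.fderiv_right (m := ∞) (by simp)).differentiable (by simp) z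
  have key : ∀ u v, fderiv ℝ (fun y => fderiv ℝ φ y u) z v = fderiv ℝ (fderiv ℝ φ) z v u := by
    intro u v
    rw [fderiv_clm_apply hd (differentiableAt_const u)]
    simp
  rw [key, key]
  exact (hφ.contDiffAt.isSymmSndFDerivAt
    (by simpa using WithTop.coe_le_coe.2 (le_top : (2 : ℕ∞) ≤ ⊤))).eq
    v u

theorem integral_curl_eq_zero {K : NNReal} {w : ℂ → ℂ} (hw : LipschitzWith K w)
    {φ : ℂ → ℝ} (hφ : ContDiff ℝ ∞ φ) (hc : HasCompactSupport φ) (u v : ℂ) :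
    ∫ z, (fderiv ℝ w z v * (fderiv ℝ φ z u : ℝ) - fderiv ℝ w z u * (fderiv ℝ φ z v : ℝ)) = 0 := by
  have hcont : ∀ u, Continuous fun z => fderiv ℝ φ z u := fun u =>
    (hφ.continuous_fderiv (by simp)).clm_apply continuous_const
  have hgi : ∀ u, Integrable fun z => fderiv ℝ φ z u := fun u =>
    (hcont u).integrable_of_hasCompactSupport (hasCompactSupport_fderiv_apply hc u)
  have hint : ∀ u v, Integrable fun z => fderiv ℝ w z v * (fderiv ℝ φ z u : ℂ) := fun u v =>
    integrable_fderiv_mul hw (hgi u).ofReal v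
  rw [integral_sub (hint u v) (hint v u), sub_eq_zero]
  have hre : ∀ u v, (∫ z, fderiv ℝ w z v * (fderiv ℝ φ z u : ℂ)).re =
      ∫ z, fderiv ℝ (fun z => (w z).re) z v * fderiv ℝ φ z u := by
    intro u v
    rw [← Complex.reCLM_apply, ← ContinuousLinearMap.integral_comp_comm _ (hint u v)]
    refine integral_congr_ae ?_
    filter_upwards [hw.ae_differentiableAt] with z hz
    simp [(hasFDerivAt_re hz.hasFDerivAt).fderiv]
  have him : ∀ u v, (∫ z, fderiv ℝ w z v * (fderiv ℝ φ z u : ℂ)).im =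
      ∫ z, fderiv ℝ (fun z => (w z).im) z v * fderiv ℝ φ z u := by
    intro u v
    rw [← Complex.imCLM_apply, ← ContinuousLinearMap.integral_comp_comm _ (hint u v)]
    refine integral_congr_ae ?_
    filter_upwards [hw.ae_differentiableAt] with z hz
    simp [(hasFDerivAt_im hz.hasFDerivAt).fderiv]
  apply Complex.ext
  · rw [hre, hre, integral_curl_eq_zero_real (lipschitz_re hw) hφ hc]
  · rw [him, him, integral_curl_eq_zero_real (lipschitz_im hw) hφ hc]

/-! ### Averages of periodic functions over a cell -/

theorem lattice_induction (L : PeriodPair) {p : ℂ → Prop} (h1 : p L.ω₁) (h2 : p L.ω₂) (h0 : p 0)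
    (hadd : ∀ x y, p x → p y → p (x + y)) (hneg : ∀ x, p x → p (-x)) : ∀ P ∈ L.lattice, p P := by
  let H : AddSubgroup ℂ :=
    { carrier := {x | p x}, zero_mem' := h0, add_mem' := fun {x y} hx hy => hadd x y hx hy,
      neg_mem' := fun {x} hx => hneg x hx }
  have : L.lattice ≤ AddSubgroup.toIntSubmodule H := Submodule.span_le.2 (by
    rintro x (rfl | rfl)
    exacts [h1, h2])
  exact fun P hP => this hP

/-- A function with constant increments over the two periods is the sum of a linear and a periodic
function. -/
theorem exists_quasiPeriod (L : PeriodPair) {U : Set ℂ} (hU : ∀ P ∈ L.lattice, ∀ z ∈ U, z + P ∈ U)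
    {f : ℂ → ℂ}
    {c₁ c₂ : ℂ} (h1 : ∀ z ∈ U, f (z + L.ω₁) = f z + c₁) (h2 : ∀ z ∈ U, f (z + L.ω₂) = f z + c₂) :
    ∃ T : ℂ →L[ℝ] ℂ, ∀ P ∈ L.lattice, ∀ z ∈ U, f (z + P) = f z + T P := by
  let T : ℂ →L[ℝ] ℂ := LinearMap.toContinuousLinearMap (L.basis.constr ℝ ![c₁, c₂])
  have hT1 : T L.ω₁ = c₁ := by
    have := L.basis.constr_basis ℝ ![c₁, c₂] 0
    rwa [L.basis_zero] at this
  have hT2 : T L.ω₂ = c₂ := by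
    have := L.basis.constr_basis ℝ ![c₁, c₂] 1
    rwa [L.basis_one] at this
  refine ⟨T, fun P hP => (lattice_induction L (p := fun P => P ∈ L.lattice ∧
    ∀ z ∈ U, f (z + P) = f z + T P) ?_ ?_ ?_ ?_ ?_ P hP).2⟩
  · exact ⟨L.ω₁_mem_lattice, fun z hz => by rw [h1 z hz, hT1]⟩
  · exact ⟨L.ω₂_mem_lattice, fun z hz => by rw [h2 z hz, hT2]⟩
  · exact ⟨zero_mem _, fun z hz => by simp⟩
  · rintro x y ⟨hx, hfx⟩ ⟨hy, hfy⟩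
    exact ⟨add_mem hx hy, fun z hz => by
      rw [← add_assoc, hfy _ (hU x hx z hz), hfx z hz, map_add, add_assoc]⟩
  · rintro x ⟨hx, hfx⟩
    refine ⟨neg_mem hx, fun z hz => ?_⟩
    have := hfx _ (hU _ (neg_mem hx) z hz)
    rw [neg_add_cancel_right] at this
    rw [this, map_neg, add_neg_cancel_right]

theorem isAddFundamentalDomain_translate (b : Module.Basis (Fin 2) ℝ ℂ) (Λ : Submodule ℤ ℂ)
    (hΛ : Λ = Submodule.span ℤ (range b)) (c : ℂ) :
    IsAddFundamentalDomain Λ ((fun z => z + c) ⁻¹' ZSpan.fundamentalDomain b) volume := by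
  subst hΛ
  refine IsAddFundamentalDomain.mk' (((ZSpan.fundamentalDomain_measurableSet b).preimage
    (by fun_prop)).nullMeasurableSet) fun x => ?_
  have := ZSpan.exist_unique_vadd_mem_fundamentalDomain b (x + c)
  simpa only [mem_preimage, Submodule.vadd_def, vadd_eq_add, add_assoc] using this

namespace TubeArray

variable (X : TubeArray)

theorem cell_eq_preimage :
    X.cell = (fun z => z + (X.L.ω₁ + X.L.ω₂) / 2) ⁻¹' ZSpan.fundamentalDomain X.L.basis := by
  have hc : ∀ s t : ℝ, (s * X.L.ω₁ + t * X.L.ω₂ : ℂ) = s • X.L.basis 0 + t • X.L.basis 1 := by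
    simp
  have hr : ∀ (s t : ℝ), X.L.basis.repr (s • X.L.basis 0 + t • X.L.basis 1) 0 = s ∧
      X.L.basis.repr (s • X.L.basis 0 + t • X.L.basis 1) 1 = t := by
    intro s t
    simp only [map_add, map_smul, Module.Basis.repr_self, Finsupp.coe_add, Finsupp.coe_smul,
      Pi.add_apply, Pi.smul_apply, smul_eq_mul]
    simp
  ext z
  simp only [cell, mem_ofPred_eq, mem_preimage, ZSpan.mem_fundamentalDomain, Fin.forall_fin_two]
  constructor
  · rintro ⟨s, hs, t, ht, rfl⟩
    have : (s * X.L.ω₁ + t * X.L.ω₂ + (X.L.ω₁ + X.L.ω₂) / 2 : ℂ) =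
        (s + 1 / 2) • X.L.basis 0 + (t + 1 / 2) • X.L.basis 1 := by
      rw [← hc]; push_cast; ring
    rw [this, (hr _ _).1, (hr _ _).2]
    simp only [mem_Ico] at *
    exact ⟨⟨by linarith [hs.1], by linarith [hs.2]⟩, by linarith [ht.1], by linarith [ht.2]⟩
  · rintro ⟨h0, h1⟩
    set x := z + (X.L.ω₁ + X.L.ω₂) / 2 with hx
    have hz := X.L.basis.sum_repr x
    rw [Fin.sum_univ_two, ← hc] at hz
    refine ⟨X.L.basis.repr x 0 - 1 / 2, ?_, X.L.basis.repr x 1 - 1 / 2, ?_, ?_⟩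
    · simp only [mem_Ico] at *
      constructor <;> linarith [h0.1, h0.2]
    · simp only [mem_Ico] at *
      constructor <;> linarith [h1.1, h1.2]
    · have : z = x - (X.L.ω₁ + X.L.ω₂) / 2 := by rw [hx]; ring
      rw [this]
      push_cast
      linear_combination -hz

theorem isAddFundamentalDomain_preimage_cell (s : ℂ) :
    IsAddFundamentalDomain X.L.lattice ((fun z => z + s) ⁻¹' X.cell) volume := by
  have := isAddFundamentalDomain_translate X.L.basis X.L.lattice X.L.lattice_eq_span_range_basis
    (s + (X.L.ω₁ + X.L.ω₂) / 2)
  rw [cell_eq_preimage, preimage_preimage]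
  simpa only [add_assoc] using this

theorem isAddFundamentalDomain_cell : IsAddFundamentalDomain X.L.lattice X.cell volume := by
  simpa using X.isAddFundamentalDomain_preimage_cell 0

theorem measurableSet_cell : MeasurableSet X.cell := by
  rw [cell_eq_preimage]
  exact (ZSpan.fundamentalDomain_measurableSet _).preimage (by fun_prop)

theorem exists_cell_bound : ∃ R : ℝ, 0 < R ∧ ∀ z ∈ X.cell, ‖z‖ ≤ R := by
  refine ⟨‖X.L.ω₁‖ + ‖X.L.ω₂‖ + 1, by positivity, ?_⟩
  rintro z ⟨s, hs, t, ht, rfl⟩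
  have hs' : |s| ≤ 1 := abs_le.2 ⟨by linarith [hs.1], by linarith [hs.2]⟩
  have ht' : |t| ≤ 1 := abs_le.2 ⟨by linarith [ht.1], by linarith [ht.2]⟩
  calc ‖(s * X.L.ω₁ + t * X.L.ω₂ : ℂ)‖ ≤ ‖(s * X.L.ω₁ : ℂ)‖ + ‖(t * X.L.ω₂ : ℂ)‖ := norm_add_le _ _
    _ = |s| * ‖X.L.ω₁‖ + |t| * ‖X.L.ω₂‖ := by simp
    _ ≤ 1 * ‖X.L.ω₁‖ + 1 * ‖X.L.ω₂‖ := by gcongr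
    _ ≤ _ := by linarith

theorem exists_sub_mem_cell (z : ℂ) : ∃ P ∈ X.L.lattice, z - P ∈ X.cell := by
  obtain ⟨v, hv, -⟩ := ZSpan.exist_unique_vadd_mem_fundamentalDomain X.L.basis
    (z + (X.L.ω₁ + X.L.ω₂) / 2)
  have hv2 : (v : ℂ) ∈ X.L.lattice := by
    rw [X.L.lattice_eq_span_range_basis]; exact v.2
  refine ⟨-v, neg_mem hv2, ?_⟩
  rw [cell_eq_preimage, mem_preimage]
  convert hv using 1
  simp only [Submodule.vadd_def, vadd_eq_add]
  ring

theorem volume_cell_lt_top : volume X.cell < ⊤ := by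
  obtain ⟨R, -, hR⟩ := X.exists_cell_bound
  exact (measure_mono fun z hz => mem_closedBall_zero_iff.2 (hR z hz)).trans_lt
    (measure_closedBall_lt_top (x := (0 : ℂ)) (r := R))

theorem volume_cell_ne_zero : volume X.cell ≠ 0 := by
  have hmp := (measurePreserving_add_right (volume : Measure ℂ) ((X.L.ω₁ + X.L.ω₂) / 2))
  rw [cell_eq_preimage, hmp.measure_preimage
    (ZSpan.fundamentalDomain_measurableSet _).nullMeasurableSet]
  exact ZSpan.measure_fundamentalDomain_ne_zero _

theorem area_pos : 0 < X.area :=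
  ENNReal.toReal_pos X.volume_cell_ne_zero X.volume_cell_lt_top.ne

theorem area_ne_zero : (X.area : ℂ) ≠ 0 := Complex.ofReal_ne_zero.2 X.area_pos.ne'

instance isFiniteMeasure_restrict_cell : IsFiniteMeasure (volume.restrict X.cell) :=
  ⟨by simpa using X.volume_cell_lt_top⟩

/-- The cell and its translate are fundamental domains of the same lattice. -/
theorem integral_cell_add {f : ℂ → ℂ} (hf : ∀ P ∈ X.L.lattice, ∀ z, f (z + P) = f z) (s : ℂ) :
    ∫ z in X.cell, f (z + s) = ∫ z in X.cell, f z := by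
  have hmp := measurePreserving_add_right (volume : Measure ℂ) s
  have h1 := hmp.setIntegral_preimage_emb (measurableEmbedding_addRight s) f
    ((fun z => z + -s) ⁻¹' X.cell)
  rw [preimage_preimage] at h1
  simp only [add_neg_cancel_right, preimage_id'] at h1
  rw [h1]
  have : VAddInvariantMeasure X.L.lattice ℂ volume :=
    inferInstanceAs <| VAddInvariantMeasure X.L.lattice.toAddSubgroup ℂ volume
  refine (X.isAddFundamentalDomain_preimage_cell (-s)).setIntegral_eq
    X.isAddFundamentalDomain_cell fun P z => ?_
  rw [Submodule.vadd_def, vadd_eq_add, add_comm, hf _ P.2]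

theorem periodic_bounded {f : ℂ → ℂ} (hc : Continuous f)
    (hf : ∀ P ∈ X.L.lattice, ∀ z, f (z + P) = f z) : ∃ C, ∀ z, ‖f z‖ ≤ C := by
  obtain ⟨R, -, hR⟩ := X.exists_cell_bound
  obtain ⟨C, hC⟩ := (isCompact_closedBall (0 : ℂ) R).exists_bound_of_continuousOn hc.continuousOn
  refine ⟨C, fun z => ?_⟩
  obtain ⟨P, hP, hz⟩ := X.exists_sub_mem_cell z
  have := hC (z - P) (mem_closedBall_zero_iff.2 (hR _ hz))
  rwa [← hf P hP, sub_add_cancel] at this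

/-- The average gradient of a quasi-periodic Lipschitz function. -/
theorem integral_cell_fderiv {K : NNReal} {w : ℂ → ℂ} (hw : LipschitzWith K w) {L : ℂ →L[ℝ] ℂ}
    (hq : ∀ P ∈ X.L.lattice, ∀ z, w (z + P) = w z + L P) (v : ℂ) :
    ∫ z in X.cell, fderiv ℝ w z v = X.area * L v := by
  have hint : ∀ s, Integrable (fun z => w (z + s) - L (z + s)) (volume.restrict X.cell) := by
    intro s
    have hcont : Continuous fun z => w z - L z := hw.continuous.sub L.continuous
    obtain ⟨C, hC⟩ := X.periodic_bounded hcont fun P hP z => by rw [hq P hP, map_add]; ring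
    exact Integrable.of_bound (hcont.comp (by fun_prop)).aestronglyMeasurable C
      (.of_forall fun z => hC _)
  have hzero : ∀ s, ∫ z in X.cell, (w (z + s) - w z - L s) = 0 := by
    intro s
    have h := X.integral_cell_add (f := fun z => w z - L z)
      (fun P hP z => by rw [hq P hP, map_add]; ring) s
    have h0 := hint 0
    simp only [add_zero] at h0
    rw [← sub_eq_zero, ← integral_sub (hint s) h0] at h
    rw [← h]
    congr 1
    ext z
    rw [map_add]
    ring
  -- The difference quotients of the periodic function `w - L` have mean zero by translation
  -- invariance. They are bounded by the Lipschitz constants and converge almost everywhere, so the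
  -- mean of the derivative vanishes too.
  have hlim : Tendsto (fun n : ℕ => ∫ z in X.cell,
      ((1 / ((n : ℝ) + 1))⁻¹ • (w (z + (1 / ((n : ℝ) + 1)) • v) - w z) - L v)) atTop
      (𝓝 (∫ z in X.cell, (fderiv ℝ w z v - L v))) := by
    refine tendsto_integral_of_dominated_convergence (fun _ => K * ‖v‖ + ‖L v‖) (fun n => ?_)
      (integrable_const _) (fun n => .of_forall fun z => ?_) ?_
    · have := hw.continuous
      exact Continuous.aestronglyMeasurable (by fun_prop)
    · refine (norm_sub_le _ _).trans (add_le_add_left ?_ _)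
      have ht : 0 < 1 / ((n : ℝ) + 1) := by positivity
      have := hw.norm_sub_le (z + (1 / ((n : ℝ) + 1)) • v) z
      rw [add_sub_cancel_left, norm_smul, Real.norm_of_nonneg ht.le] at this
      rw [norm_smul, norm_inv, Real.norm_of_nonneg ht.le, inv_mul_le_iff₀ ht]
      linarith
    · filter_upwards [ae_restrict_of_ae hw.ae_differentiableAt] with z hz
      refine Tendsto.sub_const ?_ _
      have h1 := (hz.hasFDerivAt.hasLineDerivAt v).tendsto_slope_zero
      refine h1.comp (tendsto_nhdsWithin_iff.2
        ⟨tendsto_one_div_add_atTop_nhds_zero_nat, .of_forall fun n => ?_⟩)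
      have : 0 < 1 / ((n : ℝ) + 1) := by positivity
      exact this.ne'
  have hz : ∀ n : ℕ, ∫ z in X.cell,
      ((1 / ((n : ℝ) + 1))⁻¹ • (w (z + (1 / ((n : ℝ) + 1)) • v) - w z) - L v) = 0 := by
    intro n
    have ht : (1 / ((n : ℝ) + 1)) ≠ 0 := by positivity
    have h := hzero ((1 / ((n : ℝ) + 1)) • v)
    rw [← smul_zero (1 / ((n : ℝ) + 1))⁻¹, ← h, ← integral_smul]
    congr 1
    ext z
    rw [map_smul, smul_sub _ (_ - _), smul_smul, inv_mul_cancel₀ ht, one_smul]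
  simp only [hz] at hlim
  have h0 := tendsto_nhds_unique hlim tendsto_const_nhds
  have hI : Integrable (fun z => fderiv ℝ w z v) (volume.restrict X.cell) :=
    Integrable.of_bound (measurable_fderiv_apply w v).aestronglyMeasurable (K * ‖v‖)
      (.of_forall fun z => ((fderiv ℝ w z).le_opNorm v).trans
        (mul_le_mul_of_nonneg_right (norm_fderiv_le_of_lipschitz ℝ hw) (norm_nonneg v)))
  rw [integral_sub hI (integrable_const _), setIntegral_const, sub_eq_zero] at h0
  rw [h0, Complex.real_smul]
  rfl

/-- Unfolding of a cell average against a compactly supported weight. -/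
theorem integral_cell_integral_mul {f : ℂ → ℂ} (hm : Measurable f) {C : ℝ} (hC : ∀ z, ‖f z‖ ≤ C)
    (hf : ∀ P ∈ X.L.lattice, ∀ z, f (z + P) = f z) {ψ : ℂ → ℝ} (hψ : Continuous ψ)
    (hψc : HasCompactSupport ψ) :
    Integrable (fun s => ∫ z, f (z + s) * (ψ z : ℂ)) (volume.restrict X.cell) ∧
      ∫ s in X.cell, ∫ z, f (z + s) * (ψ z : ℂ) = (∫ z in X.cell, f z) * (∫ z, ψ z : ℝ) := by
  have hi : Integrable (fun p : ℂ × ℂ => f (p.2 + p.1) * (ψ p.2 : ℂ))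
      ((volume.restrict X.cell).prod volume) := by
    refine Integrable.bdd_mul (c := C) ?_ (by
      exact (hm.comp (by fun_prop)).aestronglyMeasurable) (.of_forall fun p => hC _)
    have hψi : Integrable fun z => (ψ z : ℂ) := (hψ.integrable_of_hasCompactSupport hψc).ofReal
    exact hψi.comp_snd _
  refine ⟨hi.integral_prod_left, ?_⟩
  rw [integral_integral_swap hi, ← integral_complex_ofReal, ← integral_const_mul]
  congr 1
  ext z
  rw [integral_mul_const]
  congr 1
  simpa only [add_comm] using X.integral_cell_add hf z

end TubeArray

/-! ### Reciprocity -/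

theorem integral_fderiv_eq_zero_of_hasCompactSupport {ψ : ℂ → ℝ} (hψ : ContDiff ℝ ∞ ψ)
    (hc : HasCompactSupport ψ) (v : ℂ) : ∫ z, fderiv ℝ ψ z v = 0 := by
  obtain ⟨C, hC⟩ := (hψ.of_le (m := 1) (by simp)).lipschitzWith_of_hasCompactSupport hc (by simp)
  have h := (LipschitzWith.const (1 : ℝ) (α := ℂ)).integral_lineDeriv_mul_eq
    (μ := volume) hC hc (-v)
  have h1 : ∀ x, lineDeriv ℝ (fun _ : ℂ => (1 : ℝ)) x (-v) = 0 := fun x => by simp [lineDeriv]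
  simp only [h1, zero_mul, integral_zero, neg_neg, mul_one] at h
  rw [h]
  congr 1
  ext z
  rw [(hψ.differentiable (by simp) z).lineDeriv_eq_fderiv]

theorem integral_add_four {μ : Measure ℂ} {f g h k : ℂ → ℂ} (hf : Integrable f μ)
    (hg : Integrable g μ) (hh : Integrable h μ) (hk : Integrable k μ) :
    ∫ z, (f z + g z + h z + k z) ∂μ = ∫ z, f z ∂μ + ∫ z, g z ∂μ + ∫ z, h z ∂μ + ∫ z, k z ∂μ := by
  rw [← integral_add' hf hg, ← integral_add' (hf.add hg) hh,
    ← integral_add' ((hf.add hg).add hh) hk]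
  rfl

namespace TubeArray

variable (X : TubeArray)

theorem fderiv_periodic {F : Type*} [NormedAddCommGroup F] [NormedSpace ℝ F] {w : ℂ → F} {P : ℂ}
    {c : F} (h : ∀ z, w (z + P) = w z + c) (z : ℂ) : fderiv ℝ w (z + P) = fderiv ℝ w z := by
  rw [← fderiv_comp_add_right P]
  simp only [h, fderiv_add_const]

/-- A bounded periodic field that is divergence free in the sense of distributions is orthogonal to
the gradients of smooth periodic functions. -/
theorem integral_cell_smooth_eq_zero {k₁ k₂ : ℂ → ℂ} (hm₁ : Measurable k₁) (hm₂ : Measurable k₂)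
    {C : ℝ} (hC₁ : ∀ z, ‖k₁ z‖ ≤ C) (hC₂ : ∀ z, ‖k₂ z‖ ≤ C)
    (hp₁ : ∀ P ∈ X.L.lattice, ∀ z, k₁ (z + P) = k₁ z)
    (hp₂ : ∀ P ∈ X.L.lattice, ∀ z, k₂ (z + P) = k₂ z)
    (hdiv : ∀ φ : ℂ → ℝ, ContDiff ℝ ∞ φ → HasCompactSupport φ →
      ∫ z, (k₁ z * (fderiv ℝ φ z 1 : ℝ) + k₂ z * (fderiv ℝ φ z Complex.I : ℝ)) = 0)
    {w : ℂ → ℝ} (hw : ContDiff ℝ ∞ w) (hp : ∀ P ∈ X.L.lattice, ∀ z, w (z + P) = w z) :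
    ∫ z in X.cell, (k₁ z * (fderiv ℝ w z 1 : ℝ) + k₂ z * (fderiv ℝ w z Complex.I : ℝ)) = 0 := by
  -- The equation is tested with `ψ(· - s) w` and averaged over `s` in the cell. Where the
  -- derivative falls on `w`, the weight unfolds to `∫ ψ = 1`; where it falls on `ψ`, to `∫ ∂ψ = 0`.
  -- What remains is the periodic identity.
  let ψ : ℂ → ℝ := (⟨1, 2, one_pos, one_lt_two⟩ : ContDiffBump (0 : ℂ)).normed volume
  have hψ : ContDiff ℝ ∞ ψ := ContDiffBump.contDiff_normed _
  have hψc : HasCompactSupport ψ := ContDiffBump.hasCompactSupport_normed _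
  have hψi : ∫ z, ψ z = 1 := ContDiffBump.integral_normed _
  have hcd : ∀ {g : ℂ → ℝ}, ContDiff ℝ ∞ g → ∀ v, Continuous fun z => fderiv ℝ g z v :=
    fun hg v => (hg.continuous_fderiv (by simp)).clm_apply continuous_const
  have hpd : ∀ v, ∀ P ∈ X.L.lattice, ∀ z, fderiv ℝ w (z + P) v = fderiv ℝ w z v :=
    fun v P hP z => by rw [fderiv_periodic (c := 0) (by simpa using hp P hP)]
  have hbd : ∀ {g : ℂ → ℝ}, Continuous g → (∀ P ∈ X.L.lattice, ∀ z, g (z + P) = g z) →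
      ∃ B, ∀ z, ‖(g z : ℂ)‖ ≤ B := fun {g} hg hgp =>
    X.periodic_bounded (f := fun z => (g z : ℂ)) (Complex.continuous_ofReal.comp hg)
      fun P hP z => by rw [hgp P hP]
  obtain ⟨B₀, hB₀⟩ := hbd hw.continuous hp
  obtain ⟨B₁, hB₁⟩ := hbd (hcd hw 1) (hpd 1)
  obtain ⟨B₂, hB₂⟩ := hbd (hcd hw Complex.I) (hpd Complex.I)
  have key : ∀ {k : ℂ → ℂ} {g : ℂ → ℝ} {B : ℝ} {θ : ℂ → ℝ}, Measurable k → (∀ z, ‖k z‖ ≤ C) →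
      (∀ P ∈ X.L.lattice, ∀ z, k (z + P) = k z) → Continuous g → (∀ z, ‖(g z : ℂ)‖ ≤ B) →
      (∀ P ∈ X.L.lattice, ∀ z, g (z + P) = g z) → Continuous θ → HasCompactSupport θ →
      (∀ s, Integrable fun z => (k (z + s) * g (z + s)) * (θ z : ℂ)) ∧
      Integrable (fun s => ∫ z, (k (z + s) * g (z + s)) * (θ z : ℂ)) (volume.restrict X.cell) ∧
      ∫ s in X.cell, ∫ z, (k (z + s) * g (z + s)) * (θ z : ℂ) =
        (∫ z in X.cell, k z * g z) * (∫ z, θ z : ℝ) := by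
    intro k g B θ hk hkC hkp hg hgB hgp hθ hθc
    have hmeas : Measurable fun z => k z * (g z : ℂ) :=
      hk.mul (Complex.measurable_ofReal.comp hg.measurable)
    have hbound : ∀ z, ‖k z * (g z : ℂ)‖ ≤ C * B := fun z => by
      rw [norm_mul]
      exact mul_le_mul (hkC z) (hgB z) (norm_nonneg _) ((norm_nonneg _).trans (hkC z))
    refine ⟨fun s => ?_, X.integral_cell_integral_mul (f := fun z => k z * (g z : ℂ)) hmeas hbound
      (fun P hP z => by rw [hkp P hP, hgp P hP]) hθ hθc⟩
    have hθi : Integrable fun z => (θ z : ℂ) := (hθ.integrable_of_hasCompactSupport hθc).ofReal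
    exact hθi.bdd_mul (hmeas.comp (measurable_add_const s)).aestronglyMeasurable
      (.of_forall fun z => hbound _)
  have hN₁ := key hm₁ hC₁ hp₁ (hcd hw 1) hB₁ (hpd 1) hψ.continuous hψc
  have hN₂ := key hm₂ hC₂ hp₂ (hcd hw Complex.I) hB₂ (hpd Complex.I) hψ.continuous hψc
  have hM₁ := key hm₁ hC₁ hp₁ hw.continuous hB₀ hp (hcd hψ 1) (hasCompactSupport_fderiv_apply hψc 1)
  have hM₂ := key hm₂ hC₂ hp₂ hw.continuous hB₀ hp (hcd hψ Complex.I)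
    (hasCompactSupport_fderiv_apply hψc Complex.I)
  have hs : ∀ s, (∫ z, (k₁ (z + s) * (fderiv ℝ w (z + s) 1 : ℝ)) * (ψ z : ℂ)) +
      (∫ z, (k₂ (z + s) * (fderiv ℝ w (z + s) Complex.I : ℝ)) * (ψ z : ℂ)) +
      (∫ z, (k₁ (z + s) * (w (z + s) : ℝ)) * (fderiv ℝ ψ z 1 : ℝ)) +
      (∫ z, (k₂ (z + s) * (w (z + s) : ℝ)) * (fderiv ℝ ψ z Complex.I : ℝ)) = 0 := by
    intro s
    have hφ : ContDiff ℝ ∞ fun z => ψ (z - s) * w z :=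
      (hψ.comp (contDiff_id.sub contDiff_const)).mul hw
    have hφc : HasCompactSupport fun z => ψ (z - s) * w z := by
      have : HasCompactSupport fun z => ψ (z - s) := by
        simpa [sub_eq_add_neg, Function.comp_def] using
          hψc.comp_homeomorph (Homeomorph.addRight (-s))
      exact this.mul_right
    have h := hdiv _ hφ hφc
    rw [← integral_add_right_eq_self _ s] at h
    rw [← integral_add_four (hN₁.1 s) (hN₂.1 s) (hM₁.1 s) (hM₂.1 s), ← h]
    congr 1
    ext z
    have hd : HasFDerivAt (fun z => ψ (z - s) * w z)
        (ψ z • fderiv ℝ w (z + s) + w (z + s) • fderiv ℝ ψ z) (z + s) := by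
      have h1 : HasFDerivAt (fun z => ψ (z - s)) (fderiv ℝ ψ z) (z + s) := by
        have h2 : HasFDerivAt ψ (fderiv ℝ ψ z) (z + s - s) := by
          rw [add_sub_cancel_right]; exact (hψ.differentiable (by simp) z).hasFDerivAt
        exact h2.comp (z + s) ((hasFDerivAt_id (z + s)).sub_const s)
      have h2 := h1.mul (hw.differentiable (by simp) (z + s)).hasFDerivAt
      rw [add_sub_cancel_right] at h2
      exact h2
    rw [hd.fderiv]
    simp only [add_apply, smul_apply, smul_eq_mul]
    push_cast
    ring
  have htot : ∫ s in X.cell, ((∫ z, (k₁ (z + s) * (fderiv ℝ w (z + s) 1 : ℝ)) * (ψ z : ℂ)) +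
      (∫ z, (k₂ (z + s) * (fderiv ℝ w (z + s) Complex.I : ℝ)) * (ψ z : ℂ)) +
      (∫ z, (k₁ (z + s) * (w (z + s) : ℝ)) * (fderiv ℝ ψ z 1 : ℝ)) +
      (∫ z, (k₂ (z + s) * (w (z + s) : ℝ)) * (fderiv ℝ ψ z Complex.I : ℝ))) = 0 := by
    simp only [hs, integral_zero]
  rw [integral_add_four hN₁.2.1 hN₂.2.1 hM₁.2.1 hM₂.2.1,
    hN₁.2.2, hN₂.2.2, hM₁.2.2, hM₂.2.2, hψi,
    integral_fderiv_eq_zero_of_hasCompactSupport hψ hψc,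
    integral_fderiv_eq_zero_of_hasCompactSupport hψ hψc] at htot
  have hi : ∀ {k : ℂ → ℂ} {g : ℂ → ℝ} {B : ℝ}, Measurable k → (∀ z, ‖k z‖ ≤ C) →
      Continuous g → (∀ z, ‖(g z : ℂ)‖ ≤ B) →
      Integrable (fun z => k z * (g z : ℂ)) (volume.restrict X.cell) := by
    intro k g B hk hkC hg hgB
    refine Integrable.of_bound (hk.mul
      (Complex.measurable_ofReal.comp hg.measurable)).aestronglyMeasurable (C * B)
      (.of_forall fun z => ?_)
    rw [norm_mul]
    exact mul_le_mul (hkC z) (hgB z) (norm_nonneg _) ((norm_nonneg _).trans (hkC z))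
  rw [integral_add (hi hm₁ hC₁ (hcd hw 1) hB₁) (hi hm₂ hC₂ (hcd hw Complex.I) hB₂)]
  simpa using htot

/-- Mollification keeps the periods and the Lipschitz constant of `w`, so dominated convergence
carries the smooth case over. -/
theorem integral_cell_lipschitz_real_eq_zero {k₁ k₂ : ℂ → ℂ} (hm₁ : Measurable k₁)
    (hm₂ : Measurable k₂)
    {C : ℝ} (hC₁ : ∀ z, ‖k₁ z‖ ≤ C) (hC₂ : ∀ z, ‖k₂ z‖ ≤ C)
    (hp₁ : ∀ P ∈ X.L.lattice, ∀ z, k₁ (z + P) = k₁ z)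
    (hp₂ : ∀ P ∈ X.L.lattice, ∀ z, k₂ (z + P) = k₂ z)
    (hdiv : ∀ φ : ℂ → ℝ, ContDiff ℝ ∞ φ → HasCompactSupport φ →
      ∫ z, (k₁ z * (fderiv ℝ φ z 1 : ℝ) + k₂ z * (fderiv ℝ φ z Complex.I : ℝ)) = 0)
    {K : NNReal} {w : ℂ → ℝ} (hw : LipschitzWith K w)
    (hp : ∀ P ∈ X.L.lattice, ∀ z, w (z + P) = w z) :
    ∫ z in X.cell, (k₁ z * (fderiv ℝ w z 1 : ℝ) + k₂ z * (fderiv ℝ w z Complex.I : ℝ)) = 0 := by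
  obtain ⟨W, hs, hl, -, hd, hper, -⟩ := exists_smooth_approx hw
  have hz := fun n => X.integral_cell_smooth_eq_zero hm₁ hm₂ hC₁ hC₂ hp₁ hp₂ hdiv (hs n)
    (fun P hP => hper P (hp P hP) n)
  have hlim : Tendsto (fun n => ∫ z in X.cell,
      (k₁ z * (fderiv ℝ (W n) z 1 : ℝ) + k₂ z * (fderiv ℝ (W n) z Complex.I : ℝ))) atTop
      (𝓝 (∫ z in X.cell,
        (k₁ z * (fderiv ℝ w z 1 : ℝ) + k₂ z * (fderiv ℝ w z Complex.I : ℝ)))) := by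
    refine tendsto_integral_of_dominated_convergence (fun _ => C * K + C * K) (fun n => ?_)
      (integrable_const _) (fun n => .of_forall fun z => ?_) ?_
    · exact ((hm₁.mul (Complex.measurable_ofReal.comp (measurable_fderiv_apply _ _))).add
        (hm₂.mul (Complex.measurable_ofReal.comp
          (measurable_fderiv_apply _ _)))).aestronglyMeasurable
    · have hb : ∀ v : ℂ, ‖v‖ = 1 → ‖((fderiv ℝ (W n) z v : ℝ) : ℂ)‖ ≤ K := fun v hv => by
        rw [Complex.norm_real]
        refine ((fderiv ℝ (W n) z).le_opNorm v).trans ?_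
        rw [hv, mul_one]
        exact norm_fderiv_le_of_lipschitz ℝ (hl n)
      have hC0 : 0 ≤ C := (norm_nonneg _).trans (hC₁ z)
      refine (norm_add_le _ _).trans (add_le_add ?_ ?_)
      · rw [norm_mul]
        exact mul_le_mul (hC₁ z) (hb 1 (by simp)) (norm_nonneg _) hC0
      · rw [norm_mul]
        exact mul_le_mul (hC₂ z) (hb Complex.I (by simp)) (norm_nonneg _) hC0
    · filter_upwards [ae_restrict_of_ae (hd 1), ae_restrict_of_ae (hd Complex.I)] with z h1 h2
      exact (((Complex.continuous_ofReal.tendsto _).comp h1).const_mul _).add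
        (((Complex.continuous_ofReal.tendsto _).comp h2).const_mul _)
  simp only [hz] at hlim
  exact tendsto_nhds_unique hlim tendsto_const_nhds

theorem integral_cell_lipschitz_eq_zero {k₁ k₂ : ℂ → ℂ} (hm₁ : Measurable k₁)
    (hm₂ : Measurable k₂)
    {C : ℝ} (hC₁ : ∀ z, ‖k₁ z‖ ≤ C) (hC₂ : ∀ z, ‖k₂ z‖ ≤ C)
    (hp₁ : ∀ P ∈ X.L.lattice, ∀ z, k₁ (z + P) = k₁ z)
    (hp₂ : ∀ P ∈ X.L.lattice, ∀ z, k₂ (z + P) = k₂ z)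
    (hdiv : ∀ φ : ℂ → ℝ, ContDiff ℝ ∞ φ → HasCompactSupport φ →
      ∫ z, (k₁ z * (fderiv ℝ φ z 1 : ℝ) + k₂ z * (fderiv ℝ φ z Complex.I : ℝ)) = 0)
    {K : NNReal} {w : ℂ → ℂ} (hw : LipschitzWith K w)
    (hp : ∀ P ∈ X.L.lattice, ∀ z, w (z + P) = w z) :
    ∫ z in X.cell, (k₁ z * fderiv ℝ w z 1 + k₂ z * fderiv ℝ w z Complex.I) = 0 := by
  have h1 := X.integral_cell_lipschitz_real_eq_zero hm₁ hm₂ hC₁ hC₂ hp₁ hp₂ hdiv (lipschitz_re hw)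
    (fun P hP z => by rw [hp P hP])
  have h2 := X.integral_cell_lipschitz_real_eq_zero hm₁ hm₂ hC₁ hC₂ hp₁ hp₂ hdiv (lipschitz_im hw)
    (fun P hP z => by rw [hp P hP])
  have hint : ∀ {g : ℂ → ℝ}, LipschitzWith K g → Integrable (fun z =>
      k₁ z * (fderiv ℝ g z 1 : ℝ) + k₂ z * (fderiv ℝ g z Complex.I : ℝ))
      (volume.restrict X.cell) := by
    intro g hg
    have : ∀ v, ∀ {k : ℂ → ℂ}, Measurable k → (∀ z, ‖k z‖ ≤ C) →
        Integrable (fun z => k z * (fderiv ℝ g z v : ℂ)) (volume.restrict X.cell) := by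
      intro v k hk hkC
      refine Integrable.of_bound (hk.mul (Complex.measurable_ofReal.comp
        (measurable_fderiv_apply _ _))).aestronglyMeasurable (C * (K * ‖v‖))
        (.of_forall fun z => ?_)
      rw [norm_mul, Complex.norm_real]
      exact mul_le_mul (hkC z) (((fderiv ℝ g z).le_opNorm v).trans
        (mul_le_mul_of_nonneg_right (norm_fderiv_le_of_lipschitz ℝ hg) (norm_nonneg v)))
        (norm_nonneg _) ((norm_nonneg _).trans (hkC z))
    exact (this 1 hm₁ hC₁).add (this Complex.I hm₂ hC₂)
  have h3 := integral_add (hint (lipschitz_re hw)) ((hint (lipschitz_im hw)).const_mul Complex.I)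
  rw [integral_const_mul, h1, h2, mul_zero, add_zero] at h3
  rw [← h3]
  refine integral_congr_ae ?_
  filter_upwards [ae_restrict_of_ae hw.ae_differentiableAt] with z hz
  have hv : ∀ v, fderiv ℝ w z v = (fderiv ℝ (fun z => (w z).re) z v : ℂ) +
      Complex.I * (fderiv ℝ (fun z => (w z).im) z v : ℂ) := by
    intro v
    rw [(hasFDerivAt_re hz.hasFDerivAt).fderiv, (hasFDerivAt_im hz.hasFDerivAt).fderiv]
    simp only [ContinuousLinearMap.comp_apply, Complex.reCLM_apply, Complex.imCLM_apply]
    rw [mul_comm, Complex.re_add_im]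
  rw [hv 1, hv Complex.I]
  ring

/-! ### The permittivity -/

theorem measurable_permittivity : Measurable X.permittivity := by
  have h : ∀ r : ℝ, MeasurableSet {z : ℂ | ∃ P ∈ X.L.lattice, ‖z - P‖ < r} := by
    intro r
    have : {z : ℂ | ∃ P ∈ X.L.lattice, ‖z - P‖ < r} = ⋃ P ∈ X.L.lattice, ball P r := by
      ext z; simp [dist_eq_norm]
    rw [this]
    exact (isOpen_biUnion fun P _ => isOpen_ball).measurableSet
  unfold permittivity
  exact Measurable.ite (h _) measurable_const
    (Measurable.ite (h _) measurable_const measurable_const)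

open Classical in
theorem permittivity_periodic {P : ℂ} (hP : P ∈ X.L.lattice) (z : ℂ) :
    X.permittivity (z + P) = X.permittivity z := by
  have h : ∀ r : ℝ, (∃ Q ∈ X.L.lattice, ‖z + P - Q‖ < r) ↔ ∃ Q ∈ X.L.lattice, ‖z - Q‖ < r := by
    refine fun r => ⟨fun ⟨Q, hQ, h⟩ => ⟨Q - P, sub_mem hQ hP, ?_⟩,
      fun ⟨Q, hQ, h⟩ => ⟨Q + P, add_mem hQ hP, ?_⟩⟩
    · rwa [sub_sub_eq_add_sub]
    · rwa [add_sub_add_right_eq_sub]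
  exact if_congr (h _) rfl (if_congr (h _) rfl rfl)

theorem norm_permittivity_le (z : ℂ) : ‖X.permittivity z‖ ≤ ‖X.εc‖ + ‖X.εi‖ + ‖X.εe‖ := by
  have h1 := norm_nonneg X.εc
  have h2 := norm_nonneg X.εi
  have h3 := norm_nonneg X.εe
  unfold permittivity
  split_ifs <;> linarith

/-! ### Potentials: quasi-periodicity, reciprocity, and the tensor determined by a family of
potentials -/

namespace IsPotential

variable {X} {u v : ℂ → ℂ}

/-- The function `u(z + P) - u(z)` is Lipschitz and, `∇u` being periodic, has zero gradient almost
everywhere; hence it is constant. -/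
theorem quasiPeriodic (hu : X.IsPotential u) :
    ∃ L : ℂ →L[ℝ] ℂ, ∀ P ∈ X.L.lattice, ∀ z, u (z + P) = u z + L P := by
  obtain ⟨K, hK⟩ := hu.lipschitz
  have hc : ∀ P ∈ X.L.lattice, ∀ z, u (z + P) = u z + (u P - u 0) := by
    intro P hP z
    have hl : LipschitzWith (K + K) fun z => u (z + P) - u z := by
      refine LipschitzWith.sub (LipschitzWith.of_dist_le_mul fun x y => ?_) hK
      simpa using hK.dist_le_mul (x + P) (y + P)
    have h0 : ∀ᵐ z, fderiv ℝ (fun z => u (z + P) - u z) z = 0 := by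
      have hmp := (measurePreserving_add_right (volume : Measure ℂ) P).quasiMeasurePreserving.ae
        hK.ae_differentiableAt
      filter_upwards [hK.ae_differentiableAt, hmp] with z h1 h2
      rw [fderiv_fun_sub ((differentiableAt_comp_add_right P).2 h2) h1, fderiv_comp_add_right,
        hu.periodic P hP, sub_self]
    have := eq_of_lipschitz_of_fderiv_ae_zero hl h0 z 0
    simp only [zero_add] at this
    linear_combination this
  obtain ⟨L, hL⟩ := exists_quasiPeriod X.L (U := univ) (fun _ _ _ _ => mem_univ _)
    (fun z _ => hc _ X.L.ω₁_mem_lattice z) (fun z _ => hc _ X.L.ω₂_mem_lattice z)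
  exact ⟨L, fun P hP z => hL P hP z (mem_univ z)⟩

/-- Reciprocity: `⟨𝐃 · 𝐄'⟩ = ⟨𝐃⟩ · ⟨𝐄'⟩` for two potentials. -/
theorem integral_mul_eq (hu : X.IsPotential u) (hv : X.IsPotential v) :
    ∫ z in X.cell, X.permittivity z *
      (fderiv ℝ u z 1 * fderiv ℝ v z 1 + fderiv ℝ u z Complex.I * fderiv ℝ v z Complex.I) =
    X.area * (X.avgD u 0 * X.avgE v 0 + X.avgD u 1 * X.avgE v 1) := by
  obtain ⟨K, hK⟩ := hu.lipschitz
  obtain ⟨K', hK'⟩ := hv.lipschitz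
  obtain ⟨L, hL⟩ := hv.quasiPeriodic
  have hε := X.measurable_permittivity
  set B := ‖X.εc‖ + ‖X.εi‖ + ‖X.εe‖
  have hB : 0 ≤ B := by positivity
  have hm : ∀ e, Measurable fun z => X.permittivity z * fderiv ℝ u z e := fun e =>
    hε.mul (measurable_fderiv_apply u e)
  have hb : ∀ e : ℂ, ‖e‖ = 1 → ∀ z, ‖X.permittivity z * fderiv ℝ u z e‖ ≤ B * K := by
    intro e he z
    rw [norm_mul]
    refine mul_le_mul (X.norm_permittivity_le z) ?_ (norm_nonneg _) hB
    refine ((fderiv ℝ u z).le_opNorm e).trans ?_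
    rw [he, mul_one]
    exact norm_fderiv_le_of_lipschitz ℝ hK
  have hp : ∀ e, ∀ P ∈ X.L.lattice, ∀ z, X.permittivity (z + P) * fderiv ℝ u (z + P) e =
      X.permittivity z * fderiv ℝ u z e := fun e P hP z => by
    rw [X.permittivity_periodic hP, hu.periodic P hP]
  -- The function `v - L` is periodic, so its gradient is orthogonal over the cell to `ε∇u`. Hence
  -- `∇v` may be replaced by its mean `L` in the integral.
  have hwl : LipschitzWith (K' + ‖L‖₊) fun z => v z - L z := hK'.sub L.lipschitz
  have h0 := X.integral_cell_lipschitz_eq_zero (hm 1) (hm Complex.I) (hb 1 (by simp))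
    (hb Complex.I (by simp)) (hp 1) (hp Complex.I) (fun φ h1 h2 => by
      rw [← hu.weak_eq φ h1 h2]; congr 1; ext z; ring) hwl
    (fun P hP z => by rw [hL P hP, map_add]; ring)
  have hS := X.area_ne_zero
  have hEv : ∀ e, (X.area : ℂ)⁻¹ * ∫ z in X.cell, -fderiv ℝ v z e = -L e := fun e => by
    rw [integral_neg, X.integral_cell_fderiv hK' hL, mul_neg, inv_mul_cancel_left₀ hS]
  have hi : ∀ e : ℂ, ‖e‖ = 1 → Integrable (fun z => X.permittivity z * fderiv ℝ u z e)
      (volume.restrict X.cell) := fun e he =>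
    Integrable.of_bound (hm e).aestronglyMeasurable _ (.of_forall (hb e he))
  have hi2 : ∀ e : ℂ, ‖e‖ = 1 → Integrable (fun z => (X.permittivity z * fderiv ℝ u z e) *
      fderiv ℝ v z e) (volume.restrict X.cell) := fun e he => by
    refine Integrable.of_bound ((hm e).mul (measurable_fderiv_apply v e)).aestronglyMeasurable
      (B * K * K') (.of_forall fun z => ?_)
    rw [norm_mul]
    refine mul_le_mul (hb e he z) ?_ (norm_nonneg _) (by positivity)
    refine ((fderiv ℝ v z).le_opNorm e).trans ?_
    rw [he, mul_one]
    exact norm_fderiv_le_of_lipschitz ℝ hK'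
  have h1 : ∫ z in X.cell, ((X.permittivity z * fderiv ℝ u z 1) * fderiv ℝ v z 1 +
      (X.permittivity z * fderiv ℝ u z Complex.I) * fderiv ℝ v z Complex.I -
      (X.permittivity z * fderiv ℝ u z 1) * L 1 -
        (X.permittivity z * fderiv ℝ u z Complex.I) * L Complex.I) = 0 := by
    rw [← h0]
    refine integral_congr_ae ?_
    filter_upwards [ae_restrict_of_ae hK'.ae_differentiableAt] with z hz
    have : fderiv ℝ (fun z => v z - L z) z = fderiv ℝ v z - L := by
      rw [fderiv_fun_sub hz L.differentiableAt, L.fderiv]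
    rw [this]
    simp only [sub_apply]
    ring
  simp only [sub_eq_add_neg, ← mul_neg] at h1
  rw [integral_add_four (hi2 1 (by simp)) (hi2 Complex.I (by simp))
    ((hi 1 (by simp)).mul_const _) ((hi Complex.I (by simp)).mul_const _),
    ← integral_add (hi2 1 (by simp)) (hi2 Complex.I (by simp)),
    integral_mul_const, integral_mul_const] at h1
  simp only [avgD, avgE, Matrix.cons_val_zero, Matrix.cons_val_one]
  rw [hEv, hEv, integral_neg, integral_neg]
  have : ∫ z in X.cell, X.permittivity z *
      (fderiv ℝ u z 1 * fderiv ℝ v z 1 + fderiv ℝ u z Complex.I * fderiv ℝ v z Complex.I) =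
      ∫ z in X.cell, ((X.permittivity z * fderiv ℝ u z 1) * fderiv ℝ v z 1 +
      (X.permittivity z * fderiv ℝ u z Complex.I) * fderiv ℝ v z Complex.I) := by
    congr 1; ext z; ring
  have h2 : ∀ x y : ℂ, X.area * ((X.area : ℂ)⁻¹ * x * y) = x * y := fun x y => by
    rw [mul_assoc, mul_inv_cancel_left₀ hS]
  rw [this, mul_add, h2, h2]
  linear_combination h1

theorem reciprocity (hu : X.IsPotential u) (hv : X.IsPotential v) :
    X.avgD u 0 * X.avgE v 0 + X.avgD u 1 * X.avgE v 1 =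
      X.avgD v 0 * X.avgE u 0 + X.avgD v 1 * X.avgE u 1 := by
  have h1 := integral_mul_eq hu hv
  have h2 := integral_mul_eq hv hu
  have : ∫ z in X.cell, X.permittivity z *
      (fderiv ℝ u z 1 * fderiv ℝ v z 1 + fderiv ℝ u z Complex.I * fderiv ℝ v z Complex.I) =
      ∫ z in X.cell, X.permittivity z *
      (fderiv ℝ v z 1 * fderiv ℝ u z 1 + fderiv ℝ v z Complex.I * fderiv ℝ u z Complex.I) := by
    congr 1; ext z; ring
  rw [this, h2] at h1
  exact (mul_left_cancel₀ X.area_ne_zero h1).symm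

end IsPotential

open Matrix in
/-- The effective tensor is determined by a family of potentials whose mean fields are all
fields. -/
theorem isEffectiveTensor_iff {A B : Matrix (Fin 2) (Fin 2) ℂ} (hB : B.det ≠ 0)
    (h : ∀ F : Fin 2 → ℂ, ∃ v, X.IsPotential v ∧ X.avgE v = B.mulVec F ∧ X.avgD v = A.mulVec F)
    (T : Matrix (Fin 2) (Fin 2) ℂ) : X.IsEffectiveTensor T ↔ T = A * B⁻¹ := by
  have hBu : IsUnit B.det := isUnit_iff_ne_zero.2 hB
  have hd : ∀ a b : Fin 2 → ℂ, a 0 * b 0 + a 1 * b 1 = a ⬝ᵥ b := fun a b => by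
    simp [dotProduct, Fin.sum_univ_two]
  have hrec : ∀ u, X.IsPotential u → ∀ F, X.avgD u ⬝ᵥ (B *ᵥ F) = (A *ᵥ F) ⬝ᵥ X.avgE u := by
    intro u hu F
    obtain ⟨v, hv, hE, hD⟩ := h F
    have := hu.reciprocity hv
    rwa [hd, hd, hE, hD] at this
  -- Reciprocity inside the family: this is the symmetry of the candidate `A B⁻¹`, multiplied out by
  -- `Bᵀ` and `B`.
  have hsymm : Bᵀ * A = Aᵀ * B := by
    refine Matrix.ext_of_mulVec_single fun j => ?_
    refine dotProduct_eq _ _ fun F => ?_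
    obtain ⟨v, hv, hE, hD⟩ := h (Pi.single j 1)
    have := hrec v hv F
    rw [hE, hD, dotProduct_mulVec, ← mulVec_transpose, mulVec_mulVec, dotProduct_comm (A *ᵥ F),
      dotProduct_mulVec, ← mulVec_transpose, mulVec_mulVec] at this
    exact this
  constructor
  · intro hT
    have : T * B = A := by
      refine Matrix.ext_of_mulVec_single fun j => ?_
      obtain ⟨v, hv, hE, hD⟩ := h (Pi.single j 1)
      have := hT v hv
      rw [hE, hD, mulVec_mulVec] at this
      exact this.symm
    rw [← this, Matrix.mul_nonsing_inv_cancel_right _ _ hBu]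
  · rintro rfl u hu
    -- Reciprocity between an arbitrary `u` and the whole family. By the symmetry above, `A B⁻¹ ⟨𝐄⟩`
    -- solves the same equation, and `Bᵀ` is injective.
    have h1 : Bᵀ *ᵥ X.avgD u = Aᵀ *ᵥ X.avgE u := by
      refine dotProduct_eq _ _ fun F => ?_
      have := hrec u hu F
      rwa [dotProduct_mulVec, ← mulVec_transpose, dotProduct_comm (A *ᵥ F), dotProduct_mulVec,
        ← mulVec_transpose] at this
    have hBt : IsUnit Bᵀ.det := by rwa [det_transpose]
    have h2 : Bᵀ *ᵥ ((A * B⁻¹) *ᵥ X.avgE u) = Aᵀ *ᵥ X.avgE u := by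
      rw [mulVec_mulVec, ← Matrix.mul_assoc, hsymm, Matrix.mul_nonsing_inv_cancel_right _ _ hBu]
    rw [← h2] at h1
    exact Matrix.mulVec_injective_iff_isUnit.2 ((Matrix.isUnit_iff_isUnit_det _).2 hBt) h1

end TubeArray

/-! ### Wirtinger derivatives -/

/-- The real-linear map `v ↦ α v + β v̄`. -/
noncomputable def wirtinger (α β : ℂ) : ℂ →L[ℝ] ℂ :=
  α • ContinuousLinearMap.id ℝ ℂ + β • (Complex.conjCLE : ℂ →L[ℝ] ℂ)

@[simp]
theorem wirtinger_apply (α β v : ℂ) : wirtinger α β v = α * v + β * conj v := by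
  simp [wirtinger]

theorem norm_wirtinger_le (α β : ℂ) : ‖wirtinger α β‖ ≤ ‖α‖ + ‖β‖ := by
  refine ContinuousLinearMap.opNorm_le_bound _ (by positivity) fun v => ?_
  rw [wirtinger_apply]
  refine (norm_add_le _ _).trans_eq ?_
  rw [norm_mul, norm_mul, RCLike.norm_conj, add_mul]

theorem wirtinger_add (α β α' β' : ℂ) :
    wirtinger α β + wirtinger α' β' = wirtinger (α + α') (β + β') := by
  ext v
  simp
  ring

theorem smul_wirtinger (c α β : ℂ) : c • wirtinger α β = wirtinger (c * α) (c * β) := by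
  ext v
  simp
  ring

theorem hasFDerivAt_of_hasDerivAt {f : ℂ → ℂ} {f' z : ℂ} (h : HasDerivAt f f' z) :
    HasFDerivAt f (wirtinger f' 0) z := by
  have h1 := h.hasFDerivAt.restrictScalars ℝ
  refine h1.congr_fderiv ?_
  ext v
  simp [mul_comm]

theorem hasFDerivAt_comp_conj {f : ℂ → ℂ} {f' z : ℂ} (h : HasDerivAt f f' (conj z)) :
    HasFDerivAt (fun z => f (conj z)) (wirtinger 0 f') z := by
  have h1 := h.hasFDerivAt.restrictScalars ℝ
  have h2 : HasFDerivAt (fun z => f (conj z)) _ z :=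
    HasFDerivAt.comp (g := f) z h1 (Complex.conjCLE : ℂ →L[ℝ] ℂ).hasFDerivAt
  refine h2.congr_fderiv ?_
  ext v
  simp [mul_comm]

namespace TubeArray

variable (X : TubeArray)

/-- A potential is recovered from a Lipschitz function with a Lipschitz conjugate function; the
linear parts of the two functions give the mean fields. -/
theorem isPotential_of_stream {u ψ : ℂ → ℂ} {K K' : NNReal} {Lu Lψ : ℂ →L[ℝ] ℂ}
    (hu : LipschitzWith K u) (hψ : LipschitzWith K' ψ)
    (hqu : ∀ P ∈ X.L.lattice, ∀ z, u (z + P) = u z + Lu P)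
    (hqψ : ∀ P ∈ X.L.lattice, ∀ z, ψ (z + P) = ψ z + Lψ P)
    (hae : ∀ᵐ z, ∃ α β, HasFDerivAt u (wirtinger α β) z ∧
      HasFDerivAt ψ (X.permittivity z • wirtinger (-Complex.I * α) (Complex.I * β)) z) :
    X.IsPotential u ∧ X.avgE u = ![-Lu 1, -Lu Complex.I] ∧ X.avgD u = ![-Lψ Complex.I, Lψ 1] := by
  -- These are the Cauchy–Riemann equations with weight `ε`, namely `ε u_x = ψ_y` and `ε u_y =
  -- -ψ_x`.
  have h1 : ∀ᵐ z, X.permittivity z * fderiv ℝ u z 1 = fderiv ℝ ψ z Complex.I := by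
    filter_upwards [hae] with z ⟨α, β, h1, h2⟩
    rw [h1.fderiv, h2.fderiv]
    simp only [smul_apply, wirtinger_apply, smul_eq_mul, Complex.conj_I, map_one]
    linear_combination X.permittivity z * (α + β) * Complex.I_mul_I
  have h2 : ∀ᵐ z, X.permittivity z * fderiv ℝ u z Complex.I = -fderiv ℝ ψ z 1 := by
    filter_upwards [hae] with z ⟨α, β, h1, h2⟩
    rw [h1.fderiv, h2.fderiv]
    simp only [smul_apply, wirtinger_apply, smul_eq_mul, Complex.conj_I, map_one]
    ring
  have hS := X.area_ne_zero
  refine ⟨⟨⟨K, hu⟩, fun P hP => fderiv_periodic (hqu P hP), fun φ hφ hc => ?_⟩, ?_, ?_⟩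
  · rw [← integral_curl_eq_zero hψ hφ hc 1 Complex.I]
    refine integral_congr_ae ?_
    filter_upwards [h1, h2] with z h1 h2
    rw [mul_add, ← mul_assoc, ← mul_assoc, h1, h2]
    ring
  · simp only [avgE]
    rw [integral_neg, integral_neg, X.integral_cell_fderiv hu hqu, X.integral_cell_fderiv hu hqu,
      mul_neg, mul_neg, inv_mul_cancel_left₀ hS, inv_mul_cancel_left₀ hS]
  · have e1 : ∫ z in X.cell, -(X.permittivity z * fderiv ℝ u z 1) =
        ∫ z in X.cell, -fderiv ℝ ψ z Complex.I := by
      refine integral_congr_ae ?_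
      filter_upwards [ae_restrict_of_ae h1] with z h
      rw [h]
    have e2 : ∫ z in X.cell, -(X.permittivity z * fderiv ℝ u z Complex.I) =
        ∫ z in X.cell, fderiv ℝ ψ z 1 := by
      refine integral_congr_ae ?_
      filter_upwards [ae_restrict_of_ae h2] with z h
      rw [h, neg_neg]
    simp only [avgD]
    rw [e1, e2, integral_neg, X.integral_cell_fderiv hψ hqψ, X.integral_cell_fderiv hψ hqψ,
      mul_neg, inv_mul_cancel_left₀ hS, inv_mul_cancel_left₀ hS]

/-! ### Functions that are smooth off the interfaces -/

instance countable_lattice : Countable X.L.lattice :=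
  X.L.latticeEquivProd.toEquiv.countable_iff.2 inferInstance

/-- The union of the interfaces. -/
def interfaces : Set ℂ := {z | ∃ P ∈ X.L.lattice, ‖z - P‖ = X.a ∨ ‖z - P‖ = X.b}

theorem ae_notMem_interfaces : ∀ᵐ z, z ∉ X.interfaces := by
  have : X.interfaces = ⋃ P : X.L.lattice, (sphere (P : ℂ) X.a ∪ sphere (P : ℂ) X.b) := by
    ext z
    simp [interfaces]
  rw [this, ← measure_eq_zero_iff_ae_notMem, measure_iUnion_null_iff]
  exact fun P => measure_union_null (Measure.addHaar_sphere _ _ _) (Measure.addHaar_sphere _ _ _)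

/-- The parameter is a root of a quadratic with leading coefficient `‖v‖²`, so there are at most
two. Over all interfaces the exceptional set on a segment stays countable, which the fundamental
theorem of calculus tolerates. -/
theorem countable_segment_inter_sphere {x v : ℂ} (hv : v ≠ 0) (P : ℂ) (r : ℝ) :
    {t : ℝ | ‖x + t * v - P‖ = r}.Countable := by
  have key : ∀ t : ℝ, ‖x + t * v - P‖ = r →
      ‖v‖ ^ 2 * t ^ 2 + 2 * ((x - P) * conj v).re * t + (‖x - P‖ ^ 2 - r ^ 2) = 0 := by
    intro t ht
    rw [← ht, ← Complex.normSq_eq_norm_sq, ← Complex.normSq_eq_norm_sq, ← Complex.normSq_eq_norm_sq]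
    simp only [Complex.normSq_apply, Complex.mul_re, Complex.sub_re, Complex.sub_im,
      Complex.conj_re, Complex.conj_im, Complex.add_re, Complex.add_im, Complex.mul_im,
      Complex.ofReal_re, Complex.ofReal_im]
    ring
  have hv2 : ‖v‖ ^ 2 ≠ 0 := by positivity
  by_cases hs : {t : ℝ | ‖x + t * v - P‖ = r}.Subsingleton
  · exact hs.countable
  · obtain ⟨t₁, h₁, t₂, h₂, hne⟩ := Set.not_subsingleton_iff.1 hs
    refine (Set.toFinite {t₁, t₂}).countable.mono fun t ht => ?_
    have e := key t ht
    have e₁ := key t₁ h₁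
    have e₂ := key t₂ h₂
    have h3 : ‖v‖ ^ 2 * (t₁ + t₂) + 2 * ((x - P) * conj v).re = 0 := by
      have : (t₁ - t₂) * (‖v‖ ^ 2 * (t₁ + t₂) + 2 * ((x - P) * conj v).re) = 0 := by
        linear_combination e₁ - e₂
      exact (mul_eq_zero.1 this).resolve_left (sub_ne_zero.2 hne)
    have h4 : ‖v‖ ^ 2 * ((t - t₁) * (t - t₂)) = 0 := by
      linear_combination e - e₁ - (t - t₁) * h3
    rcases mul_eq_zero.1 ((mul_eq_zero.1 h4).resolve_left hv2) with h | h
    · exact Or.inl (sub_eq_zero.1 h)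
    · exact Or.inr (sub_eq_zero.1 h)

/-- A continuous function with bounded gradient off the interfaces is Lipschitz. -/
theorem lipschitz_of_fderiv_bound {w : ℂ → ℂ} (hc : Continuous w) {K : NNReal}
    (hd : ∀ z ∉ X.interfaces, DifferentiableAt ℝ w z ∧ ‖fderiv ℝ w z‖ ≤ K) : LipschitzWith K w := by
  refine LipschitzWith.of_dist_le_mul fun y x => ?_
  rcases eq_or_ne y x with rfl | hne
  · simp
  set v := y - x
  have hv : v ≠ 0 := sub_ne_zero.2 hne
  let γ : ℝ → ℂ := fun t => x + t * v
  have hγ : Continuous γ := by fun_prop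
  have hs : {t : ℝ | γ t ∈ X.interfaces}.Countable := by
    have : {t : ℝ | γ t ∈ X.interfaces} = ⋃ P : X.L.lattice,
        ({t : ℝ | ‖x + t * v - P‖ = X.a} ∪ {t : ℝ | ‖x + t * v - P‖ = X.b}) := by
      ext t
      simp [interfaces, γ]
    rw [this]
    exact countable_iUnion fun P => (countable_segment_inter_sphere hv _ _).union
      (countable_segment_inter_sphere hv _ _)
  have hder : ∀ t : ℝ, γ t ∉ X.interfaces →
      HasDerivAt (fun t => w (γ t)) (fderiv ℝ w (γ t) v) t := by
    intro t ht
    have h1 : HasDerivAt γ v t := by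
      have := ((Complex.ofRealCLM.hasDerivAt (x := t)).mul_const v).const_add x
      rwa [Complex.ofRealCLM_apply, Complex.ofReal_one, one_mul] at this
    exact (hd _ ht).1.hasFDerivAt.comp_hasDerivAt t h1
  have hbd : ∀ᵐ t : ℝ, ‖fderiv ℝ w (γ t) v‖ ≤ K * ‖v‖ := by
    filter_upwards [hs.ae_notMem volume] with t ht
    exact ((fderiv ℝ w (γ t)).le_opNorm v).trans
      (mul_le_mul_of_nonneg_right (hd _ ht).2 (norm_nonneg v))
  have hint : IntervalIntegrable (fun t => fderiv ℝ w (γ t) v) volume 0 1 := by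
    refine (intervalIntegrable_const (c := K * ‖v‖)).mono_fun
      ((measurable_fderiv_apply w v).comp hγ.measurable).aestronglyMeasurable ?_
    filter_upwards [ae_restrict_of_ae hbd] with t ht
    rwa [Real.norm_of_nonneg (r := K * ‖v‖) (by positivity)]
  have hftc := integral_eq_of_hasDerivAt_off_countable (fun t => w (γ t))
    (fun t => fderiv ℝ w (γ t) v) hs (hc.comp hγ).continuousOn
    (fun t ht => hder t ht.2) hint
  have hb := intervalIntegral.norm_integral_le_of_norm_le_const_ae (a := 0) (b := 1)
    (hbd.mono fun t ht _ => ht)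
  rw [hftc] at hb
  simpa [γ, v, dist_eq_norm] using hb

/-! ### Gluing -/

/-- The closed region outside the tubes. -/
def outside : Set ℂ := {z | ∀ P ∈ X.L.lattice, X.a ≤ ‖z - P‖}

open Classical in
/-- The function equal to `Fo` outside the tubes and to `Fd (z - P) + L P` in the tube around
`P`. -/
noncomputable def glue (L : ℂ →L[ℝ] ℂ) (Fd Fo : ℂ → ℂ) (z : ℂ) : ℂ :=
  if h : ∃ P ∈ X.L.lattice, ‖z - P‖ < X.a then Fd (z - h.choose) + L h.choose else Fo z

variable {X}

/-- One inequality is weak, since tubes may touch: a point of a closed tube still lies in no other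
open tube. -/
theorem eq_of_norm_sub_lt {P Q z : ℂ} (hP : P ∈ X.L.lattice) (hQ : Q ∈ X.L.lattice)
    (h1 : ‖z - P‖ ≤ X.a) (h2 : ‖z - Q‖ < X.a) : P = Q := by
  by_contra hne
  have h3 := X.two_mul_a_le (P - Q) (sub_mem hP hQ) (sub_ne_zero.2 hne)
  have h4 : ‖P - Q‖ ≤ ‖z - Q‖ + ‖z - P‖ := by
    rw [show P - Q = (z - Q) - (z - P) by ring]; exact norm_sub_le _ _
  linarith

variable {L : ℂ →L[ℝ] ℂ} {Fd Fo : ℂ → ℂ}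

theorem glue_of_lt {P z : ℂ} (hP : P ∈ X.L.lattice) (hz : ‖z - P‖ < X.a) :
    X.glue L Fd Fo z = Fd (z - P) + L P := by
  have h : ∃ P ∈ X.L.lattice, ‖z - P‖ < X.a := ⟨P, hP, hz⟩
  rw [glue, dif_pos h, eq_of_norm_sub_lt h.choose_spec.1 hP h.choose_spec.2.le hz]

theorem glue_of_mem_outside {z : ℂ} (hz : z ∈ X.outside) : X.glue L Fd Fo z = Fo z := by
  rw [glue, dif_neg]
  rintro ⟨P, hP, h⟩
  exact absurd h (not_lt.2 (hz P hP))

theorem mem_outside_of_norm_eq {P z : ℂ} (hP : P ∈ X.L.lattice) (hz : ‖z - P‖ = X.a) :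
    z ∈ X.outside := by
  intro Q hQ
  by_contra h
  have := eq_of_norm_sub_lt hP hQ hz.le (not_le.1 h)
  subst this
  exact h hz.ge

theorem add_mem_outside_iff {P z : ℂ} (hP : P ∈ X.L.lattice) :
    z + P ∈ X.outside ↔ z ∈ X.outside := by
  refine ⟨fun h Q hQ => ?_, fun h Q hQ => ?_⟩
  · have := h (Q + P) (add_mem hQ hP)
    rwa [add_sub_add_right_eq_sub] at this
  · have := h (Q - P) (sub_mem hQ hP)
    rwa [sub_sub_eq_add_sub] at this

theorem mem_outside_or (z : ℂ) : z ∈ X.outside ∨ ∃ P ∈ X.L.lattice, ‖z - P‖ < X.a := by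
  by_cases h : ∃ P ∈ X.L.lattice, ‖z - P‖ < X.a
  · exact Or.inr h
  · push Not at h
    exact Or.inl h

theorem glue_quasiPeriodic (hq : ∀ P ∈ X.L.lattice, ∀ z ∈ X.outside, Fo (z + P) = Fo z + L P)
    {P : ℂ} (hP : P ∈ X.L.lattice) (z : ℂ) :
    X.glue L Fd Fo (z + P) = X.glue L Fd Fo z + L P := by
  rcases mem_outside_or (X := X) z with h | ⟨Q, hQ, h⟩
  · rw [glue_of_mem_outside h, glue_of_mem_outside ((add_mem_outside_iff hP).2 h), hq P hP z h]
  · have h' : ‖z + P - (Q + P)‖ < X.a := by rwa [add_sub_add_right_eq_sub]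
    rw [glue_of_lt hQ h, glue_of_lt (add_mem hQ hP) h', add_sub_add_right_eq_sub, map_add,
      add_assoc]

/-- Matching is required on the circle about the origin only; the quasi-periodicity of `Fo` carries
it to the other circles. -/
theorem glue_of_le (hq : ∀ P ∈ X.L.lattice, ∀ z ∈ X.outside, Fo (z + P) = Fo z + L P)
    (hm : ∀ z, ‖z‖ = X.a → Fd z = Fo z) {P z : ℂ} (hP : P ∈ X.L.lattice) (hz : ‖z - P‖ ≤ X.a) :
    X.glue L Fd Fo z = Fd (z - P) + L P := by
  rcases hz.lt_or_eq with h | h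
  · exact glue_of_lt hP h
  · have h2 : z - P ∈ X.outside :=
      mem_outside_of_norm_eq (P := 0) (zero_mem _) (by rwa [sub_zero])
    rw [glue_of_mem_outside (mem_outside_of_norm_eq hP h), hm _ h, ← hq P hP _ h2, sub_add_cancel]

variable (X) in
theorem finite_lattice_norm_sub_le (x : ℂ) (r : ℝ) :
    {P : X.L.lattice | ‖(P : ℂ) - x‖ ≤ r}.Finite := by
  have h : IsCompact {P : X.L.lattice | ‖(P : ℂ) - x‖ ≤ r} := by
    have : {P : X.L.lattice | ‖(P : ℂ) - x‖ ≤ r} = Subtype.val ⁻¹' closedBall x r := by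
      ext P; simp [dist_eq_norm]
    rw [this]
    exact (X.L.isClosed_lattice.isClosedEmbedding_subtypeVal).isCompact_preimage
      (isCompact_closedBall x r)
  exact h.finite_of_discrete

variable (X) in
theorem locallyFinite_closedBall (r : ℝ) :
    LocallyFinite fun P : X.L.lattice => closedBall (P : ℂ) r := by
  intro x
  refine ⟨ball x 1, ball_mem_nhds x one_pos, (X.finite_lattice_norm_sub_le x (r + 1)).subset ?_⟩
  rintro P ⟨z, hz1, hz2⟩
  rw [mem_closedBall, dist_eq_norm] at hz1
  rw [mem_ball, dist_eq_norm] at hz2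
  have : ‖(P : ℂ) - x‖ ≤ ‖z - x‖ + ‖z - P‖ := by
    rw [show (P : ℂ) - x = (z - x) - (z - P) by ring]; exact norm_sub_le _ _
  simp only [mem_ofPred_eq]
  linarith

variable (X) in
theorem isOpen_strict_outside (r : ℝ) : IsOpen {z : ℂ | ∀ P ∈ X.L.lattice, r < ‖z - P‖} := by
  have : {z : ℂ | ∀ P ∈ X.L.lattice, r < ‖z - P‖} = (⋃ P : X.L.lattice, closedBall (P : ℂ) r)ᶜ := by
    ext z; simp [dist_eq_norm]
  rw [this, isOpen_compl_iff]
  exact (X.locallyFinite_closedBall r).isClosed_iUnion fun P => isClosed_closedBall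

variable (X) in
theorem isClosed_outside : IsClosed X.outside := by
  have : X.outside = (⋃ P : X.L.lattice, ball (P : ℂ) X.a)ᶜ := by
    ext z; simp [outside, dist_eq_norm]
  rw [this, isClosed_compl_iff]
  exact isOpen_iUnion fun P => isOpen_ball

theorem continuous_glue (hq : ∀ P ∈ X.L.lattice, ∀ z ∈ X.outside, Fo (z + P) = Fo z + L P)
    (hm : ∀ z, ‖z‖ = X.a → Fd z = Fo z) (hd : ContinuousOn Fd (closedBall 0 X.a))
    (ho : ContinuousOn Fo X.outside) : Continuous (X.glue L Fd Fo) := by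
  -- A locally finite closed cover of the plane: the index `none` is the exterior, the others are
  -- the closed tubes.
  let s : Option X.L.lattice → Set ℂ := fun o => o.elim X.outside fun P => closedBall (P : ℂ) X.a
  have hlf : LocallyFinite s := by
    intro x
    obtain ⟨t, ht, hf⟩ := X.locallyFinite_closedBall X.a x
    refine ⟨t, ht, ((hf.image some).insert none).subset ?_⟩
    rintro (_ | P) hP
    · exact Or.inl rfl
    · exact Or.inr ⟨P, hP, rfl⟩
  refine hlf.continuous ?_ ?_ ?_
  · refine eq_univ_of_forall fun z => mem_iUnion.2 ?_
    rcases mem_outside_or (X := X) z with h | ⟨Q, hQ, h⟩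
    · exact ⟨none, h⟩
    · exact ⟨some ⟨Q, hQ⟩, mem_closedBall_iff_norm.2 h.le⟩
  · rintro (_ | P)
    exacts [X.isClosed_outside, isClosed_closedBall]
  · rintro (_ | P)
    · exact ho.congr fun z hz => glue_of_mem_outside hz
    · have : ContinuousOn (fun z => Fd (z - P) + L P) (closedBall (P : ℂ) X.a) := by
        refine (hd.comp (by fun_prop) fun z hz => ?_).add continuousOn_const
        rw [mem_closedBall_zero_iff]
        exact mem_closedBall_iff_norm.1 hz
      exact this.congr fun z hz => glue_of_le hq hm P.2 (mem_closedBall_iff_norm.1 hz)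

theorem hasFDerivAt_glue_inside {P z : ℂ} (hP : P ∈ X.L.lattice) (hz : ‖z - P‖ < X.a)
    {F' : ℂ →L[ℝ] ℂ} (h : HasFDerivAt Fd F' (z - P)) : HasFDerivAt (X.glue L Fd Fo) F' z := by
  have h1 : HasFDerivAt (fun z => Fd (z - P) + L P) F' z :=
    (h.comp z ((hasFDerivAt_id z).sub_const P)).add_const _
  refine h1.congr_of_eventuallyEq ?_
  have : ball P X.a ∈ 𝓝 z := isOpen_ball.mem_nhds (mem_ball_iff_norm.2 hz)
  filter_upwards [this] with y hy
  exact glue_of_lt hP (mem_ball_iff_norm.1 hy)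

theorem hasFDerivAt_glue_outside {z : ℂ} (hz : ∀ P ∈ X.L.lattice, X.a < ‖z - P‖)
    {F' : ℂ →L[ℝ] ℂ} (h : HasFDerivAt Fo F' z) : HasFDerivAt (X.glue L Fd Fo) F' z := by
  refine h.congr_of_eventuallyEq ?_
  filter_upwards [(X.isOpen_strict_outside X.a).mem_nhds hz] with y hy
  exact glue_of_mem_outside fun P hP => (hy P hP).le

theorem cases_of_notMem_interfaces {z : ℂ} (hz : z ∉ X.interfaces) :
    (∀ P ∈ X.L.lattice, X.a < ‖z - P‖) ∨
      ∃ P ∈ X.L.lattice, ‖z - P‖ < X.a ∧ ‖z - P‖ ≠ X.b := by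
  simp only [interfaces, mem_ofPred_eq, not_exists, not_and, not_or] at hz
  rcases mem_outside_or (X := X) z with h | ⟨Q, hQ, h⟩
  · exact Or.inl fun P hP => lt_of_le_of_ne (h P hP) (Ne.symm (hz P hP).1)
  · exact Or.inr ⟨Q, hQ, h, (hz Q hQ).2⟩

theorem permittivity_outside {z : ℂ} (hz : ∀ P ∈ X.L.lattice, X.a < ‖z - P‖) :
    X.permittivity z = X.εe := by
  rw [permittivity, if_neg, if_neg]
  · rintro ⟨P, hP, h⟩
    exact absurd h (hz P hP).not_gt
  · rintro ⟨P, hP, h⟩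
    exact absurd (h.trans X.b_lt_a) (hz P hP).not_gt

theorem permittivity_inside {P z : ℂ} (hP : P ∈ X.L.lattice) (hz : ‖z - P‖ < X.a) :
    X.permittivity z = if ‖z - P‖ < X.b then X.εc else X.εi := by
  rw [permittivity]
  split_ifs with h1 h2 h3 h4
  · rfl
  · obtain ⟨Q, hQ, h⟩ := h1
    rw [eq_of_norm_sub_lt hQ hP (h.le.trans X.b_lt_a.le) hz] at h
    exact absurd h h2
  · exact absurd ⟨P, hP, h4⟩ h1
  · rfl
  · exact absurd ⟨P, hP, hz⟩ h3
  · exact absurd ⟨P, hP, hz⟩ h3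

/-- Gluing a field outside the tubes to a field in a tube gives a potential. -/
theorem isPotential_glue {Lu Lψ : ℂ →L[ℝ] ℂ} {Du Dψ Ou Oψ : ℂ → ℂ} {K : ℝ}
    (hqu : ∀ P ∈ X.L.lattice, ∀ z ∈ X.outside, Ou (z + P) = Ou z + Lu P)
    (hqψ : ∀ P ∈ X.L.lattice, ∀ z ∈ X.outside, Oψ (z + P) = Oψ z + Lψ P)
    (hmu : ∀ z, ‖z‖ = X.a → Du z = Ou z) (hmψ : ∀ z, ‖z‖ = X.a → Dψ z = Oψ z)
    (hcDu : ContinuousOn Du (closedBall 0 X.a)) (hcDψ : ContinuousOn Dψ (closedBall 0 X.a))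
    (hcOu : ContinuousOn Ou X.outside) (hcOψ : ContinuousOn Oψ X.outside)
    (hO : ∀ z ∈ X.outside, ∃ α β, ‖α‖ ≤ K ∧ ‖β‖ ≤ K ∧ HasFDerivAt Ou (wirtinger α β) z ∧
      HasFDerivAt Oψ (X.εe • wirtinger (-Complex.I * α) (Complex.I * β)) z)
    (hD : ∀ z, ‖z‖ < X.a → ‖z‖ ≠ X.b → ∃ α β, ‖α‖ ≤ K ∧ ‖β‖ ≤ K ∧
      HasFDerivAt Du (wirtinger α β) z ∧
      HasFDerivAt Dψ ((if ‖z‖ < X.b then X.εc else X.εi) •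
        wirtinger (-Complex.I * α) (Complex.I * β)) z) :
    X.IsPotential (X.glue Lu Du Ou) ∧
      X.avgE (X.glue Lu Du Ou) = ![-Lu 1, -Lu Complex.I] ∧
      X.avgD (X.glue Lu Du Ou) = ![-Lψ Complex.I, Lψ 1] := by
  have hloc : ∀ z ∉ X.interfaces, ∃ α β, ‖α‖ ≤ K ∧ ‖β‖ ≤ K ∧
      HasFDerivAt (X.glue Lu Du Ou) (wirtinger α β) z ∧
      HasFDerivAt (X.glue Lψ Dψ Oψ)
        (X.permittivity z • wirtinger (-Complex.I * α) (Complex.I * β)) z := by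
    intro z hz
    rcases cases_of_notMem_interfaces hz with h | ⟨P, hP, h1, h2⟩
    · obtain ⟨α, β, h1, h2, h3, h4⟩ := hO z fun P hP => (h P hP).le
      rw [permittivity_outside h]
      exact ⟨α, β, h1, h2, hasFDerivAt_glue_outside h h3, hasFDerivAt_glue_outside h h4⟩
    · obtain ⟨α, β, h3, h4, h5, h6⟩ := hD (z - P) h1 h2
      rw [permittivity_inside hP h1]
      exact ⟨α, β, h3, h4, hasFDerivAt_glue_inside hP h1 h5, hasFDerivAt_glue_inside hP h1 h6⟩
  set B := ‖X.εc‖ + ‖X.εi‖ + ‖X.εe‖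
  have hB : 0 ≤ B := by positivity
  refine X.isPotential_of_stream (K := Real.toNNReal (K + K)) (K' := Real.toNNReal (B * (K + K)))
    (ψ := X.glue Lψ Dψ Oψ)
    (X.lipschitz_of_fderiv_bound (continuous_glue hqu hmu hcDu hcOu) fun z hz => ?_)
    (X.lipschitz_of_fderiv_bound (continuous_glue hqψ hmψ hcDψ hcOψ) fun z hz => ?_)
    (fun P hP => glue_quasiPeriodic hqu hP) (fun P hP => glue_quasiPeriodic hqψ hP) ?_
  · obtain ⟨α, β, h1, h2, h3, -⟩ := hloc z hz
    refine ⟨h3.differentiableAt, ?_⟩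
    rw [h3.fderiv]
    exact ((norm_wirtinger_le α β).trans (add_le_add h1 h2)).trans (Real.le_coe_toNNReal _)
  · obtain ⟨α, β, h1, h2, -, h3⟩ := hloc z hz
    refine ⟨h3.differentiableAt, le_trans ?_ (Real.le_coe_toNNReal _)⟩
    rw [h3.fderiv, norm_smul]
    refine mul_le_mul (X.norm_permittivity_le z) ((norm_wirtinger_le _ _).trans ?_)
      (norm_nonneg _) hB
    simpa using add_le_add h1 h2
  · filter_upwards [X.ae_notMem_interfaces] with z hz
    obtain ⟨α, β, -, -, h3, h4⟩ := hloc z hz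
    exact ⟨α, β, h3, h4⟩

end TubeArray

/-- The local form of every field constructed below, paired with its conjugate function in a phase
of permittivity `ε`. -/
theorem hasFDerivAt_add_conj {f g : ℂ → ℂ} {f' g' z : ℂ} (hf : HasDerivAt f f' z)
    (hg : HasDerivAt g g' (conj z)) (ε : ℂ) :
    HasFDerivAt (fun z => f z + g (conj z)) (wirtinger f' g') z ∧
      HasFDerivAt (fun z => ε * (-Complex.I * f z + Complex.I * g (conj z)))
        (ε • wirtinger (-Complex.I * f') (Complex.I * g')) z := by
  have h1 := hasFDerivAt_of_hasDerivAt hf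
  have h2 := hasFDerivAt_comp_conj hg
  refine ⟨(h1.add h2).congr_fderiv (by rw [wirtinger_add, add_zero, zero_add]), ?_⟩
  refine (((h1.const_mul (-Complex.I)).add (h2.const_mul Complex.I)).const_mul ε).congr_fderiv ?_
  rw [smul_wirtinger, smul_wirtinger, wirtinger_add, mul_zero, mul_zero, add_zero, zero_add]

theorem exists_deriv_bound {Φ : ℂ → ℂ} {t : ℝ} (ht : 1 < t) (hΦ : DifferentiableOn ℂ Φ (ball 0 t)) :
    ∃ C, 0 ≤ C ∧ ∀ z, ‖z‖ ≤ 1 → ‖deriv Φ z‖ ≤ C := by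
  have hc : ContinuousOn (deriv Φ) (closedBall 0 1) :=
    (hΦ.deriv isOpen_ball).continuousOn.mono (closedBall_subset_ball ht)
  obtain ⟨C, hC⟩ := (isCompact_closedBall (0 : ℂ) 1).exists_bound_of_continuousOn hc
  exact ⟨C, (norm_nonneg _).trans (hC 0 (by simp)), fun z hz => hC z (by simpa using hz)⟩

namespace TubeArray

variable (X : TubeArray)

/-! ### The field in a coated tube -/

/-- The holomorphic part of the potential in the core. -/
noncomputable def coreField (Φ : ℂ → ℂ) (z : ℂ) : ℂ := X.a * (1 + X.α') * Φ (z / X.a)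

/-- The holomorphic part of the potential in the coating. -/
noncomputable def coatField (Φ Φ' : ℂ → ℂ) (z : ℂ) : ℂ :=
  X.a * (Φ (z / X.a) + X.α' * Φ' ((X.b : ℂ) ^ 2 / (X.a * z)))

/-- The potential in the tube around the origin. -/
noncomputable def tubePotential (Φ Φ' : ℂ → ℂ) (z : ℂ) : ℂ :=
  if ‖z‖ < X.b then X.coreField Φ z + X.coreField Φ' (conj z)
  else X.coatField Φ Φ' z + X.coatField Φ' Φ (conj z)

/-- The conjugate function of the potential in the tube around the origin. -/
noncomputable def tubeStream (Φ Φ' : ℂ → ℂ) (z : ℂ) : ℂ :=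
  if ‖z‖ < X.b then
    X.εc * (-Complex.I * X.coreField Φ z + Complex.I * X.coreField Φ' (conj z))
  else X.εi * (-Complex.I * X.coatField Φ Φ' z + Complex.I * X.coatField Φ' Φ (conj z))

variable {X} {Φ Φ' : ℂ → ℂ} {t : ℝ}

theorem a_ne_zero : (X.a : ℂ) ≠ 0 := Complex.ofReal_ne_zero.2 X.a_pos.ne'

theorem norm_div_a (z : ℂ) : ‖z / X.a‖ = ‖z‖ / X.a := by
  rw [norm_div, Complex.norm_real, Real.norm_of_nonneg X.a_pos.le]

theorem norm_div_a_le {z : ℂ} (hz : ‖z‖ ≤ X.a) : ‖z / X.a‖ ≤ 1 := by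
  rw [norm_div_a]
  exact (div_le_one X.a_pos).2 hz

theorem norm_reflect_le {z : ℂ} (hz : X.b ≤ ‖z‖) : ‖(X.b : ℂ) ^ 2 / (X.a * z)‖ ≤ 1 := by
  rw [norm_div, norm_mul, norm_pow, Complex.norm_real, Complex.norm_real,
    Real.norm_of_nonneg X.a_pos.le, Real.norm_of_nonneg X.b_nonneg]
  refine div_le_one_of_le₀ ?_ (mul_nonneg X.a_pos.le (norm_nonneg z))
  nlinarith [X.b_nonneg, X.b_lt_a, X.a_pos]

/-- On the core circle the image point of `z` is `z̄`, up to the scaling by `a`, so image terms in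
`z` become terms in `z̄`. For `b = 0` the only point is `z = 0`, and `0 / 0 = 0` gives the right
value. -/
theorem reflect_eq {z : ℂ} (hz : ‖z‖ = X.b) : (X.b : ℂ) ^ 2 / (X.a * z) = conj z / X.a := by
  have h : z * conj z = (X.b : ℂ) ^ 2 := by
    rw [Complex.mul_conj, Complex.normSq_eq_norm_sq, hz]; push_cast; ring
  have ha : (X.a : ℂ) ≠ 0 := a_ne_zero
  rcases eq_or_ne z 0 with rfl | h0
  · simp
  · rw [← h]
    field_simp

/-- This is the flux condition at the core: there an image of strength `α̃` leaves the factor `1 -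
α̃` in the coating's conjugate function, against `1 + α̃` in the core. -/
theorem εi_mul_one_sub_α' : X.εi * (1 - X.α') = X.εc * (1 + X.α') := by
  have := X.εi_add_εc_ne_zero
  rw [α']
  field_simp
  ring

/-- On `‖z‖ = b` each image term merges with the direct term of the other function, giving the
common factor `1 + α̃`. So the core formula extends to the closed core, for arbitrary `Φ` and `Φ'`.
-/
theorem tubePotential_of_le {z : ℂ} (hz : ‖z‖ ≤ X.b) :
    X.tubePotential Φ Φ' z = X.coreField Φ z + X.coreField Φ' (conj z) := by
  rw [tubePotential]
  split_ifs with h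
  · rfl
  · have hb : ‖z‖ = X.b := le_antisymm hz (not_lt.1 h)
    have hb' : ‖conj z‖ = X.b := by rwa [RCLike.norm_conj]
    rw [coatField, coatField, reflect_eq hb, reflect_eq hb', coreField, coreField,
      RCLike.conj_conj]
    ring

theorem tubeStream_of_le {z : ℂ} (hz : ‖z‖ ≤ X.b) :
    X.tubeStream Φ Φ' z =
      X.εc * (-Complex.I * X.coreField Φ z + Complex.I * X.coreField Φ' (conj z)) := by
  rw [tubeStream]
  split_ifs with h
  · rfl
  · have hb : ‖z‖ = X.b := le_antisymm hz (not_lt.1 h)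
    have hb' : ‖conj z‖ = X.b := by rwa [RCLike.norm_conj]
    rw [coatField, coatField, reflect_eq hb, reflect_eq hb', coreField, coreField,
      RCLike.conj_conj]
    linear_combination Complex.I * X.a * (Φ' (conj z / X.a) - Φ (z / X.a)) * X.εi_mul_one_sub_α'

theorem hasDerivAt_coreField (ht : 1 < t) (hΦ : DifferentiableOn ℂ Φ (ball 0 t)) {z : ℂ}
    (hz : ‖z‖ ≤ X.a) : HasDerivAt (X.coreField Φ) ((1 + X.α') * deriv Φ (z / X.a)) z := by
  have hd : DifferentiableAt ℂ Φ (z / X.a) := (hΦ _ (by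
    simpa using (norm_div_a_le hz).trans_lt ht)).differentiableAt (isOpen_ball.mem_nhds (by
    simpa using (norm_div_a_le hz).trans_lt ht))
  have h := (hd.hasDerivAt.comp z ((hasDerivAt_id z).div_const (X.a : ℂ))).const_mul
    (X.a * (1 + X.α'))
  refine h.congr_deriv ?_
  have ha : (X.a : ℂ) ≠ 0 := a_ne_zero
  field_simp

theorem hasDerivAt_coatField (ht : 1 < t) (hΦ : DifferentiableOn ℂ Φ (ball 0 t))
    (hΦ' : DifferentiableOn ℂ Φ' (ball 0 t)) {z : ℂ} (h0 : z ≠ 0) (hb : X.b ≤ ‖z‖)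
    (hz : ‖z‖ ≤ X.a) :
    HasDerivAt (X.coatField Φ Φ') (deriv Φ (z / X.a) -
      X.α' * deriv Φ' ((X.b : ℂ) ^ 2 / (X.a * z)) * ((X.b : ℂ) ^ 2 / z ^ 2)) z := by
  have hmem : ∀ {w : ℂ}, ‖w‖ ≤ 1 → ball (0 : ℂ) t ∈ 𝓝 w := fun {w} hw =>
    isOpen_ball.mem_nhds (by simpa using hw.trans_lt ht)
  have hd := hΦ.differentiableAt (hmem (norm_div_a_le hz))
  have hd' := hΦ'.differentiableAt (hmem (norm_reflect_le hb))
  have ha : (X.a : ℂ) ≠ 0 := a_ne_zero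
  have h1 := hd.hasDerivAt.comp z ((hasDerivAt_id z).div_const (X.a : ℂ))
  have h2 : HasDerivAt (fun z : ℂ => (X.b : ℂ) ^ 2 / (X.a * z))
      (-((X.b : ℂ) ^ 2 / (X.a * z ^ 2))) z := by
    have := ((hasDerivAt_const z ((X.b : ℂ) ^ 2)).div ((hasDerivAt_id z).const_mul (X.a : ℂ))
      (mul_ne_zero ha h0))
    refine this.congr_deriv ?_
    simp only [id]
    field_simp
    ring
  have h := (h1.add ((hd'.hasDerivAt.comp z h2).const_mul X.α')).const_mul (X.a : ℂ)
  refine h.congr_deriv ?_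
  field_simp
  ring

theorem continuousOn_coreField (ht : 1 < t) (hΦ : DifferentiableOn ℂ Φ (ball 0 t)) :
    ContinuousOn (X.coreField Φ) {z | ‖z‖ ≤ X.a} := fun _ hz =>
  (hasDerivAt_coreField ht hΦ hz).continuousAt.continuousWithinAt

/-- If `b = 0`, the coating contains the centre; there the image term is the constant `Φ' 0`. -/
theorem continuousOn_coatField (ht : 1 < t) (hΦ : DifferentiableOn ℂ Φ (ball 0 t))
    (hΦ' : DifferentiableOn ℂ Φ' (ball 0 t)) :
    ContinuousOn (X.coatField Φ Φ') {z | X.b ≤ ‖z‖ ∧ ‖z‖ ≤ X.a} := by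
  intro z hz
  rcases eq_or_ne z 0 with rfl | h0
  · have hb : X.b = 0 := le_antisymm (by simpa using hz.1) X.b_nonneg
    have : X.coatField Φ Φ' = fun z => X.a * (Φ (z / X.a) + X.α' * Φ' 0) := by
      ext z
      simp [coatField, hb]
    rw [this]
    have hd : DifferentiableAt ℂ Φ (0 / X.a) := hΦ.differentiableAt
      (isOpen_ball.mem_nhds (by simpa using zero_lt_one.trans ht))
    have hc : ContinuousAt (fun z : ℂ => Φ (z / X.a)) 0 :=
      ContinuousAt.comp (g := Φ) (f := fun z : ℂ => z / X.a) hd.continuousAt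
        (continuous_id.div_const _).continuousAt
    exact (continuousAt_const.mul (hc.add continuousAt_const)).continuousWithinAt
  · exact (hasDerivAt_coatField ht hΦ hΦ' h0 hz.1 hz.2).continuousAt.continuousWithinAt

theorem continuousOn_tube {F G F' G' D : ℂ → ℂ}
    (h1 : ∀ z, ‖z‖ ≤ X.b → D z = F z + G (conj z))
    (h2 : ∀ z, X.b ≤ ‖z‖ → D z = F' z + G' (conj z))
    (hF : ContinuousOn F {z | ‖z‖ ≤ X.a}) (hG : ContinuousOn G {z | ‖z‖ ≤ X.a})
    (hF' : ContinuousOn F' {z | X.b ≤ ‖z‖ ∧ ‖z‖ ≤ X.a})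
    (hG' : ContinuousOn G' {z | X.b ≤ ‖z‖ ∧ ‖z‖ ≤ X.a}) :
    ContinuousOn D (closedBall 0 X.a) := by
  have hcover : closedBall (0 : ℂ) X.a = {z | ‖z‖ ≤ X.b} ∪ {z | X.b ≤ ‖z‖ ∧ ‖z‖ ≤ X.a} := by
    ext z
    simp only [mem_closedBall_zero_iff, mem_union, mem_ofPred_eq]
    have := X.b_lt_a
    constructor
    · intro h
      rcases le_total ‖z‖ X.b with h' | h'
      exacts [Or.inl h', Or.inr ⟨h', h⟩]
    · rintro (h | h)
      exacts [h.trans this.le, h.2]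
  rw [hcover]
  have hconj : ∀ s : Set ℂ, ContinuousOn (fun z : ℂ => conj z) s := fun s =>
    Complex.continuous_conj.continuousOn
  refine ContinuousOn.union_of_isClosed ?_ ?_ (isClosed_le continuous_norm continuous_const)
    ((isClosed_le continuous_const continuous_norm).inter
      (isClosed_le continuous_norm continuous_const))
  · have hsub : {z : ℂ | ‖z‖ ≤ X.b} ⊆ {z | ‖z‖ ≤ X.a} := fun z hz => le_trans hz X.b_lt_a.le
    refine ((hF.mono hsub).add (hG.comp (hconj _) fun z hz => ?_)).congr fun z hz => h1 z hz
    simpa using hsub hz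
  · refine (hF'.add (hG'.comp (hconj _) fun z hz => ?_)).congr fun z hz => h2 z hz.1
    simpa using hz

/-- A potential is determined by holomorphic functions `fo`, `go` outside the tubes and `Φ`, `Φ'`
in the tubes that satisfy the interface conditions on the outer circle. -/
theorem exists_potential {fo go : ℂ → ℂ} {K : ℝ} {cf cg : ℂ →L[ℝ] ℂ} (ht : 1 < t)
    (hΦ : DifferentiableOn ℂ Φ (ball 0 t)) (hΦ' : DifferentiableOn ℂ Φ' (ball 0 t))
    (hfo : ∀ z ∈ X.outside, DifferentiableAt ℂ fo z ∧ ‖deriv fo z‖ ≤ K)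
    (hgo : ∀ z ∈ X.outside, DifferentiableAt ℂ go (conj z) ∧ ‖deriv go (conj z)‖ ≤ K)
    (hqf : ∀ P ∈ X.L.lattice, ∀ z ∈ X.outside, fo (z + P) = fo z + cf P)
    (hqg : ∀ P ∈ X.L.lattice, ∀ z ∈ X.outside, go (conj (z + P)) = go (conj z) + cg P)
    (hm₁ : ∀ w : ℂ, ‖w‖ = 1 → fo (X.a * w) + go (X.a * conj w) =
      X.a * (Φ w + X.α' * Φ ((X.ν : ℂ) ^ 2 * w) +
        (Φ' (conj w) + X.α' * Φ' ((X.ν : ℂ) ^ 2 * conj w))))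
    (hm₂ : ∀ w : ℂ, ‖w‖ = 1 → X.εe * (go (X.a * conj w) - fo (X.a * w)) =
      X.εi * X.a * ((Φ' (conj w) - X.α' * Φ' ((X.ν : ℂ) ^ 2 * conj w)) -
        (Φ w - X.α' * Φ ((X.ν : ℂ) ^ 2 * w)))) :
    ∃ u, X.IsPotential u ∧ (∀ z ∈ X.outside, u z = fo z + go (conj z)) ∧
      X.avgE u = ![-(cf 1 + cg 1), -(cf Complex.I + cg Complex.I)] ∧
      X.avgD u = ![-(X.εe * (Complex.I * (cg Complex.I - cf Complex.I))),
        X.εe * (Complex.I * (cg 1 - cf 1))] := by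
  have ha : (X.a : ℂ) ≠ 0 := a_ne_zero
  obtain ⟨C, hC0, hC⟩ := exists_deriv_bound ht hΦ
  obtain ⟨C', hC0', hC'⟩ := exists_deriv_bound ht hΦ'
  -- On the outer circle `z = a w` the image point is `ν² w̄`; this is the origin of the factors
  -- `ν²` in `hm₁` and `hm₂`.
  have hreflect : ∀ w : ℂ, ‖w‖ = 1 →
      (X.b : ℂ) ^ 2 / (X.a * (X.a * w)) = (X.ν : ℂ) ^ 2 * conj w := by
    intro w hw
    have h : w * conj w = 1 := by
      rw [Complex.mul_conj, Complex.normSq_eq_norm_sq, hw]; simp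
    have h0 : w ≠ 0 := left_ne_zero_of_mul_eq_one h
    rw [ν]
    push_cast
    field_simp
    linear_combination -(X.b : ℂ) ^ 2 * h
  have hrescale : ∀ z : ℂ, ‖z‖ = X.a → ∃ w : ℂ, ‖w‖ = 1 ∧ z = X.a * w := fun z hz =>
    ⟨z / X.a, by rw [norm_div_a, hz, div_self X.a_pos.ne'], by field_simp⟩
  have hnb : ∀ z : ℂ, ‖z‖ = X.a → ¬‖z‖ < X.b := fun z hz => by
    rw [hz]; exact X.b_lt_a.le.not_gt
  have hcoat : ∀ w : ℂ, ‖w‖ = 1 → ∀ Φ Φ' : ℂ → ℂ, X.coatField Φ Φ' (X.a * w) =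
      X.a * (Φ w + X.α' * Φ' ((X.ν : ℂ) ^ 2 * conj w)) := by
    intro w hw Φ Φ'
    rw [coatField, hreflect w hw, mul_div_cancel_left₀ _ ha]
  have hM1 : (1 + ‖X.α'‖) * (C + C') ≤ max K 0 + (1 + ‖X.α'‖) * (C + C') :=
    le_add_of_nonneg_left (le_max_right _ _)
  have hcoreb : ∀ c, ∀ z, 0 ≤ c → c ≤ C + C' → ∀ Φ : ℂ → ℂ, (∀ z, ‖z‖ ≤ 1 → ‖deriv Φ z‖ ≤ c) →
      ‖z‖ ≤ X.a → ‖(1 + X.α') * deriv Φ (z / X.a)‖ ≤ (1 + ‖X.α'‖) * (C + C') := by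
    intro c z h0 hc Φ h hz
    rw [norm_mul]
    refine mul_le_mul ((norm_add_le _ _).trans (by simp)) ((h _ (norm_div_a_le hz)).trans hc)
      (norm_nonneg _) (by positivity)
  have hcoatb : ∀ z, z ≠ 0 → X.b ≤ ‖z‖ → ‖z‖ ≤ X.a → ∀ c c' (Φ Φ' : ℂ → ℂ), 0 ≤ c → 0 ≤ c' →
      c + c' = C + C' → (∀ z, ‖z‖ ≤ 1 → ‖deriv Φ z‖ ≤ c) → (∀ z, ‖z‖ ≤ 1 → ‖deriv Φ' z‖ ≤ c') →
      ‖deriv Φ (z / X.a) - X.α' * deriv Φ' ((X.b : ℂ) ^ 2 / (X.a * z)) * ((X.b : ℂ) ^ 2 / z ^ 2)‖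
        ≤ (1 + ‖X.α'‖) * (C + C') := by
    intro z h0 hb hz c c' Φ Φ' hc hc' hcc h h'
    have h3 : ‖(X.b : ℂ) ^ 2 / z ^ 2‖ ≤ 1 := by
      rw [norm_div, norm_pow, norm_pow, Complex.norm_real, Real.norm_of_nonneg X.b_nonneg]
      refine div_le_one_of_le₀ ?_ (by positivity)
      exact pow_le_pow_left₀ X.b_nonneg hb 2
    calc _ ≤ ‖deriv Φ (z / X.a)‖ +
          ‖X.α' * deriv Φ' ((X.b : ℂ) ^ 2 / (X.a * z)) * ((X.b : ℂ) ^ 2 / z ^ 2)‖ := norm_sub_le _ _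
      _ ≤ c + ‖X.α'‖ * c' * 1 := by
          rw [norm_mul, norm_mul]
          refine add_le_add (h _ (norm_div_a_le hz))
            (mul_le_mul ?_ h3 (norm_nonneg _) (by positivity))
          exact mul_le_mul_of_nonneg_left (h' _ (norm_reflect_le hb)) (norm_nonneg _)
      _ ≤ (1 + ‖X.α'‖) * (c + c') := by
          nlinarith [norm_nonneg X.α', mul_nonneg (norm_nonneg X.α') hc]
      _ = _ := by rw [hcc]
  have hpair := isPotential_glue (X := X) (K := max K 0 + (1 + ‖X.α'‖) * (C + C'))
    (Lu := cf + cg) (Lψ := X.εe • ((-Complex.I) • cf + Complex.I • cg))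
    (Du := X.tubePotential Φ Φ') (Dψ := X.tubeStream Φ Φ')
    (Ou := fun z => fo z + go (conj z))
    (Oψ := fun z => X.εe * (-Complex.I * fo z + Complex.I * go (conj z)))
    (fun P hP z hz => by
      rw [hqf P hP z hz, hqg P hP z hz, add_apply]; ring)
    (fun P hP z hz => by
      rw [hqf P hP z hz, hqg P hP z hz]
      simp only [smul_apply, add_apply, smul_eq_mul]
      ring)
    (fun z hz => by
      obtain ⟨w, hw, rfl⟩ := hrescale z hz
      have hw' : ‖conj w‖ = 1 := by rwa [RCLike.norm_conj]
      rw [tubePotential, if_neg (hnb _ hz), map_mul, Complex.conj_ofReal, hcoat w hw,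
        hcoat _ hw', hm₁ w hw, RCLike.conj_conj]
      ring)
    (fun z hz => by
      obtain ⟨w, hw, rfl⟩ := hrescale z hz
      have hw' : ‖conj w‖ = 1 := by rwa [RCLike.norm_conj]
      rw [tubeStream, if_neg (hnb _ hz), map_mul, Complex.conj_ofReal, hcoat w hw, hcoat _ hw',
        RCLike.conj_conj]
      linear_combination -Complex.I * hm₂ w hw)
    (continuousOn_tube (fun z hz => tubePotential_of_le hz)
      (fun z hz => by rw [tubePotential, if_neg hz.not_gt])
      (continuousOn_coreField ht hΦ) (continuousOn_coreField ht hΦ')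
      (continuousOn_coatField ht hΦ hΦ') (continuousOn_coatField ht hΦ' hΦ))
    (continuousOn_tube
      (F := fun z => X.εc * (-Complex.I * X.coreField Φ z))
      (G := fun z => X.εc * (Complex.I * X.coreField Φ' z))
      (F' := fun z => X.εi * (-Complex.I * X.coatField Φ Φ' z))
      (G' := fun z => X.εi * (Complex.I * X.coatField Φ' Φ z))
      (fun z hz => by rw [tubeStream_of_le hz, mul_add])
      (fun z hz => by rw [tubeStream, if_neg hz.not_gt, mul_add])
      (continuousOn_const.mul (continuousOn_const.mul (continuousOn_coreField ht hΦ)))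
      (continuousOn_const.mul (continuousOn_const.mul (continuousOn_coreField ht hΦ')))
      (continuousOn_const.mul (continuousOn_const.mul (continuousOn_coatField ht hΦ hΦ')))
      (continuousOn_const.mul (continuousOn_const.mul (continuousOn_coatField ht hΦ' hΦ))))
    (fun z hz => (hasFDerivAt_add_conj (hfo z hz).1.hasDerivAt (hgo z hz).1.hasDerivAt
      1).1.continuousAt.continuousWithinAt)
    (fun z hz => (hasFDerivAt_add_conj (hfo z hz).1.hasDerivAt (hgo z hz).1.hasDerivAt
      X.εe).2.continuousAt.continuousWithinAt)
    (fun z hz => ⟨deriv fo z, deriv go (conj z),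
      (hfo z hz).2.trans ((le_max_left _ _).trans (le_add_of_nonneg_right (by positivity))),
      (hgo z hz).2.trans ((le_max_left _ _).trans (le_add_of_nonneg_right (by positivity))),
      hasFDerivAt_add_conj (hfo z hz).1.hasDerivAt (hgo z hz).1.hasDerivAt X.εe⟩)
    (fun z hz hzb => by
      have hz' : ‖conj z‖ ≤ X.a := by rw [RCLike.norm_conj]; exact hz.le
      rcases hzb.lt_or_gt with h | h
      · have h1 := hasFDerivAt_add_conj (hasDerivAt_coreField (X := X) ht hΦ hz.le)
          (hasDerivAt_coreField (X := X) ht hΦ' hz') X.εc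
        have hn : {y : ℂ | ‖y‖ < X.b} ∈ 𝓝 z :=
          (isOpen_lt continuous_norm continuous_const).mem_nhds h
        refine ⟨_, _, (hcoreb C _ hC0 (by linarith) Φ hC hz.le).trans hM1,
          (hcoreb C' _ hC0' (by linarith) Φ' hC' hz').trans hM1,
          h1.1.congr_of_eventuallyEq ?_, ?_⟩
        · filter_upwards [hn] with y hy
          exact if_pos hy
        · rw [if_pos h]
          refine h1.2.congr_of_eventuallyEq ?_
          filter_upwards [hn] with y hy
          exact if_pos hy
      · have h0 : z ≠ 0 := norm_pos_iff.1 (X.b_nonneg.trans_lt h)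
        have h0' : conj z ≠ 0 := by simpa using h0
        have h' : X.b ≤ ‖conj z‖ := by rw [RCLike.norm_conj]; exact h.le
        have h1 := hasFDerivAt_add_conj (hasDerivAt_coatField (X := X) ht hΦ hΦ' h0 h.le hz.le)
          (hasDerivAt_coatField (X := X) ht hΦ' hΦ h0' h' hz') X.εi
        have hn : {y : ℂ | X.b < ‖y‖} ∈ 𝓝 z :=
          (isOpen_lt continuous_const continuous_norm).mem_nhds h
        refine ⟨_, _, (hcoatb z h0 h.le hz.le C C' Φ Φ' hC0 hC0' rfl hC hC').trans hM1,
          (hcoatb _ h0' h' hz' C' C Φ' Φ hC0' hC0 (add_comm _ _) hC' hC).trans hM1,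
          h1.1.congr_of_eventuallyEq ?_, ?_⟩
        · filter_upwards [hn] with y hy
          exact if_neg (not_lt.2 (le_of_lt hy))
        · rw [if_neg h.le.not_gt]
          refine h1.2.congr_of_eventuallyEq ?_
          filter_upwards [hn] with y hy
          exact if_neg (not_lt.2 (le_of_lt hy)))
  refine ⟨_, hpair.1, fun z hz => glue_of_mem_outside hz, ?_, ?_⟩
  · rw [hpair.2.1]
    simp only [add_apply]
  · rw [hpair.2.2]
    simp only [smul_apply, add_apply, smul_eq_mul]
    congr 1
    · ring
    · congr 1
      ring

/-! ### Interface conditions for one mode -/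

/-- Both outer interface conditions for one mode: incident amplitude `R`, scattered amplitude `-γ_n
R`, and amplitude `R (1 - α) / (1 - α α̃ ν^(4n+2))` in the coating. The exponent `4n + 2` comes from
evaluating `w^(2n+1)` at `ν² w`. -/
theorem coeff_match (n : ℕ) (hγ : X.γden n ≠ 0) (R : ℂ) :
    R - X.γ n * R = R * ((1 - X.α) / X.γden n) * (1 + X.α' * (X.ν : ℂ) ^ (4 * n + 2)) ∧
      X.εe * (R + X.γ n * R) =
        X.εi * (R * ((1 - X.α) / X.γden n) * (1 - X.α' * (X.ν : ℂ) ^ (4 * n + 2))) := by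
  have h1 : X.εe * (1 + X.α) = X.εi * (1 - X.α) := by
    have := X.εi_add_εe_ne_zero
    rw [α]
    field_simp
    ring
  have hg : X.γ n = (X.α - X.α' * (X.ν : ℂ) ^ (4 * n + 2)) / X.γden n := rfl
  have hd : X.γden n = 1 - X.α * X.α' * (X.ν : ℂ) ^ (4 * n + 2) := rfl
  constructor
  · rw [hg]
    field_simp
    rw [hd]
    ring
  · rw [hg]
    field_simp
    rw [hd]
    linear_combination R * (1 - X.α' * (X.ν : ℂ) ^ (4 * n + 2)) * h1

/-! ### Neutral inclusions -/

/-- The exterior field is exactly linear, so only the mode `n = 0` has to be matched and neither the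
zeta function nor any symmetry or strict separation of the tubes enters. Here `⟨𝐄⟩ = F` and `⟨𝐃⟩ =
ε_e F`. -/
theorem exists_neutral_potential (h0 : X.γden 0 ≠ 0) (hγ : X.γ 0 = 0) (F : Fin 2 → ℂ) :
    ∃ u, X.IsPotential u ∧ X.avgE u = (1 : Matrix (Fin 2) (Fin 2) ℂ).mulVec F ∧
      X.avgD u = (X.εe • (1 : Matrix (Fin 2) (Fin 2) ℂ)).mulVec F := by
  set p := (F 0 - Complex.I * F 1) / 2 with hp
  set q := (F 0 + Complex.I * F 1) / 2 with hq
  set κ := (1 - X.α) / X.γden 0 with hκ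
  have hmatch := fun R => coeff_match 0 h0 R
  simp only [hγ, zero_mul, sub_zero, add_zero, mul_zero, zero_add, ← hκ] at hmatch
  have hlin : ∀ c z : ℂ, HasDerivAt (fun z => c * z) c z := fun c z => by
    simpa using (hasDerivAt_id z).const_mul c
  have hdl : ∀ c z : ℂ, DifferentiableAt ℂ (fun z => c * z) z := fun c z =>
    (hlin c z).differentiableAt
  obtain ⟨u, hu, -, hE, hD⟩ := exists_potential (X := X) (t := 2) (Φ := fun w => -p * κ * w)
    (Φ' := fun w => -q * κ * w) (fo := fun z => -p * z) (go := fun z => -q * z)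
    (K := ‖p‖ + ‖q‖) (cf := wirtinger (-p) 0) (cg := wirtinger 0 (-q)) one_lt_two
    (fun z _ => (hdl _ _).differentiableWithinAt) (fun z _ => (hdl _ _).differentiableWithinAt)
    (fun z _ => ⟨hdl _ _, by rw [(hlin (-p) z).deriv, norm_neg]; linarith [norm_nonneg q]⟩)
    (fun z _ => ⟨hdl _ _, by rw [(hlin (-q) (conj z)).deriv, norm_neg]; linarith [norm_nonneg p]⟩)
    (fun P _ z _ => by rw [wirtinger_apply]; ring)
    (fun P _ z _ => by rw [wirtinger_apply, map_add]; ring)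
    (fun w _ => by
      linear_combination X.a * w * (hmatch (-p)).1 + X.a * conj w * (hmatch (-q)).1)
    (fun w _ => by
      linear_combination X.a * conj w * (hmatch (-q)).2 - X.a * w * (hmatch (-p)).2)
  refine ⟨u, hu, ?_, ?_⟩
  · rw [hE, Matrix.one_mulVec]
    ext i
    fin_cases i
    · simp [hp, hq]; ring
    · simp [hp, hq]
      linear_combination -F 1 * Complex.I_mul_I
  · rw [hD, Matrix.smul_mulVec, Matrix.one_mulVec]
    ext i
    fin_cases i
    · simp [hp, hq]
      linear_combination -X.εe * F 0 * Complex.I_mul_I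
    · simp [hp, hq]
      refine Or.inl ?_
      linear_combination -F 1 * Complex.I_mul_I

theorem isEffectiveTensor_neutral_iff (h0 : X.γden 0 ≠ 0) (hγ : X.γ 0 = 0)
    (T : Matrix (Fin 2) (Fin 2) ℂ) : X.IsEffectiveTensor T ↔ T = X.εe • 1 := by
  rw [X.isEffectiveTensor_iff (A := X.εe • 1) (B := 1) (by simp)
    (exists_neutral_potential h0 hγ)]
  simp

theorem γ_zero_eq_zero_iff (hic : X.εi ≠ X.εc) : (X.γden 0 ≠ 0 ∧ X.γ 0 = 0) ↔
    (X.b : ℂ) ^ 2 / (X.a : ℂ) ^ 2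
      = ((X.εi - X.εe) * (X.εi + X.εc)) / ((X.εi + X.εe) * (X.εi - X.εc)) := by
  have h1 := X.εi_add_εe_ne_zero
  have h2 := X.εi_add_εc_ne_zero
  have h3 : X.εi - X.εc ≠ 0 := sub_ne_zero.2 hic
  have hν : (X.ν : ℂ) ^ (4 * 0 + 2) = (X.b : ℂ) ^ 2 / (X.a : ℂ) ^ 2 := by
    rw [ν]; push_cast; ring
  have hα' : X.α' ≠ 0 := div_ne_zero h3 h2
  have hrhs : ((X.εi - X.εe) * (X.εi + X.εc)) / ((X.εi + X.εe) * (X.εi - X.εc)) =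
      X.α / X.α' := by
    rw [α, α']; field_simp
  rw [γ, γden, hν, hrhs, eq_div_iff hα']
  set s := (X.b : ℂ) ^ 2 / (X.a : ℂ) ^ 2
  constructor
  · rintro ⟨hd, h⟩
    rw [div_eq_zero_iff, or_iff_left hd] at h
    linear_combination -h
  · intro h
    -- With `α̃ s = α` the denominator is `1 - α² = 4 ε_e ε_i / (ε_i + ε_e)²`, so its being nonzero
    -- is a consequence of the ratio condition.
    have h4 : 1 - X.α * X.α' * s = (1 - X.α) * (1 + X.α) := by linear_combination -X.α * h
    have h5 : 1 - X.α = 2 * X.εe / (X.εi + X.εe) := by rw [α]; field_simp; ring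
    have h6 : 1 + X.α = 2 * X.εi / (X.εi + X.εe) := by rw [α]; field_simp; ring
    refine ⟨?_, ?_⟩
    · rw [h4, h5, h6]
      exact mul_ne_zero (div_ne_zero (mul_ne_zero two_ne_zero X.εe_ne_zero) h1)
        (div_ne_zero (mul_ne_zero two_ne_zero X.εi_ne_zero) h1)
    · rw [show X.α - X.α' * s = 0 by linear_combination -h, zero_div]

end TubeArray

/-! ### Weierstrass' zeta function -/

section Zeta

/-- `ζ(z) - 1/z`, continued to the origin. -/
noncomputable def zetaRegular (L : PeriodPair) (z : ℂ) : ℂ :=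
  ∑' P : L.lattice, if (P : ℂ) = 0 then 0 else 1 / (z - P) + 1 / (P : ℂ) + z / (P : ℂ) ^ 2

/-- The three fractions combine to `z² / ((z - l) l²)`, and `‖z - l‖ ≥ ‖l‖ / 2`. -/
theorem norm_zeta_term_le {r : ℝ} (hr : 0 < r) {z l : ℂ} (hz : ‖z‖ < r) (h : 2 * r ≤ ‖l‖) :
    ‖1 / (z - l) + 1 / l + z / l ^ 2‖ ≤ 2 * r ^ 2 * ‖l‖ ^ (-3 : ℝ) := by
  have hl : 0 < ‖l‖ := by linarith
  have hl0 : l ≠ 0 := norm_pos_iff.1 hl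
  have h1 : ‖l‖ / 2 ≤ ‖z - l‖ := by
    have := norm_sub_norm_le l z
    rw [norm_sub_rev] at this
    linarith
  have hzl : z - l ≠ 0 := norm_pos_iff.1 (by linarith)
  have e : 1 / (z - l) + 1 / l + z / l ^ 2 = z ^ 2 / ((z - l) * l ^ 2) := by
    field_simp
    ring
  rw [e, norm_div, norm_mul, norm_pow, norm_pow, Real.rpow_neg (norm_nonneg l),
    ← div_eq_mul_inv]
  have h3 : ‖l‖ ^ (3 : ℝ) = ‖l‖ ^ 3 := by norm_cast
  rw [h3, div_le_div_iff₀ (by positivity) (by positivity)]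
  have h4 : ‖z‖ ^ 2 ≤ r ^ 2 := pow_le_pow_left₀ (norm_nonneg z) hz.le 2
  calc ‖z‖ ^ 2 * ‖l‖ ^ 3 ≤ r ^ 2 * ‖l‖ ^ 3 := by gcongr
    _ = 2 * r ^ 2 * (‖l‖ / 2 * ‖l‖ ^ 2) := by ring
    _ ≤ 2 * r ^ 2 * (‖z - l‖ * ‖l‖ ^ 2) := by gcongr

variable (L : PeriodPair)

theorem hasSumLocallyUniformly_zetaRegular :
    HasSumLocallyUniformly (fun (P : L.lattice) (z : ℂ) =>
      if (P : ℂ) = 0 then 0 else 1 / (z - P) + 1 / (P : ℂ) + z / (P : ℂ) ^ 2) (zetaRegular L) := by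
  refine L.hasSumLocallyUniformly_aux (u := fun r P => 2 * r ^ 2 * ‖P‖ ^ (-3 : ℝ)) _
    (fun _ _ => (ZLattice.summable_norm_rpow _ _ (by simp; norm_num)).mul_left _) fun r hr =>
    Filter.eventually_atTop.mpr ⟨2 * r, ?_⟩
  rintro _ h z hz l rfl
  split_ifs
  · rw [norm_zero]; positivity
  · exact norm_zeta_term_le hr hz h

theorem hasSum_zetaRegular (z : ℂ) :
    HasSum (fun P : L.lattice =>
      if (P : ℂ) = 0 then 0 else 1 / (z - P) + 1 / (P : ℂ) + z / (P : ℂ) ^ 2) (zetaRegular L z) :=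
  (hasSumLocallyUniformly_zetaRegular L).hasSum

theorem differentiableAt_zeta_term {l z : ℂ} (h : z - l ≠ 0) :
    DifferentiableAt ℂ (fun z => 1 / (z - l) + 1 / l + z / l ^ 2) z :=
  have h2 : HasDerivAt (fun z : ℂ => 1 / (z - l) + 1 / l + z / l ^ 2)
      ((0 * (z - l) - 1 * 1) / (z - l) ^ 2 + 1 / l ^ 2) z :=
    (((hasDerivAt_const z (1 : ℂ)).div ((hasDerivAt_id z).sub_const l) h).add_const
      _).add ((hasDerivAt_id z).div_const _)
  h2.differentiableAt

theorem sub_ne_zero_of_mem {z : ℂ} (hz : z ∈ ((L.lattice : Set ℂ) \ {0})ᶜ) {P : L.lattice}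
    (hP : (P : ℂ) ≠ 0) : z - P ≠ 0 := fun h => hz (by
  rw [sub_eq_zero.1 h]
  exact ⟨P.2, hP⟩)

theorem differentiableOn_zetaRegular :
    DifferentiableOn ℂ (zetaRegular L) ((L.lattice : Set ℂ) \ {0})ᶜ := by
  refine (hasSumLocallyUniformly_zetaRegular L).hasSumLocallyUniformlyOn.differentiableOn
    (.of_forall fun s => .fun_sum fun P _ => ?_) L.isOpen_compl_lattice_sdiff
  split_ifs with h
  · simp
  · exact fun z hz =>
      (differentiableAt_zeta_term (sub_ne_zero_of_mem L hz h)).differentiableWithinAt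

theorem deriv_zetaRegular {z : ℂ} (hz : z ∈ ((L.lattice : Set ℂ) \ {0})ᶜ) :
    deriv (zetaRegular L) z = -L.weierstrassPExcept 0 z := by
  refine ((hasSumLocallyUniformly_zetaRegular L).tendstoLocallyUniformlyOn.deriv
    (.of_forall fun s => .fun_sum fun P _ => ?_) L.isOpen_compl_lattice_sdiff).unique
    (g := fun z => -L.weierstrassPExcept 0 z) ?_ hz
  · split_ifs with h
    · simp
    · exact fun z hz =>
        (differentiableAt_zeta_term (sub_ne_zero_of_mem L hz h)).differentiableWithinAt
  · have h1 : TendstoLocallyUniformlyOn (fun (s : Finset L.lattice) z => -∑ l ∈ s,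
        if (l : ℂ) = 0 then 0 else (1 / (z - l) ^ 2 - 1 / (l : ℂ) ^ 2))
        (fun z => -L.weierstrassPExcept 0 z) atTop ((L.lattice : Set ℂ) \ {0})ᶜ :=
      (L.hasSumLocallyUniformly_weierstrassPExcept 0).tendstoLocallyUniformlyOn.neg
    refine h1.congr fun s z hz => ?_
    simp only [Function.comp_apply]
    rw [deriv_fun_sum, ← Finset.sum_neg_distrib]
    · refine Finset.sum_congr rfl fun P _ => ?_
      split_ifs with h
      · simp
      · have h0 := sub_ne_zero_of_mem L hz h
        have h2 : HasDerivAt (fun z : ℂ => 1 / (z - P) + 1 / (P : ℂ) + z / (P : ℂ) ^ 2)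
            ((0 * (z - P) - 1 * 1) / (z - P) ^ 2 + 1 / (P : ℂ) ^ 2) z :=
          (((hasDerivAt_const z (1 : ℂ)).div ((hasDerivAt_id z).sub_const (P : ℂ)) h0).add_const
            _).add ((hasDerivAt_id z).div_const _)
        rw [h2.deriv]
        ring
    · intro P _
      split_ifs with h
      · simp
      · exact differentiableAt_zeta_term (sub_ne_zero_of_mem L hz h)

theorem weierstrassZeta_eq (z : ℂ) : weierstrassZeta L z = zetaRegular L z + z⁻¹ := by
  have h1 : HasSum (fun P : L.lattice => if P = 0 then z⁻¹ else 0) z⁻¹ := hasSum_ite_eq 0 z⁻¹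
  rw [weierstrassZeta, ← ((hasSum_zetaRegular L z).add h1).tsum_eq]
  congr 1
  ext P
  by_cases h : P = 0
  · simp [h]
  · simp [h]

theorem zetaRegular_zero : zetaRegular L 0 = 0 := by
  rw [zetaRegular, ← tsum_zero]
  congr 1
  ext P
  split_ifs <;> simp

theorem compl_subset : (L.lattice : Set ℂ)ᶜ ⊆ ((L.lattice : Set ℂ) \ {0})ᶜ :=
  compl_subset_compl.2 sdiff_subset

theorem hasDerivAt_zetaRegular {z : ℂ} (hz : z ∈ ((L.lattice : Set ℂ) \ {0})ᶜ) :
    HasDerivAt (zetaRegular L) (-L.weierstrassPExcept 0 z) z := by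
  rw [← deriv_zetaRegular L hz]
  exact ((differentiableOn_zetaRegular L).differentiableAt
    (L.isOpen_compl_lattice_sdiff.mem_nhds hz)).hasDerivAt

theorem hasDerivAt_weierstrassZeta {z : ℂ} (hz : z ∉ L.lattice) :
    HasDerivAt (weierstrassZeta L) (-L.weierstrassP z) z := by
  have h0 : z ≠ 0 := fun h => hz (h ▸ zero_mem _)
  have h1 := (hasDerivAt_zetaRegular L (compl_subset L hz)).add (hasDerivAt_inv h0)
  have h2 := L.weierstrassPExcept_def 0 z
  simp only [ZeroMemClass.coe_zero, sub_zero] at h2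
  have : weierstrassZeta L = zetaRegular L + Inv.inv := funext fun z => weierstrassZeta_eq L z
  rw [this]
  refine h1.congr_deriv ?_
  rw [h2]
  simp

theorem countable_coe_lattice : (L.lattice : Set ℂ).Countable :=
  have : Countable L.lattice := L.latticeEquivProd.toEquiv.countable_iff.2 inferInstance
  Set.to_countable _

theorem isOpen_compl_lattice : IsOpen (L.lattice : Set ℂ)ᶜ := L.isClosed_lattice.isOpen_compl

theorem isPreconnected_compl_of_countable {s : Set ℂ} (hs : s.Countable) : IsPreconnected sᶜ :=
  (hs.isConnected_compl_of_one_lt_rank (by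
    rw [Complex.rank_real_complex]; exact Nat.one_lt_ofNat)).isPreconnected

theorem weierstrassZeta_neg (z : ℂ) : weierstrassZeta L (-z) = -weierstrassZeta L z := by
  rw [weierstrassZeta, weierstrassZeta, ← tsum_neg, ← (Equiv.neg L.lattice).tsum_eq]
  congr 1
  ext P
  simp only [Equiv.neg_apply, NegMemClass.coe_neg]
  rw [show -z - -(P : ℂ) = -(z - P) by ring, neg_sq]
  simp only [one_div, inv_neg, neg_div]
  ring_nf

theorem add_notMem_lattice {P z : ℂ} (hP : P ∈ L.lattice) (hz : z ∉ L.lattice) :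
    z + P ∉ L.lattice := fun h => hz (by simpa using sub_mem h hP)

/-- The derivative `-℘` is periodic, and the complement of a countable set in the plane is
connected, so the increment over a period is constant. -/
theorem exists_zeta_quasiPeriod : ∃ T : ℂ →L[ℝ] ℂ, ∀ P ∈ L.lattice, ∀ z ∉ L.lattice,
    weierstrassZeta L (z + P) = weierstrassZeta L z + T P := by
  have key : ∀ P ∈ L.lattice, ∃ c, ∀ z ∈ (L.lattice : Set ℂ)ᶜ,
      weierstrassZeta L (z + P) = weierstrassZeta L z + c := by
    intro P hP
    have hd : ∀ z ∈ (L.lattice : Set ℂ)ᶜ,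
        HasDerivAt (fun z => weierstrassZeta L (z + P) - weierstrassZeta L z) 0 z := by
      intro z hz
      have h1 := (hasDerivAt_weierstrassZeta L (add_notMem_lattice L hP hz)).comp_add_const z P
      refine (h1.sub (hasDerivAt_weierstrassZeta L hz)).congr_deriv ?_
      rw [L.weierstrassP_add_coe z ⟨P, hP⟩, sub_self]
    have hc := (isOpen_compl_lattice L).exists_is_const_of_deriv_eq_zero
      (isPreconnected_compl_of_countable (countable_coe_lattice L))
      (fun z hz => (hd z hz).differentiableAt.differentiableWithinAt) (fun z hz => (hd z hz).deriv)
    obtain ⟨c, hc⟩ := hc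
    exact ⟨c, fun z hz => by rw [← hc z hz]; ring⟩
  obtain ⟨c₁, h1⟩ := key _ L.ω₁_mem_lattice
  obtain ⟨c₂, h2⟩ := key _ L.ω₂_mem_lattice
  exact exists_quasiPeriod L (U := (L.lattice : Set ℂ)ᶜ)
    (fun P hP z hz => add_notMem_lattice L hP hz) h1 h2

/-- Oddness of `ζ`, evaluated at `-ω₁ / 2`. -/
theorem quasiPeriod_ω₁ {T : ℂ →L[ℝ] ℂ} (hT : ∀ P ∈ L.lattice, ∀ z ∉ L.lattice,
    weierstrassZeta L (z + P) = weierstrassZeta L z + T P) :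
    T L.ω₁ = 2 * weierstrassZeta L (L.ω₁ / 2) := by
  have hn : -(L.ω₁ / 2) ∉ L.lattice := fun h => L.ω₁_div_two_notMem_lattice (by simpa using h)
  have := hT _ L.ω₁_mem_lattice _ hn
  rw [weierstrassZeta_neg, show -(L.ω₁ / 2) + L.ω₁ = L.ω₁ / 2 by ring] at this
  linear_combination -this

/-! ### Expansion at the origin -/

theorem iteratedDeriv_zetaRegular_zero (k : ℕ) :
    iteratedDeriv k (zetaRegular L) 0 =
      if k < 2 then 0 else -(k.factorial : ℂ) * L.G (k + 1) := by
  rcases k with _ | k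
  · simp [zetaRegular_zero]
  · rw [iteratedDeriv_succ']
    have h : deriv (zetaRegular L) =ᶠ[𝓝 0] fun z => -L.weierstrassPExcept 0 z := by
      filter_upwards [L.compl_lattice_sdiff_singleton_mem_nhds 0] with z hz
      exact deriv_zetaRegular L hz
    rw [h.iteratedDeriv_eq, iteratedDeriv_fun_neg, L.iteratedDeriv_weierstrassPExcept_self]
    rcases k with _ | k
    · simp
    · simp

theorem iteratedDeriv_zetaRegular_even (k : ℕ) :
    iteratedDeriv (2 * k) (zetaRegular L) 0 = 0 := by
  rw [iteratedDeriv_zetaRegular_zero, L.G_eq_zero_of_odd (2 * k + 1) ⟨k, rfl⟩]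
  simp

/-- The convention `s_1 = 0` is forced here: the summand `z / P²` of `ζ` cancels the linear Taylor
coefficient. -/
theorem iteratedDeriv_zetaRegular_odd (k : ℕ) :
    iteratedDeriv (2 * k + 1) (zetaRegular L) 0 =
      -((2 * k + 1).factorial : ℂ) * latticeSum L (k + 1) := by
  rw [iteratedDeriv_zetaRegular_zero, latticeSum]
  rcases k with _ | k
  · simp
  · rw [if_neg (by omega), if_neg (by omega)]
    rfl

variable {L} {ℓ : ℝ}

theorem ball_subset_compl (hℓ : ∀ P ∈ L.lattice, P ≠ 0 → ℓ ≤ ‖P‖) :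
    ball (0 : ℂ) ℓ ⊆ ((L.lattice : Set ℂ) \ {0})ᶜ := by
  rintro z hz ⟨h1, h2⟩
  exact absurd (hℓ z h1 h2) (not_le.2 (by simpa using hz))

/-- The Taylor expansion of the even derivatives of `ζ(z) - 1/z`. -/
theorem hasSum_iteratedDeriv_zetaRegular (hℓ : ∀ P ∈ L.lattice, P ≠ 0 → ℓ ≤ ‖P‖) (n : ℕ) {z : ℂ}
    (hz : ‖z‖ < ℓ) :
    HasSum (fun m : ℕ => -(latticeSum L (n + m + 1) *
      (((2 * n + 2 * m + 1).factorial : ℂ) / ((2 * m + 1).factorial : ℂ)) * z ^ (2 * m + 1)))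
      (iteratedDeriv (2 * n) (zetaRegular L) z) := by
  have hd : DifferentiableOn ℂ (iteratedDeriv (2 * n) (zetaRegular L)) (ball 0 ℓ) := by
    have h := (differentiableOn_zetaRegular L).mono (ball_subset_compl hℓ)
    have : AnalyticOnNhd ℂ (zetaRegular L) (ball 0 ℓ) := h.analyticOnNhd isOpen_ball
    exact (this.iterated_deriv (2 * n)).differentiableOn.congr fun x _ => by
      rw [iteratedDeriv_eq_iterate]
  have hs := Complex.hasSum_taylorSeries_on_ball hd (z := z) (by simpa using hz)
  have hinj : Function.Injective fun m : ℕ => 2 * m + 1 := fun a b h => by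
    simpa using h
  have hcomp : ∀ j, iteratedDeriv j (iteratedDeriv (2 * n) (zetaRegular L)) 0 =
      iteratedDeriv (j + 2 * n) (zetaRegular L) 0 := by
    intro j
    simp only [iteratedDeriv_eq_iterate, Function.iterate_add_apply]
  rw [← hinj.hasSum_iff] at hs
  · refine hs.congr_fun fun m => ?_
    simp only [Function.comp_apply, hcomp, smul_eq_mul, sub_zero]
    rw [show 2 * m + 1 + 2 * n = 2 * (n + m) + 1 by ring, iteratedDeriv_zetaRegular_odd,
      show 2 * n + 2 * m + 1 = 2 * (n + m) + 1 by ring]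
    ring
  · intro j hj
    have hj' : Even j := by
      by_contra h
      obtain ⟨m, rfl⟩ := Nat.not_even_iff_odd.1 h
      exact hj ⟨m, rfl⟩
    obtain ⟨m, rfl⟩ := hj'
    rw [hcomp, show m + m + 2 * n = 2 * (m + n) by ring, iteratedDeriv_zetaRegular_even]
    simp

theorem iteratedDeriv_weierstrassZeta {z : ℂ} (hz : z ∉ L.lattice) (n : ℕ) :
    iteratedDeriv (2 * n) (weierstrassZeta L) z =
      iteratedDeriv (2 * n) (zetaRegular L) z + ((2 * n).factorial : ℂ) * (z ^ (2 * n + 1))⁻¹ := by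
  have h0 : z ≠ 0 := fun h => hz (h ▸ zero_mem _)
  have : weierstrassZeta L = zetaRegular L + Inv.inv := funext fun z => weierstrassZeta_eq L z
  rw [this, iteratedDeriv_add]
  · congr 1
    rw [iteratedDeriv_eq_iterate, iter_deriv_inv]
    rw [pow_mul, neg_one_sq, one_pow, one_mul]
    congr 1
    rw [show (-1 - ((2 * n : ℕ) : ℤ)) = -((2 * n + 1 : ℕ) : ℤ) by push_cast; ring, zpow_neg,
      zpow_natCast]
  · exact ((differentiableOn_zetaRegular L).analyticAt
      (L.isOpen_compl_lattice_sdiff.mem_nhds (compl_subset L hz))).contDiffAt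
  · exact contDiffAt_inv ℂ h0

end Zeta

/-! ### The area of the cell and the quasi-periods -/

namespace TubeArray

variable (X : TubeArray)

theorem area_eq : X.area = |X.L.ω₁.re * X.L.ω₂.im - X.L.ω₁.im * X.L.ω₂.re| := by
  have h1 : volume.real (ZSpan.fundamentalDomain Complex.basisOneI) = 1 := by
    have h2 : volume (ZSpan.fundamentalDomain Complex.basisOneI) = 1 := by
      rw [measure_congr (ZSpan.fundamentalDomain_ae_parallelepiped Complex.basisOneI volume)]
      have := Complex.orthonormalBasisOneI.volume_parallelepiped
      rwa [← Complex.toBasis_orthonormalBasisOneI, OrthonormalBasis.coe_toBasis]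
    rw [measureReal_def, h2, ENNReal.toReal_one]
  have h3 : X.area = volume.real (ZSpan.fundamentalDomain X.L.basis) := by
    rw [area, cell_eq_preimage, measureReal_def, measure_preimage_add_right, measureReal_def]
  rw [h3, ZSpan.measureReal_fundamentalDomain _ volume Complex.basisOneI, h1, mul_one,
    Module.Basis.det_apply, Matrix.det_fin_two]
  simp [Module.Basis.toMatrix_apply, PeriodPair.basis_zero, PeriodPair.basis_one]
  ring_nf

theorem area_eq_of_real (h1 : X.L.ω₁.im = 0) (h2 : 0 < (X.L.ω₂ / X.L.ω₁).im) :
    X.area = X.L.ω₁.re * X.L.ω₂.im := by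
  have h3 : X.L.ω₁ = (X.L.ω₁.re : ℂ) := Complex.ext rfl (by simp [h1])
  rw [h3, Complex.div_ofReal_im] at h2
  rw [area_eq, h1, zero_mul, sub_zero, abs_of_pos]
  rcases lt_trichotomy X.L.ω₁.re 0 with h | h | h
  · have := (div_pos_iff.1 h2).resolve_left fun h' => absurd h'.2 h.not_gt
    exact mul_pos_of_neg_of_neg h this.1
  · simp [h] at h2
  · exact mul_pos h ((div_pos_iff_of_pos_right h).1 h2)

variable {X} in
theorem norm_bounded_on_outside {f : ℂ → ℂ} (hc : ContinuousOn f X.outside)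
    (hf : ∀ P ∈ X.L.lattice, ∀ z ∈ X.outside, f (z + P) = f z) :
    ∃ C, ∀ z ∈ X.outside, ‖f z‖ ≤ C := by
  obtain ⟨R, -, hR⟩ := X.exists_cell_bound
  have hK : IsCompact (closedBall (0 : ℂ) R ∩ X.outside) :=
    (isCompact_closedBall 0 R).inter_right X.isClosed_outside
  obtain ⟨C, hC⟩ := hK.exists_bound_of_continuousOn (hc.mono inter_subset_right)
  refine ⟨C, fun z hz => ?_⟩
  obtain ⟨P, hP, hzP⟩ := X.exists_sub_mem_cell z
  have ho : z - P ∈ X.outside := (add_mem_outside_iff hP).1 (by rwa [sub_add_cancel])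
  have := hC (z - P) ⟨mem_closedBall_zero_iff.2 (hR _ hzP), ho⟩
  rwa [← hf P hP _ ho, sub_add_cancel] at this

variable {X} in
theorem notMem_lattice_of_mem_outside {z : ℂ} (hz : z ∈ X.outside) : z ∉ X.L.lattice := fun h => by
  have := hz z h
  rw [sub_self, norm_zero] at this
  exact absurd this (not_le.2 X.a_pos)

open scoped Pointwise in
/-- The part of the cell covered by tubes has the area of one tube. -/
theorem volume_cell_inter_tubes :
    volume.real ({z | ∃ P ∈ X.L.lattice, ‖z - P‖ < X.a} ∩ X.cell) = Real.pi * X.a ^ 2 := by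
  have : VAddInvariantMeasure X.L.lattice ℂ volume :=
    inferInstanceAs <| VAddInvariantMeasure X.L.lattice.toAddSubgroup ℂ volume
  have hv : ∀ P : X.L.lattice, P +ᵥ ball (0 : ℂ) X.a = ball (P : ℂ) X.a := by
    intro P
    change (fun z => (P : ℂ) + z) '' ball 0 X.a = _
    rw [image_add_left]
    ext z
    simp [dist_eq_norm, sub_eq_neg_add]
  have h1 := X.isAddFundamentalDomain_cell.measure_eq_tsum (ball (0 : ℂ) X.a)
  simp only [hv] at h1
  rw [← measure_iUnion, ← iUnion_inter] at h1
  · have h2 : (⋃ P : X.L.lattice, ball (P : ℂ) X.a) = {z | ∃ P ∈ X.L.lattice, ‖z - P‖ < X.a} := by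
      ext z
      simp [dist_eq_norm]
    rw [measureReal_def, ← h2, ← h1, Complex.volume_ball]
    simp [X.a_pos.le, mul_comm]
  · intro P Q hPQ
    refine Disjoint.mono inter_subset_left inter_subset_left
      (disjoint_left.2 fun z hz hz' => hPQ (Subtype.ext ?_))
    exact eq_of_norm_sub_lt P.2 Q.2 (mem_ball_iff_norm.1 hz).le (mem_ball_iff_norm.1 hz')
  · exact fun P => measurableSet_ball.inter X.measurableSet_cell

/-- A form of Legendre's relation. Replacing `1/z` by `z̄ / a²` in each tube, which agrees with it
on the circle, turns `ζ` into a Lipschitz function with the same quasi-periods. Twice its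
`z̄`-derivative is `2 / a²` in the tubes and `0` outside. Its integral over the cell is therefore
`(2 / a²) π a² = 2π`. -/
theorem quasiPeriod_one_add {T : ℂ →L[ℝ] ℂ} (hT : ∀ P ∈ X.L.lattice, ∀ z ∉ X.L.lattice,
    weierstrassZeta X.L (z + P) = weierstrassZeta X.L z + T P) :
    X.area * (T 1 + Complex.I * T Complex.I) = 2 * Real.pi := by
  have ha := X.a_pos
  have ha0 : (X.a : ℂ) ≠ 0 := Complex.ofReal_ne_zero.2 ha.ne'
  set Fd : ℂ → ℂ := fun z => zetaRegular X.L z + ((X.a : ℂ) ^ 2)⁻¹ * conj z with hFd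
  have hq : ∀ P ∈ X.L.lattice, ∀ z ∈ X.outside,
      weierstrassZeta X.L (z + P) = weierstrassZeta X.L z + T P :=
    fun P hP z hz => hT P hP z (notMem_lattice_of_mem_outside hz)
  have hm : ∀ z, ‖z‖ = X.a → Fd z = weierstrassZeta X.L z := by
    intro z hz
    have : z⁻¹ = conj z * ((X.a : ℂ) ^ 2)⁻¹ := by
      rw [Complex.inv_def, Complex.normSq_eq_norm_sq, hz]; push_cast; rfl
    rw [weierstrassZeta_eq, this, mul_comm]
  have hsub : closedBall (0 : ℂ) X.a ⊆ ((X.L.lattice : Set ℂ) \ {0})ᶜ :=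
    (closedBall_subset_ball (by linarith)).trans (ball_subset_compl X.two_mul_a_le)
  have hEc : ContinuousOn (zetaRegular X.L) (closedBall 0 X.a) :=
    ((differentiableOn_zetaRegular X.L).mono hsub).continuousOn
  have hPc : ContinuousOn (fun z => -X.L.weierstrassPExcept 0 z) (closedBall 0 X.a) := by
    refine ContinuousOn.neg fun z hz => ?_
    exact ((X.L.differentiableOn_weierstrassPExcept 0).continuousOn z (by simpa using hsub hz)).mono
      (by simpa using hsub)
  have hdin : ∀ z ∈ closedBall (0 : ℂ) X.a, HasFDerivAt Fd
      (wirtinger (-X.L.weierstrassPExcept 0 z) ((X.a : ℂ) ^ 2)⁻¹) z := by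
    intro z hz
    have h1 := hasFDerivAt_of_hasDerivAt (hasDerivAt_zetaRegular X.L (hsub hz))
    have h2 : HasDerivAt (fun w : ℂ => ((X.a : ℂ) ^ 2)⁻¹ * w) ((X.a : ℂ) ^ 2)⁻¹ (conj z) := by
      simpa using (hasDerivAt_id (conj z)).const_mul ((X.a : ℂ) ^ 2)⁻¹
    have h3 := h1.add (hasFDerivAt_comp_conj h2)
    rw [wirtinger_add] at h3
    simp only [add_zero, zero_add] at h3
    exact h3
  have hdout : ∀ z ∈ X.outside, HasFDerivAt (weierstrassZeta X.L)
      (wirtinger (-X.L.weierstrassP z) 0) z := fun z hz =>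
    hasFDerivAt_of_hasDerivAt (hasDerivAt_weierstrassZeta X.L (notMem_lattice_of_mem_outside hz))
  obtain ⟨C₁, hC₁⟩ := (isCompact_closedBall (0 : ℂ) X.a).exists_bound_of_continuousOn hPc
  obtain ⟨C₂, hC₂⟩ := norm_bounded_on_outside (X := X) (f := fun z => -X.L.weierstrassP z)
    (X.L.differentiableOn_weierstrassP.continuousOn.neg.mono
      fun _ hz => notMem_lattice_of_mem_outside hz)
    fun P hP z _ => by rw [X.L.weierstrassP_add_coe z ⟨P, hP⟩]
  set w := X.glue T Fd (weierstrassZeta X.L) with hw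
  have hcont : Continuous w := continuous_glue hq hm
    (hEc.add (by fun_prop)) fun z hz => (hdout z hz).continuousAt.continuousWithinAt
  have hin : ∀ P ∈ X.L.lattice, ∀ z, ‖z - P‖ < X.a → HasFDerivAt w
      (wirtinger (-X.L.weierstrassPExcept 0 (z - P)) ((X.a : ℂ) ^ 2)⁻¹) z := fun P hP z hz =>
    hasFDerivAt_glue_inside hP hz (hdin _ (mem_closedBall_zero_iff.2 hz.le))
  have hout : ∀ z, (∀ P ∈ X.L.lattice, X.a < ‖z - P‖) → HasFDerivAt w
      (wirtinger (-X.L.weierstrassP z) 0) z := fun z hz =>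
    hasFDerivAt_glue_outside hz (hdout z fun P hP => (hz P hP).le)
  have hlip : LipschitzWith (Real.toNNReal (max (C₁ + ‖((X.a : ℂ) ^ 2)⁻¹‖) C₂)) w := by
    refine X.lipschitz_of_fderiv_bound hcont fun z hz => ?_
    suffices h : DifferentiableAt ℝ w z ∧ ‖fderiv ℝ w z‖ ≤ max (C₁ + ‖((X.a : ℂ) ^ 2)⁻¹‖) C₂ from
      ⟨h.1, h.2.trans (Real.le_coe_toNNReal _)⟩
    rcases cases_of_notMem_interfaces hz with h | ⟨P, hP, h, -⟩
    · refine ⟨(hout z h).differentiableAt, ?_⟩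
      rw [(hout z h).fderiv]
      refine (norm_wirtinger_le _ _).trans (le_max_of_le_right ?_)
      rw [norm_zero, add_zero]
      exact hC₂ z fun P hP => (h P hP).le
    · refine ⟨(hin P hP z h).differentiableAt, ?_⟩
      rw [(hin P hP z h).fderiv]
      refine (norm_wirtinger_le _ _).trans (le_max_of_le_left ?_)
      gcongr
      exact hC₁ _ (mem_closedBall_zero_iff.2 h.le)
  have hqw : ∀ P ∈ X.L.lattice, ∀ z, w (z + P) = w z + T P := fun P hP z =>
    glue_quasiPeriodic hq hP z
  set B := {z : ℂ | ∃ P ∈ X.L.lattice, ‖z - P‖ < X.a} with hB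
  have hBm : MeasurableSet B := by
    have : B = ⋃ P : X.L.lattice, ball (P : ℂ) X.a := by
      ext z; simp [hB, dist_eq_norm]
    rw [this]
    exact (isOpen_iUnion fun _ => isOpen_ball).measurableSet
  have hae : ∀ᵐ z, fderiv ℝ w z 1 + Complex.I * fderiv ℝ w z Complex.I =
      B.indicator (fun _ => 2 * ((X.a : ℂ) ^ 2)⁻¹) z := by
    filter_upwards [X.ae_notMem_interfaces] with z hz
    rcases cases_of_notMem_interfaces hz with h | ⟨P, hP, h, -⟩
    · rw [(hout z h).fderiv, indicator_of_notMem
        (show z ∉ B from fun ⟨P, hP, hlt⟩ => absurd hlt (h P hP).not_gt)]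
      simp only [wirtinger_apply, map_one, Complex.conj_I]
      linear_combination -X.L.weierstrassP z * Complex.I_mul_I
    · rw [(hin P hP z h).fderiv, indicator_of_mem (show z ∈ B from ⟨P, hP, h⟩)]
      simp only [wirtinger_apply, map_one, Complex.conj_I]
      linear_combination (-X.L.weierstrassPExcept 0 (z - P) - ((X.a : ℂ) ^ 2)⁻¹) * Complex.I_mul_I
  have hint : ∀ v : ℂ, Integrable (fun z => fderiv ℝ w z v) (volume.restrict X.cell) := by
    intro v
    refine Integrable.mono' (integrable_const
      (Real.toNNReal (max (C₁ + ‖((X.a : ℂ) ^ 2)⁻¹‖) C₂) * ‖v‖))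
      (measurable_fderiv_apply_const ℝ w v).aestronglyMeasurable (Eventually.of_forall fun z => ?_)
    exact (ContinuousLinearMap.le_opNorm _ _).trans (by
      gcongr; exact norm_fderiv_le_of_lipschitz ℝ hlip)
  have h1 : ∫ z in X.cell, (fderiv ℝ w z 1 + Complex.I * fderiv ℝ w z Complex.I) =
      X.area * T 1 + Complex.I * (X.area * T Complex.I) := by
    rw [integral_add (hint 1) ((hint Complex.I).const_mul _), integral_const_mul,
      X.integral_cell_fderiv hlip hqw, X.integral_cell_fderiv hlip hqw]
  rw [integral_congr_ae (ae_restrict_of_ae hae), integral_indicator hBm,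
    Measure.restrict_restrict hBm, setIntegral_const, volume_cell_inter_tubes,
    Complex.real_smul] at h1
  push_cast at h1
  field_simp at h1
  linear_combination -h1

end TubeArray

/-! ### Symmetry with respect to the real axis -/

section Symmetry

variable {L : PeriodPair} {ℓ : ℝ}

/-- Near the origin the Taylor coefficients are rational multiples of lattice sums, hence real. -/
theorem zetaRegular_conj (hℓ : ∀ P ∈ L.lattice, P ≠ 0 → ℓ ≤ ‖P‖)
    (hs : ∀ k, 2 ≤ k → (latticeSum L k).im = 0) {z : ℂ} (hz : ‖z‖ < ℓ) :
    zetaRegular L (conj z) = conj (zetaRegular L z) := by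
  have hz' : ‖conj z‖ < ℓ := by rwa [Complex.norm_conj]
  have h1 := hasSum_iteratedDeriv_zetaRegular hℓ 0 hz
  have h2 := hasSum_iteratedDeriv_zetaRegular hℓ 0 hz'
  rw [mul_zero, iteratedDeriv_zero] at h1 h2
  refine h2.unique ((Complex.hasSum_conj'.2 h1).congr_fun fun m => ?_)
  have hr : conj (latticeSum L (0 + m + 1)) = latticeSum L (0 + m + 1) := by
    rw [Complex.conj_eq_iff_im]
    rcases m with _ | m
    · simp [latticeSum]
    · exact hs _ (by omega)
  simp only [map_neg, map_mul, map_div₀, map_pow, map_natCast, hr]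

theorem analyticOnNhd_weierstrassZeta : AnalyticOnNhd ℂ (weierstrassZeta L) (L.lattice : Set ℂ)ᶜ :=
  DifferentiableOn.analyticOnNhd (fun _ hz =>
    (hasDerivAt_weierstrassZeta L hz).differentiableAt.differentiableWithinAt)
    (isOpen_compl_lattice L)

/-- Identity theorem, starting from the Taylor disc. The common domain is the complement of a
countable set, hence connected. -/
theorem weierstrassZeta_conj_of_notMem (h0 : 0 < ℓ) (hℓ : ∀ P ∈ L.lattice, P ≠ 0 → ℓ ≤ ‖P‖)
    (hs : ∀ k, 2 ≤ k → (latticeSum L k).im = 0) {z : ℂ} (hz : z ∉ L.lattice)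
    (hz' : conj z ∉ L.lattice) : weierstrassZeta L z = conj (weierstrassZeta L (conj z)) := by
  set V : Set ℂ := (L.lattice : Set ℂ)ᶜ ∩ conj ⁻¹' (L.lattice : Set ℂ)ᶜ with hV
  have hVo : IsOpen V :=
    (isOpen_compl_lattice L).inter ((isOpen_compl_lattice L).preimage Complex.continuous_conj)
  have hVp : IsPreconnected V := by
    rw [hV, preimage_compl, ← compl_union]
    exact isPreconnected_compl_of_countable ((countable_coe_lattice L).union
      ((countable_coe_lattice L).preimage_of_injOn (starRingEnd ℂ).injective.injOn))
  have hf : AnalyticOnNhd ℂ (weierstrassZeta L) V :=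
    analyticOnNhd_weierstrassZeta.mono inter_subset_left
  have hg : AnalyticOnNhd ℂ (fun z => conj (weierstrassZeta L (conj z))) V := by
    refine DifferentiableOn.analyticOnNhd (fun w hw => ?_) hVo
    have := (hasDerivAt_weierstrassZeta L hw.2).conj_conj
    rw [Complex.conj_conj] at this
    exact this.differentiableAt.differentiableWithinAt
  have hnear : ∀ w : ℂ, ‖w‖ < ℓ → w ≠ 0 → w ∉ L.lattice := fun w h1 h2 h3 =>
    absurd (hℓ w h3 h2) h1.not_ge
  have hz0 : ‖((ℓ / 2 : ℝ) : ℂ)‖ < ℓ := by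
    rw [Complex.norm_real, Real.norm_of_nonneg (by positivity)]; linarith
  have hz1 : ((ℓ / 2 : ℝ) : ℂ) ≠ 0 := Complex.ofReal_ne_zero.2 (by positivity)
  refine hf.eqOn_of_preconnected_of_eventuallyEq hg hVp (z₀ := ((ℓ / 2 : ℝ) : ℂ))
    ⟨hnear _ hz0 hz1, ?_⟩ ?_ ⟨hz, hz'⟩
  · rw [mem_preimage, Complex.conj_ofReal]
    exact hnear _ hz0 hz1
  · filter_upwards [isOpen_ball.mem_nhds (mem_ball_zero_iff.2 hz0)] with w hw
    rw [weierstrassZeta_eq, weierstrassZeta_eq, zetaRegular_conj hℓ hs (mem_ball_zero_iff.1 hw)]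
    simp

/-- The lattice is the pole set of `ζ`. If `P̄` were not in it, `conj ζ(conj (z + P))` would stay
bounded as `z → 0`, while `ζ(z + P)` has a simple pole. Multiplied by `z`, the two sides would tend
to `0` and `1`. -/
theorem conj_mem_lattice (h0 : 0 < ℓ) (hℓ : ∀ P ∈ L.lattice, P ≠ 0 → ℓ ≤ ‖P‖)
    (hs : ∀ k, 2 ≤ k → (latticeSum L k).im = 0) {P : ℂ} (hP : P ∈ L.lattice) :
    conj P ∈ L.lattice := by
  by_contra hn
  obtain ⟨T, hT⟩ := exists_zeta_quasiPeriod L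
  set W : Set ℂ := ((L.lattice : Set ℂ) ∪ (fun z => conj (z + P)) ⁻¹' (L.lattice : Set ℂ))ᶜ with hW
  have hinj : Function.Injective fun z : ℂ => conj (z + P) := fun x y h => by
    simpa using (starRingEnd ℂ).injective h
  have hWd : Dense W := Set.Countable.dense_compl ℝ ((countable_coe_lattice L).union
    ((countable_coe_lattice L).preimage_of_injOn hinj.injOn))
  have : (𝓝[W] (0 : ℂ)).NeBot := mem_closure_iff_nhdsWithin_neBot.1 (hWd 0)
  have hE : ContinuousAt (zetaRegular L) 0 :=
    (hasDerivAt_zetaRegular L (by simp)).continuousAt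
  have h1 : Tendsto (fun z => (zetaRegular L z + T P) * z + 1) (𝓝[W] 0) (𝓝 1) := by
    have : ContinuousAt (fun z => (zetaRegular L z + T P) * z + 1) 0 := by fun_prop
    simpa using this.tendsto.mono_left nhdsWithin_le_nhds
  have hζ : ContinuousAt (weierstrassZeta L) (conj (0 + P)) := by
    rw [zero_add]; exact (hasDerivAt_weierstrassZeta L hn).continuousAt
  have h2 : Tendsto (fun z => conj (weierstrassZeta L (conj (z + P))) * z) (𝓝[W] 0) (𝓝 0) := by
    have h3 : ContinuousAt (fun z => weierstrassZeta L (conj (z + P))) 0 :=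
      ContinuousAt.comp (f := fun z : ℂ => conj (z + P)) hζ (by fun_prop)
    have : ContinuousAt (fun z => conj (weierstrassZeta L (conj (z + P))) * z) 0 :=
      (Complex.continuous_conj.continuousAt.comp h3).mul continuousAt_id
    simpa using this.tendsto.mono_left nhdsWithin_le_nhds
  refine one_ne_zero (tendsto_nhds_unique (h1.congr' ?_) h2)
  filter_upwards [self_mem_nhdsWithin] with z hz
  have hz1 : z ∉ L.lattice := fun h => hz (Or.inl h)
  have hz2 : conj (z + P) ∉ L.lattice := fun h => hz (Or.inr h)
  have hz0 : z ≠ 0 := fun h => hz1 (h ▸ zero_mem _)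
  rw [← weierstrassZeta_conj_of_notMem h0 hℓ hs (add_notMem_lattice L hP hz1) hz2, hT P hP z hz1,
    weierstrassZeta_eq]
  field_simp
  ring

end Symmetry

/-! ### The gap between the tubes, and the constants `η₁`, `A`, `B` -/

namespace TubeArray

variable (X : TubeArray)

/-- The minimum of `‖P‖` is attained because only finitely many lattice points satisfy `‖P‖ ≤ ‖ω₁‖`.
The margin `ℓ - 2a` makes every later series converge geometrically. -/
theorem exists_min_norm (h : ∀ P ∈ X.L.lattice, P ≠ 0 → 2 * X.a < ‖P‖) :
    ∃ ℓ, 2 * X.a < ℓ ∧ ∀ P ∈ X.L.lattice, P ≠ 0 → ℓ ≤ ‖P‖ := by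
  set s := {P : X.L.lattice | ‖(P : ℂ) - 0‖ ≤ ‖X.L.ω₁‖} ∩ {P | P ≠ 0} with hs
  have hf : s.Finite := (X.finite_lattice_norm_sub_le 0 ‖X.L.ω₁‖).inter_of_left _
  have hω : X.L.ω₁ ≠ 0 := fun h0 => X.L.ω₁_div_two_notMem_lattice (by rw [h0]; simp)
  have hne : s.Nonempty := ⟨⟨X.L.ω₁, X.L.ω₁_mem_lattice⟩, by simp, by simpa using hω⟩
  obtain ⟨Q, hQ, hmin⟩ := hf.exists_minimalFor (fun P : X.L.lattice => ‖(P : ℂ)‖) s hne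
  refine ⟨‖(Q : ℂ)‖, h Q Q.2 (by simpa using hQ.2), fun P hP hP0 => ?_⟩
  by_cases hle : ‖P‖ ≤ ‖X.L.ω₁‖
  · by_contra hlt
    exact hlt (hmin (j := ⟨P, hP⟩) ⟨by simpa using hle, by simpa using hP0⟩ (not_le.1 hlt).le)
  · have := hQ.1
    simp only [sub_zero, mem_ofPred_eq] at this
    exact this.trans (not_le.1 hle).le

theorem η₁_im {ℓ : ℝ} (h0 : 0 < ℓ) (hℓ : ∀ P ∈ X.L.lattice, P ≠ 0 → ℓ ≤ ‖P‖)
    (hs : ∀ k, 2 ≤ k → (latticeSum X.L k).im = 0) (h1 : X.L.ω₁.im = 0) : X.η₁.im = 0 := by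
  have hr : conj (X.L.ω₁ / 2) = X.L.ω₁ / 2 := by
    rw [Complex.conj_eq_iff_im]; simp [h1]
  have hn := X.L.ω₁_div_two_notMem_lattice
  have := weierstrassZeta_conj_of_notMem h0 hℓ hs hn (by rwa [hr])
  rw [hr] at this
  exact Complex.conj_eq_iff_im.1 this.symm

/-- The quasi-periods of the zeta function in Wirtinger form. -/
theorem exists_wirtinger_quasiPeriod (h1 : X.L.ω₁.im = 0) :
    ∃ A B : ℂ, X.area * B = Real.pi ∧ X.L.ω₁ * (A + B) = 2 * X.η₁ ∧
      ∀ P ∈ X.L.lattice, ∀ z ∉ X.L.lattice,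
        weierstrassZeta X.L (z + P) = weierstrassZeta X.L z + wirtinger A B P := by
  obtain ⟨T, hT⟩ := exists_zeta_quasiPeriod X.L
  have hw : ∀ v, T v = wirtinger ((T 1 - Complex.I * T Complex.I) / 2)
      ((T 1 + Complex.I * T Complex.I) / 2) v := by
    intro v
    have hv : v = v.re • (1 : ℂ) + v.im • Complex.I := by
      simp [Complex.re_add_im]
    have hc : conj v = v.re - v.im * Complex.I := by
      apply Complex.ext <;> simp
    have hv' : v = v.re + v.im * Complex.I := (Complex.re_add_im v).symm
    have hT' : T v = v.re * T 1 + v.im * T Complex.I := by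
      conv_lhs => rw [hv, map_add, map_smul, map_smul]
      simp only [Complex.real_smul]
    rw [wirtinger_apply, hc, hT']
    linear_combination (v.im : ℂ) * T Complex.I * Complex.I_mul_I -
      (T 1 - Complex.I * T Complex.I) / 2 * hv'
  refine ⟨_, _, ?_, ?_, fun P hP z hz => by rw [hT P hP z hz, ← hw]⟩
  · linear_combination X.quasiPeriod_one_add hT / 2
  · have h2 := quasiPeriod_ω₁ X.L hT
    rw [hw, wirtinger_apply, Complex.conj_eq_iff_im.2 h1] at h2
    rw [η₁, ← h2]
    ring

end TubeArray

/-! ### The double series of lattice sums -/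

/-- Summing over the second index gives `x^i / (1 - y)^(i+1)`, a geometric series of ratio `x / (1 -
y) < 1`. -/
theorem summable_choose_mul_pow_mul_pow {x y : ℝ} (hx : 0 ≤ x) (hy : 0 ≤ y) (hxy : x + y < 1) :
    Summable fun p : ℕ × ℕ => ((p.1 + p.2).choose p.1 : ℝ) * x ^ p.1 * y ^ p.2 := by
  have hs : ∀ i : ℕ, HasSum (fun j : ℕ => ((i + j).choose i : ℝ) * x ^ i * y ^ j)
      (x ^ i * (1 / (1 - y) ^ (i + 1))) := by
    intro i
    have := (hasSum_choose_mul_geometric_of_norm_lt_one i (r := y)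
      (by rw [Real.norm_of_nonneg hy]; linarith)).mul_left (x ^ i)
    refine this.congr_fun fun j => ?_
    rw [add_comm i j]
    ring
  refine (summable_prod_of_nonneg fun p => by simp only [Pi.zero_apply]; positivity).2
    ⟨fun i => (hs i).summable, ?_⟩
  simp only [(hs _).tsum_eq]
  have h1 : 0 < 1 - y := by linarith
  have hg : Summable fun i : ℕ => (x / (1 - y)) ^ i * (1 - y)⁻¹ :=
    (summable_geometric_of_lt_one (by positivity) (by rw [div_lt_one h1]; linarith)).mul_right _
  refine hg.congr fun i => ?_
  rw [div_pow, pow_succ]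
  field_simp

/-- The coefficients `s_{n+m+1} (2n+2m+1)! / ((2n)! (2m+1)!)`. -/
noncomputable def zetaCoeff (L : PeriodPair) (n m : ℕ) : ℂ :=
  latticeSum L (n + m + 1) *
    (((2 * n + 2 * m + 1).factorial : ℂ) / ((2 * n).factorial * (2 * m + 1).factorial))

section

variable {L : PeriodPair} {ℓ : ℝ}

/-- Of the `2k + 2` powers of `1/‖P‖`, three are kept for convergence and the other `2k - 1` are
estimated by `1/ℓ`. -/
theorem exists_norm_latticeSum_le (h0 : 0 < ℓ) (hℓ : ∀ P ∈ L.lattice, P ≠ 0 → ℓ ≤ ‖P‖) :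
    ∃ C, 0 ≤ C ∧ ∀ k, ‖latticeSum L (k + 1)‖ ≤ C * (ℓ ^ (2 * k + 1))⁻¹ := by
  have hS : Summable fun P : L.lattice => ‖P‖ ^ (-3 : ℝ) :=
    ZLattice.summable_norm_rpow _ _ (by simp; norm_num)
  refine ⟨ℓ ^ 2 * ∑' P : L.lattice, ‖P‖ ^ (-3 : ℝ),
    mul_nonneg (by positivity) (tsum_nonneg fun P => by positivity), fun k => ?_⟩
  rw [latticeSum]
  split_ifs with hk
  · rw [norm_zero]
    exact mul_nonneg (mul_nonneg (by positivity) (tsum_nonneg fun P => by positivity))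
      (by positivity)
  have hk' : 1 ≤ k := by omega
  have hb : ∀ P : L.lattice, ‖((P : ℂ) ^ (2 * (k + 1)))⁻¹‖ ≤
      ℓ ^ 2 * (ℓ ^ (2 * k + 1))⁻¹ * ‖P‖ ^ (-3 : ℝ) := by
    intro P
    rcases eq_or_ne (P : ℂ) 0 with hP | hP
    · rw [hP, zero_pow (by omega), inv_zero, norm_zero]
      positivity
    · have h1 := hℓ P P.2 hP
      have h2 : 0 < ‖(P : ℂ)‖ := norm_pos_iff.2 hP
      have h3 : ‖P‖ ^ (3 : ℝ) = ‖(P : ℂ)‖ ^ 3 := by norm_cast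
      rw [norm_inv, norm_pow, Real.rpow_neg (norm_nonneg P), h3]
      obtain ⟨j, rfl⟩ := Nat.exists_eq_add_of_le' hk'
      rw [show 2 * (j + 1) + 1 = (2 * j + 1) + 2 by ring, pow_add ℓ, mul_inv, mul_comm (ℓ ^ 2),
        mul_assoc (ℓ ^ (2 * j + 1))⁻¹, inv_mul_cancel₀ (by positivity), mul_one, ← mul_inv,
        show 2 * (j + 1 + 1) = (2 * j + 1) + 3 by ring, pow_add ‖(P : ℂ)‖]
      gcongr
  calc ‖L.G (2 * (k + 1))‖ ≤ ∑' P : L.lattice, ℓ ^ 2 * (ℓ ^ (2 * k + 1))⁻¹ * ‖P‖ ^ (-3 : ℝ) :=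
        tsum_of_norm_bounded (hS.mul_left _).hasSum hb
    _ = _ := by rw [tsum_mul_left]; ring

/-- The factorial quotient is the binomial coefficient of `2n + 2m + 1` over `2n`, which reduces
this to the binomial double series in `x / ℓ` and `y / ℓ`. It justifies exchanging the multipole sum
with the Taylor sum; on the boundary of a tube `x = y = a`, so that `2a < ℓ` is needed. -/
theorem summable_zetaCoeff (hℓ : ∀ P ∈ L.lattice, P ≠ 0 → ℓ ≤ ‖P‖) {x y : ℝ} (hx : 0 ≤ x)
    (hy : 0 ≤ y) (hxy : x + y < ℓ) :
    Summable fun p : ℕ × ℕ => ‖zetaCoeff L p.1 p.2‖ * x ^ (2 * p.1) * y ^ (2 * p.2 + 1) := by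
  have h0 : 0 < ℓ := by linarith
  obtain ⟨C, hC0, hC⟩ := exists_norm_latticeSum_le h0 hℓ
  have hs := summable_choose_mul_pow_mul_pow (x := x / ℓ) (y := y / ℓ) (by positivity)
    (by positivity) (by rw [← add_div, div_lt_one h0]; exact hxy)
  have hinj : Function.Injective fun p : ℕ × ℕ => (2 * p.1, 2 * p.2 + 1) := by
    rintro ⟨a, b⟩ ⟨c, d⟩ h
    simp only [Prod.mk.injEq] at h ⊢
    omega
  refine Summable.of_nonneg_of_le (fun p => by positivity) (fun p => ?_)
    ((hs.comp_injective hinj).mul_left C)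
  obtain ⟨n, m⟩ := p
  have hc : ‖(((2 * n + 2 * m + 1).factorial : ℂ) / ((2 * n).factorial * (2 * m + 1).factorial))‖ =
      ((2 * n + (2 * m + 1)).choose (2 * n) : ℝ) := by
    rw [Nat.cast_add_choose, norm_div, norm_mul, Complex.norm_natCast, Complex.norm_natCast,
      Complex.norm_natCast]
    rfl
  simp only [Function.comp_apply, zetaCoeff, norm_mul, hc]
  calc _ ≤ C * (ℓ ^ (2 * (n + m) + 1))⁻¹ * ((2 * n + (2 * m + 1)).choose (2 * n) : ℝ) *
        x ^ (2 * n) * y ^ (2 * m + 1) := by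
        gcongr
        exact hC _
    _ = _ := by
        rw [div_pow, div_pow, show 2 * (n + m) + 1 = 2 * n + (2 * m + 1) by ring, pow_add ℓ,
          mul_inv]
        ring

end

namespace TubeArray

variable {X : TubeArray} {ℓ : ℝ} {g : ℕ → ℂ} {K : ℝ}

theorem summable_interaction_family (hℓ : ∀ P ∈ X.L.lattice, P ≠ 0 → ℓ ≤ ‖P‖)
    (hg : ∀ n, ‖g n‖ ≤ K) {z : ℂ} (hz : X.a + ‖z‖ < ℓ) :
    Summable fun p : ℕ × ℕ => zetaCoeff X.L p.1 p.2 * g p.1 * (X.a : ℂ) ^ (2 * p.1 + 1) *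
      z ^ (2 * p.2 + 1) := by
  have ha := X.a_pos
  refine Summable.of_norm_bounded
    ((summable_zetaCoeff hℓ ha.le (norm_nonneg z) hz).mul_left (K * X.a)) fun p => ?_
  rw [norm_mul, norm_mul, norm_mul, norm_pow, norm_pow, Complex.norm_real,
    Real.norm_of_nonneg ha.le]
  calc _ ≤ ‖zetaCoeff X.L p.1 p.2‖ * K * X.a ^ (2 * p.1 + 1) * ‖z‖ ^ (2 * p.2 + 1) := by
        gcongr
        exact hg _
    _ = _ := by ring

/-- In `zetaCoeff` the first index is the multipole order and the second the Taylor order; in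
`interaction` their roles are exchanged. -/
theorem interaction_term_eq (g : ℕ → ℂ) (w : ℂ) (n m : ℕ) :
    zetaCoeff X.L n m * g n * (X.a : ℂ) ^ (2 * n + 1) * (X.a * w) ^ (2 * m + 1) =
      latticeSum X.L (m + n + 1) * (((2 * m + 2 * n + 1).factorial : ℂ)
        / (((2 * n).factorial : ℂ) * ((2 * m + 1).factorial : ℂ)))
        * g n * (X.a : ℂ) ^ (2 * m + 2 * n + 2) * w ^ (2 * m + 1) := by
  rw [zetaCoeff, mul_pow, add_comm m n, add_comm (2 * m) (2 * n)]
  ring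

theorem summable_interaction (hℓ : ∀ P ∈ X.L.lattice, P ≠ 0 → ℓ ≤ ‖P‖) (hlt : 2 * X.a < ℓ)
    (hg : ∀ n, ‖g n‖ ≤ K) (m : ℕ) :
    Summable fun k : ℕ => latticeSum X.L (m + k + 1)
      * (((2 * m + 2 * k + 1).factorial : ℂ)
        / (((2 * k).factorial : ℂ) * ((2 * m + 1).factorial : ℂ)))
      * g k * (X.a : ℂ) ^ (2 * m + 2 * k + 2) := by
  have := (summable_interaction_family (z := X.a * 1) hℓ hg (by
    rw [mul_one, Complex.norm_real, Real.norm_of_nonneg X.a_pos.le]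
    linarith)).prod_symm.prod_factor
      m
  refine this.congr fun k => ?_
  rw [Prod.swap_prod_mk, interaction_term_eq, one_pow, mul_one]

theorem interaction_add (hℓ : ∀ P ∈ X.L.lattice, P ≠ 0 → ℓ ≤ ‖P‖) (hlt : 2 * X.a < ℓ)
    {h : ℕ → ℂ} {K' : ℝ} (hg : ∀ n, ‖g n‖ ≤ K) (hh : ∀ n, ‖h n‖ ≤ K') (p q : ℂ) (m : ℕ) :
    X.interaction (fun n => p * g n + q * h n) m =
      p * X.interaction g m + q * X.interaction h m := by
  have h1 := (summable_interaction hℓ hlt hg m).mul_left p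
  have h2 := (summable_interaction hℓ hlt hh m).mul_left q
  rw [interaction, interaction, interaction, ← tsum_mul_left, ← tsum_mul_left, ← h1.tsum_add h2]
  congr 1
  ext k
  ring

/-- The regular parts of the multipoles of all tubes, expanded in the tube at the origin. -/
theorem exists_hasSum_interaction (hℓ : ∀ P ∈ X.L.lattice, P ≠ 0 → ℓ ≤ ‖P‖)
    (hg : ∀ n, ‖g n‖ ≤ K) {w : ℂ} (hw : X.a + X.a * ‖w‖ < ℓ) :
    ∃ s, HasSum (fun m => X.interaction g m * w ^ (2 * m + 1)) s ∧
      HasSum (fun n => g n * ((X.a : ℂ) ^ (2 * n + 1) *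
        (iteratedDeriv (2 * n) (zetaRegular X.L) (X.a * w) / ((2 * n).factorial : ℂ)))) (-s) := by
  have ha := X.a_pos
  have hn : ‖(X.a * w : ℂ)‖ = X.a * ‖w‖ := by
    rw [norm_mul, Complex.norm_real, Real.norm_of_nonneg ha.le]
  have hF := summable_interaction_family hℓ hg (z := X.a * w) (by rwa [hn])
  refine ⟨∑' p : ℕ × ℕ, zetaCoeff X.L p.1 p.2 * g p.1 * (X.a : ℂ) ^ (2 * p.1 + 1) *
      (X.a * w) ^ (2 * p.2 + 1), ?_, ?_⟩
  · have h1 := hF.hasSum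
    rw [← (Equiv.prodComm ℕ ℕ).hasSum_iff] at h1
    refine h1.prod_fiberwise fun m => ?_
    have h2 := hF.prod_symm.prod_factor m
    simp only [Prod.swap_prod_mk] at h2
    refine h2.hasSum_iff.2 ?_
    simp only [interaction_term_eq]
    rw [tsum_mul_right, interaction]
  · refine (hF.hasSum.neg).prod_fiberwise fun n => ?_
    have h1 := hasSum_iteratedDeriv_zetaRegular hℓ n (z := X.a * w)
      (by rw [hn]; linarith [norm_nonneg w])
    have h2 := (h1.div_const ((2 * n).factorial : ℂ)).mul_left (g n * (X.a : ℂ) ^ (2 * n + 1))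
    rw [mul_assoc] at h2
    refine h2.congr_fun fun m => ?_
    have := Nat.factorial_ne_zero (2 * n)
    simp only [zetaCoeff]
    field_simp

theorem summable_norm_interaction (hℓ : ∀ P ∈ X.L.lattice, P ≠ 0 → ℓ ≤ ‖P‖)
    (hg : ∀ n, ‖g n‖ ≤ K) {t : ℝ} (h0 : 0 ≤ t) (ht : X.a + X.a * t < ℓ) :
    Summable fun m => ‖X.interaction g m‖ * t ^ (2 * m + 1) := by
  obtain ⟨s, h1, -⟩ := exists_hasSum_interaction (w := t) hℓ hg
    (by rwa [Complex.norm_real, Real.norm_of_nonneg h0])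
  refine h1.summable.norm.congr fun m => ?_
  rw [norm_mul, norm_pow, Complex.norm_real, Real.norm_of_nonneg h0]

/-! ### The response coefficients -/

theorem ν_nonneg (X : TubeArray) : 0 ≤ X.ν := div_nonneg X.b_nonneg X.a_pos.le

theorem ν_lt_one (X : TubeArray) : X.ν < 1 := (div_lt_one X.a_pos).2 X.b_lt_a

theorem tendsto_ν_pow (X : TubeArray) :
    Tendsto (fun n : ℕ => (X.ν : ℂ) ^ (4 * n + 2)) atTop (𝓝 0) := by
  have h1 : Tendsto (fun n : ℕ => (X.ν : ℂ) ^ n) atTop (𝓝 0) :=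
    tendsto_pow_atTop_nhds_zero_of_norm_lt_one (by
      rw [Complex.norm_real, Real.norm_of_nonneg X.ν_nonneg]; exact X.ν_lt_one)
  exact h1.comp (tendsto_atTop_mono (fun n => show n ≤ 4 * n + 2 by omega) tendsto_id)

theorem exists_norm_le_of_tendsto {f : ℕ → ℂ} {l : ℂ} (h : Tendsto f atTop (𝓝 l)) :
    ∃ C, ∀ n, ‖f n‖ ≤ C := by
  obtain ⟨C, hC⟩ := (Metric.isBounded_range_of_tendsto f h).exists_norm_le
  exact ⟨C, fun n => hC _ (mem_range_self n)⟩

theorem tendsto_inv_γden (X : TubeArray) : Tendsto (fun n => (X.γden n)⁻¹) atTop (𝓝 1) := by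
  have : Tendsto (fun n => X.γden n) atTop (𝓝 1) := by
    simpa [γden] using (X.tendsto_ν_pow.const_mul (X.α * X.α')).const_sub 1
  simpa using this.inv₀ one_ne_zero

theorem exists_norm_inv_γden_le (X : TubeArray) : ∃ C, ∀ n, ‖(X.γden n)⁻¹‖ ≤ C :=
  exists_norm_le_of_tendsto X.tendsto_inv_γden

theorem exists_norm_γ_le (X : TubeArray) : ∃ C, ∀ n, ‖X.γ n‖ ≤ C :=
  exists_norm_le_of_tendsto (l := (X.α - X.α' * 0) * 1)
    (((X.tendsto_ν_pow.const_mul X.α').const_sub X.α).mul X.tendsto_inv_γden)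

end TubeArray

/-! ### Multipole series outside the tubes -/

theorem differentiableAt_iteratedDeriv_weierstrassZeta {L : PeriodPair} {z : ℂ} (hz : z ∉ L.lattice)
    (n : ℕ) : DifferentiableAt ℂ (iteratedDeriv n (weierstrassZeta L)) z := by
  rw [iteratedDeriv_eq_iterate]
  exact (analyticOnNhd_weierstrassZeta.iterated_deriv n z hz).differentiableAt

namespace TubeArray

variable (X : TubeArray)

/-- Cauchy's estimates for the derivatives of the zeta function, locally uniform. -/
theorem exists_norm_iteratedDeriv_le {r : ℝ} (hr : 0 < r) {z₀ : ℂ}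
    (hz₀ : ∀ P ∈ X.L.lattice, r < ‖z₀ - P‖) :
    ∃ δ > 0, ∃ M, (∀ z ∈ ball z₀ δ, ∀ P ∈ X.L.lattice, r < ‖z - P‖) ∧
      ∀ z ∈ ball z₀ δ, ∀ n,
        ‖iteratedDeriv n (weierstrassZeta X.L) z‖ ≤ n.factorial * M / r ^ n := by
  obtain ⟨δ, hδ, hsub⟩ := nhds_basis_closedBall.mem_iff.1 ((X.isOpen_strict_outside r).mem_nhds hz₀)
  have hK : IsCompact (cthickening r (closedBall z₀ δ)) := (isCompact_closedBall z₀ δ).cthickening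
  have hKs : cthickening r (closedBall z₀ δ) ⊆ (X.L.lattice : Set ℂ)ᶜ := by
    rw [(isCompact_closedBall z₀ δ).cthickening_eq_biUnion_closedBall hr.le]
    simp only [iUnion_subset_iff]
    intro z hz y hy hyL
    have := hsub hz y hyL
    rw [mem_closedBall_iff_norm'] at hy
    linarith
  have hd : DifferentiableOn ℂ (weierstrassZeta X.L) (cthickening r (closedBall z₀ δ)) :=
    fun z hz => (hasDerivAt_weierstrassZeta X.L (hKs hz)).differentiableAt.differentiableWithinAt
  obtain ⟨M, hM⟩ := hK.exists_bound_of_continuousOn hd.continuousOn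
  refine ⟨δ, hδ, M, fun z hz => hsub (ball_subset_closedBall hz), fun z hz n => ?_⟩
  have hb : closedBall z r ⊆ cthickening r (closedBall z₀ δ) :=
    closedBall_subset_cthickening (ball_subset_closedBall hz) r
  refine Complex.norm_iteratedDeriv_le_of_forall_mem_sphere_norm_le n hr ?_
    fun w hw => hM w (hb (sphere_subset_closedBall hw))
  refine DifferentiableOn.diffContOnCl ?_
  rw [closure_ball z hr.ne']
  exact hd.mono hb

/-- The `n`-th multipole term `a^{2n+1} ζ^{(2n)}(z) / (2n)!`. -/
noncomputable def multipole (n : ℕ) (z : ℂ) : ℂ :=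
  (X.a : ℂ) ^ (2 * n + 1) *
    (iteratedDeriv (2 * n) (weierstrassZeta X.L) z / ((2 * n).factorial : ℂ))

variable {X} {g : ℕ → ℂ} {t : ℝ}

/-- The multipole series converges and is holomorphic a little beyond the region outside the
tubes, if the coefficients decay exponentially. -/
theorem multipole_series (ht : 0 < t) (hg : Summable fun n => ‖g n‖ * t ^ (2 * n)) {z : ℂ}
    (hz : ∀ P ∈ X.L.lattice, X.a / t < ‖z - P‖) :
    Summable (fun n => ‖g n * X.multipole n z‖) ∧
      DifferentiableAt ℂ (fun z => ∑' n, g n * X.multipole n z) z := by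
  have ha := X.a_pos
  have hr : 0 < X.a / t := by positivity
  -- Cauchy's estimate on circles of radius `a / t` cancels `(2n)!` and `a^(2n)` and leaves the
  -- bound `a M t^(2n)` for the multipole terms.
  obtain ⟨δ, hδ, M, hout, hM⟩ := X.exists_norm_iteratedDeriv_le hr hz
  have hb : ∀ n, ∀ y ∈ ball z δ, ‖g n * X.multipole n y‖ ≤ X.a * M * (‖g n‖ * t ^ (2 * n)) := by
    intro n y hy
    have h1 := hM y hy (2 * n)
    have hf : (0 : ℝ) < (2 * n).factorial := by exact_mod_cast Nat.factorial_pos _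
    rw [norm_mul, multipole, norm_mul, norm_pow, Complex.norm_real, Real.norm_of_nonneg ha.le,
      norm_div, Complex.norm_natCast]
    calc _ ≤ ‖g n‖ * (X.a ^ (2 * n + 1) *
          (((2 * n).factorial * M / (X.a / t) ^ (2 * n)) / (2 * n).factorial)) := by gcongr
      _ = _ := by
        rw [div_pow, pow_succ]
        field_simp
  have hs := hg.mul_left (X.a * M)
  refine ⟨hs.of_nonneg_of_le (fun n => norm_nonneg _) fun n => hb n z (mem_ball_self hδ), ?_⟩
  refine (Complex.differentiableOn_tsum_of_summable_norm hs (fun n y hy => ?_)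
    isOpen_ball hb).differentiableAt
    (isOpen_ball.mem_nhds (mem_ball_self hδ))
  have hy' : y ∉ X.L.lattice := fun h => by
    have := hout y hy y h
    rw [sub_self, norm_zero] at this
    linarith
  exact ((((differentiableAt_iteratedDeriv_weierstrassZeta hy' (2 * n)).div_const _).const_mul
    _).const_mul _).differentiableWithinAt

/-- A quasi-period is a constant, which every derivative of `ζ` kills; only the dipole `n = 0` keeps
it. -/
theorem multipole_add {T : ℂ →L[ℝ] ℂ} (hT : ∀ P ∈ X.L.lattice, ∀ z ∉ X.L.lattice,
    weierstrassZeta X.L (z + P) = weierstrassZeta X.L z + T P) {P z : ℂ} (hP : P ∈ X.L.lattice)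
    (hz : z ∉ X.L.lattice) (n : ℕ) :
    X.multipole n (z + P) = X.multipole n z + if n = 0 then X.a * T P else 0 := by
  rcases n with _ | n
  · simp [multipole, hT P hP z hz]
    ring
  · have h1 : (fun w => weierstrassZeta X.L (w + P)) =ᶠ[𝓝 z]
        fun w => T P + weierstrassZeta X.L w := by
      filter_upwards [(isOpen_compl_lattice X.L).mem_nhds hz] with w hw
      rw [hT P hP w hw, add_comm]
    have h2 := h1.iteratedDeriv_eq (2 * (n + 1))
    rw [iteratedDeriv_comp_add_const, iteratedDeriv_const_add (by omega)] at h2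
    simp only at h2
    rw [multipole, h2, multipole, if_neg (by omega), add_zero]

theorem tsum_multipole_add {T : ℂ →L[ℝ] ℂ} (hT : ∀ P ∈ X.L.lattice, ∀ z ∉ X.L.lattice,
    weierstrassZeta X.L (z + P) = weierstrassZeta X.L z + T P) (ht : 0 < t)
    (hg : Summable fun n => ‖g n‖ * t ^ (2 * n)) {P z : ℂ} (hP : P ∈ X.L.lattice)
    (hz : ∀ P ∈ X.L.lattice, X.a / t < ‖z - P‖) :
    ∑' n, g n * X.multipole n (z + P) = ∑' n, g n * X.multipole n z + X.a * g 0 * T P := by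
  have hzL : z ∉ X.L.lattice := fun h => by
    have := hz z h
    rw [sub_self, norm_zero] at this
    exact this.not_ge (div_pos X.a_pos ht).le
  have h1 := (multipole_series ht hg hz).1.of_norm.hasSum
  have h2 : HasSum (fun n => if n = 0 then X.a * g 0 * T P else 0) (X.a * g 0 * T P) :=
    hasSum_ite_eq 0 _
  rw [← (h1.add h2).tsum_eq]
  congr 1
  ext n
  rw [multipole_add hT hP hzL]
  split_ifs with h
  · subst h; ring
  · ring

/-- The multipole series on the boundary of the tube at the origin. -/
theorem hasSum_multipole {ℓ K : ℝ} (hℓ : ∀ P ∈ X.L.lattice, P ≠ 0 → ℓ ≤ ‖P‖) (hlt : 2 * X.a < ℓ)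
    (hg : ∀ n, ‖g n‖ ≤ K) {w : ℂ} (hw : ‖w‖ = 1)
    (hs : Summable fun n => g n * conj w ^ (2 * n + 1)) :
    HasSum (fun n => g n * X.multipole n (X.a * w))
      (∑' n, g n * conj w ^ (2 * n + 1) - ∑' n, X.interaction g n * w ^ (2 * n + 1)) := by
  have ha := X.a_pos
  have ha0 : (X.a : ℂ) ≠ 0 := Complex.ofReal_ne_zero.2 ha.ne'
  obtain ⟨s, h1, h2⟩ := exists_hasSum_interaction hℓ hg (w := w) (by rw [hw]; linarith)
  rw [h1.tsum_eq, sub_eq_add_neg]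
  refine (hs.hasSum.add h2).congr_fun fun n => ?_
  have hn : ‖(X.a * w : ℂ)‖ = X.a := by
    rw [norm_mul, hw, Complex.norm_real, Real.norm_of_nonneg ha.le, mul_one]
  have hL : (X.a * w : ℂ) ∉ X.L.lattice := fun h => by
    have := hℓ _ h (norm_pos_iff.1 (by rwa [hn]))
    linarith
  -- On the unit circle the singular part `w^(-2n-1)` is the power `w̄^(2n+1)`: what the `z`-part
  -- scatters is matched with what comes in through the `z̄`-part.
  have hi : conj w = w⁻¹ := by
    rw [Complex.inv_def, Complex.normSq_eq_norm_sq, hw]; simp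
  have := Nat.factorial_ne_zero (2 * n)
  have hf : ((2 * n).factorial : ℂ) ≠ 0 := by exact_mod_cast this
  rw [multipole, iteratedDeriv_weierstrassZeta hL, hi, mul_pow, mul_inv, inv_pow]
  field_simp
  ring

end TubeArray

/-! ### Odd power series -/

section

variable {A c : ℕ → ℂ} {t C : ℝ}

theorem norm_odd_term_le {w : ℂ} (hw : ‖w‖ ≤ t) (n : ℕ) :
    ‖A n * w ^ (2 * n + 1)‖ ≤ ‖A n‖ * t ^ (2 * n + 1) := by
  rw [norm_mul, norm_pow]
  gcongr

theorem summable_odd_series (hA : Summable fun n => ‖A n‖ * t ^ (2 * n + 1)) {w : ℂ}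
    (hw : ‖w‖ ≤ t) : Summable fun n => A n * w ^ (2 * n + 1) :=
  Summable.of_norm_bounded hA fun n => norm_odd_term_le hw n

theorem differentiableOn_odd_series (hA : Summable fun n => ‖A n‖ * t ^ (2 * n + 1)) :
    DifferentiableOn ℂ (fun w => ∑' n, A n * w ^ (2 * n + 1)) (ball 0 t) :=
  Complex.differentiableOn_tsum_of_summable_norm hA
    (fun _ => ((differentiable_id.pow _).const_mul _).differentiableOn) isOpen_ball
    fun n _ hw => norm_odd_term_le (mem_ball_zero_iff.1 hw).le n

theorem summable_odd_mul (ht : 0 ≤ t) (hc : ∀ n, ‖c n‖ ≤ C)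
    (hA : Summable fun n => ‖A n‖ * t ^ (2 * n + 1)) :
    Summable fun n => ‖c n * A n‖ * t ^ (2 * n + 1) := by
  refine (hA.mul_left C).of_nonneg_of_le (fun n => by positivity) fun n => ?_
  rw [norm_mul, ← mul_assoc]
  gcongr
  exact hc n

theorem norm_le_of_summable_odd (ht : 1 ≤ t) (hA : Summable fun n => ‖A n‖ * t ^ (2 * n + 1)) :
    Summable fun n => ‖A n‖ * t ^ (2 * n) := by
  refine hA.of_nonneg_of_le (fun n => by positivity) fun n => ?_
  gcongr
  omega

end

/-! ### The potential built from a solution of the infinite system -/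

namespace TubeArray

variable {X : TubeArray}

/-- The derivative is periodic and continuous on the exterior, which is compact modulo the lattice.
The margin `r < a` makes `f` holomorphic in a neighbourhood of the closed exterior. -/
theorem exists_norm_deriv_le {f : ℂ → ℂ} {r : ℝ} (hr : r < X.a) {c : ℂ → ℂ}
    (hd : ∀ z, (∀ P ∈ X.L.lattice, r < ‖z - P‖) → DifferentiableAt ℂ f z)
    (hq : ∀ P ∈ X.L.lattice, ∀ z, (∀ Q ∈ X.L.lattice, r < ‖z - Q‖) → f (z + P) = f z + c P) :
    ∃ K, ∀ z ∈ X.outside, DifferentiableAt ℂ f z ∧ ‖deriv f z‖ ≤ K := by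
  have hsub : X.outside ⊆ {z | ∀ P ∈ X.L.lattice, r < ‖z - P‖} := fun z hz P hP =>
    hr.trans_le (hz P hP)
  have hc : ContinuousOn (deriv f) X.outside :=
    ((DifferentiableOn.deriv (fun z hz => (hd z hz).differentiableWithinAt)
      (X.isOpen_strict_outside r)).continuousOn).mono hsub
  obtain ⟨K, hK⟩ := norm_bounded_on_outside hc fun P hP z hz => by
    have h1 : (fun w => f (w + P)) =ᶠ[𝓝 z] fun w => f w + c P := by
      filter_upwards [(X.isOpen_strict_outside r).mem_nhds (hsub hz)] with w hw
      exact hq P hP w hw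
    have h2 := h1.deriv_eq
    rwa [deriv_comp_add_const, deriv_add_const] at h2
  exact ⟨K, fun z hz => ⟨hd z (hsub hz), hK z hz⟩⟩

variable {ℓ K : ℝ} {g h : ℕ → ℂ} {p q A B : ℂ}

/-- The coefficients of the field incident on the tube at the origin. -/
noncomputable def incident (X : TubeArray) (g : ℕ → ℂ) (p : ℂ) (n : ℕ) : ℂ :=
  -(X.interaction g n + if n = 0 then p else 0)

theorem summable_incident (hℓ : ∀ P ∈ X.L.lattice, P ≠ 0 → ℓ ≤ ‖P‖) (hg : ∀ n, ‖g n‖ ≤ K) {t : ℝ}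
    (h0 : 0 ≤ t) (ht : X.a + X.a * t < ℓ) :
    Summable fun n => ‖X.incident g p n‖ * t ^ (2 * n + 1) := by
  have h1 := summable_norm_interaction hℓ hg h0 ht
  have h2 : Summable fun n : ℕ => if n = 0 then ‖p‖ * t else 0 := (hasSum_ite_eq 0 _).summable
  refine (h1.add h2).of_nonneg_of_le (fun n => by positivity) fun n => ?_
  rw [incident, norm_neg]
  rcases eq_or_ne n 0 with rfl | hn
  · simp only [if_true, mul_zero, zero_add, pow_one, ← add_mul]
    gcongr
    exact norm_add_le _ _
  · simp [hn]

theorem tsum_incident_mul_pow (hℓ : ∀ P ∈ X.L.lattice, P ≠ 0 → ℓ ≤ ‖P‖) (hlt : 2 * X.a < ℓ)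
    (hg : ∀ n, ‖g n‖ ≤ K) {w : ℂ} (hw : ‖w‖ = 1) :
    ∑' n, X.incident g p n * w ^ (2 * n + 1) =
      -(p * w) - ∑' n, X.interaction g n * w ^ (2 * n + 1) := by
  obtain ⟨s, h1, -⟩ := exists_hasSum_interaction hℓ hg (w := w) (by rw [hw]; linarith)
  have h2 : HasSum (fun n : ℕ => if n = 0 then p * w else 0) (p * w) := hasSum_ite_eq 0 _
  rw [← (h2.neg.sub h1.summable.hasSum).tsum_eq]
  congr 1
  ext n
  rw [incident]
  split_ifs with hn
  · subst hn; ring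
  · ring

/-- The potential of an array whose multipole coefficients solve the infinite system. -/
theorem exists_multipole_potential (hℓ : ∀ P ∈ X.L.lattice, P ≠ 0 → ℓ ≤ ‖P‖) (hlt : 2 * X.a < ℓ)
    (hΛ : ∀ P ∈ X.L.lattice, conj P ∈ X.L.lattice) (hden : ∀ n, X.γden n ≠ 0)
    (hT : ∀ P ∈ X.L.lattice, ∀ z ∉ X.L.lattice,
      weierstrassZeta X.L (z + P) = weierstrassZeta X.L z + wirtinger A B P)
    (hgK : ∀ n, ‖g n‖ ≤ K) (hhK : ∀ n, ‖h n‖ ≤ K)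
    (hg : ∀ n, g n = -(X.γ n * X.incident h q n)) (hh : ∀ n, h n = -(X.γ n * X.incident g p n)) :
    ∃ u, X.IsPotential u ∧
      (∀ z ∈ X.outside, Summable (fun n => g n * X.multipole n z) ∧
        Summable (fun n => h n * X.multipole n (conj z)) ∧
        u z = -(p * z + q * conj z) +
          X.a * (∑' n, g n * X.multipole n z + ∑' n, h n * X.multipole n (conj z))) ∧
      X.avgE u = ![p + q - X.a ^ 2 * (g 0 + h 0) * (A + B),
        Complex.I * (p - q - X.a ^ 2 * (g 0 - h 0) * (A - B))] ∧
      X.avgD u = ![X.εe * (p + q - X.a ^ 2 * (g 0 + h 0) * (A - B)),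
        X.εe * (Complex.I * (p - q - X.a ^ 2 * (g 0 - h 0) * (A + B)))] := by
  have ha := X.a_pos
  -- Chosen so that `t > 1` and `a + a t = a + ℓ / 2 < ℓ`: the incident series converge in a disc
  -- larger than the tube.
  set t := ℓ / (2 * X.a) with ht
  have ht1 : 1 < t := by rw [ht, one_lt_div (by positivity)]; exact hlt
  have ht0 : 0 < t := by linarith
  have hat : X.a + X.a * t < ℓ := by
    have : X.a * t = ℓ / 2 := by rw [ht]; field_simp
    rw [this]; linarith
  have hr : X.a / t < X.a := div_lt_self ha ht1
  obtain ⟨Cγ, hCγ⟩ := X.exists_norm_γ_le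
  obtain ⟨Cd, hCd⟩ := X.exists_norm_inv_γden_le
  have hR := summable_incident (p := p) hℓ hgK ht0.le hat
  have hR' := summable_incident (p := q) hℓ hhK ht0.le hat
  -- Bootstrap: coefficients that are merely bounded produce an incident field converging up to
  -- radius `t`, and since the `γ_n` are bounded the system returns this decay to the coefficients.
  have hgs : Summable fun n => ‖g n‖ * t ^ (2 * n + 1) :=
    (summable_odd_mul ht0.le hCγ hR').congr fun n => by rw [hg n, norm_neg]
  have hhs : Summable fun n => ‖h n‖ * t ^ (2 * n + 1) :=
    (summable_odd_mul ht0.le hCγ hR).congr fun n => by rw [hh n, norm_neg]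
  have hgs' := norm_le_of_summable_odd ht1.le hgs
  have hhs' := norm_le_of_summable_odd ht1.le hhs
  -- The amplitude in the coating per unit incident amplitude, as in `coeff_match`.
  set κ : ℕ → ℂ := fun n => (1 - X.α) / X.γden n with hκ
  have hκC : ∀ n, ‖κ n‖ ≤ ‖1 - X.α‖ * Cd := fun n => by
    change ‖(1 - X.α) / X.γden n‖ ≤ _
    rw [div_eq_mul_inv, norm_mul]
    gcongr
    exact hCd n
  have hA := summable_odd_mul ht0.le hκC hR
  have hA' := summable_odd_mul ht0.le hκC hR'
  set fo : ℂ → ℂ := fun z => -(p * z) + X.a * ∑' n, g n * X.multipole n z with hfo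
  set go : ℂ → ℂ := fun z => -(q * z) + X.a * ∑' n, h n * X.multipole n z with hgo
  have hdf : ∀ {f : ℕ → ℂ} (c : ℂ), (Summable fun n => ‖f n‖ * t ^ (2 * n)) → ∀ z,
      (∀ P ∈ X.L.lattice, X.a / t < ‖z - P‖) →
      DifferentiableAt ℂ (fun z => -(c * z) + X.a * ∑' n, f n * X.multipole n z) z :=
    fun c hf z hz => ((differentiableAt_id.const_mul c).neg).add
      ((multipole_series ht0 hf hz).2.const_mul _)
  have hqf : ∀ {f : ℕ → ℂ} (c : ℂ), (Summable fun n => ‖f n‖ * t ^ (2 * n)) → ∀ P ∈ X.L.lattice,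
      ∀ z, (∀ Q ∈ X.L.lattice, X.a / t < ‖z - Q‖) →
      -(c * (z + P)) + X.a * ∑' n, f n * X.multipole n (z + P) =
        -(c * z) + X.a * ∑' n, f n * X.multipole n z +
          (-(c * P) + X.a ^ 2 * f 0 * wirtinger A B P) := fun c hf P hP z hz => by
    rw [tsum_multipole_add hT ht0 hf hP hz]
    ring
  have hso : ∀ z ∈ X.outside, ∀ P ∈ X.L.lattice, X.a / t < ‖z - P‖ := fun z hz P hP =>
    hr.trans_le (hz P hP)
  have hco : ∀ z ∈ X.outside, conj z ∈ X.outside := fun z hz P hP => by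
    have := hz _ (hΛ P hP)
    rwa [← Complex.norm_conj, map_sub, Complex.conj_conj] at this
  obtain ⟨K₁, hK₁⟩ := exists_norm_deriv_le hr (hdf p hgs') (hqf p hgs')
  obtain ⟨K₂, hK₂⟩ := exists_norm_deriv_le hr (hdf q hhs') (hqf q hhs')
  have hν : ∀ w : ℂ, ‖w‖ = 1 → ‖(X.ν : ℂ) ^ 2 * w‖ ≤ t := fun w hw => by
    rw [norm_mul, hw, mul_one, norm_pow, Complex.norm_real, Real.norm_of_nonneg X.ν_nonneg]
    exact (pow_le_one₀ X.ν_nonneg X.ν_lt_one.le).trans ht1.le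
  have hcw : ∀ w : ℂ, ‖w‖ = 1 → ‖conj w‖ = 1 := fun w hw => by rwa [Complex.norm_conj]
  have hwt : ∀ w : ℂ, ‖w‖ = 1 → ‖w‖ ≤ t := fun w hw => hw.le.trans ht1.le
  -- On the circle the part holomorphic in `z` contributes its incident series in powers of `w` and
  -- its multipoles in powers of `w̄`. So the powers of `w` collect the incident series of `g` and
  -- the scattered `h`, and those of `w̄` the reverse, which is why the system couples `g` and `h`
  -- crosswise.
  have hvf : ∀ {f : ℕ → ℂ} {w c : ℂ}, ‖w‖ = 1 → (∀ n, ‖f n‖ ≤ K) →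
      (Summable fun n => ‖f n‖ * t ^ (2 * n + 1)) →
      -(c * (X.a * w)) + X.a * ∑' n, f n * X.multipole n (X.a * w) =
        X.a * (∑' n, X.incident f c n * w ^ (2 * n + 1) + ∑' n, f n * conj w ^ (2 * n + 1)) := by
    intro f w c hw hfK hf
    rw [tsum_incident_mul_pow hℓ hlt hfK hw, (hasSum_multipole hℓ hlt hfK hw
      (summable_odd_series hf (hwt _ (hcw w hw)))).tsum_eq]
    ring
  have hin : ∀ {R f : ℕ → ℂ} {w : ℂ}, ‖w‖ = 1 → (∀ n, f n = -(X.γ n * R n)) →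
      (Summable fun n => ‖R n‖ * t ^ (2 * n + 1)) →
      (Summable fun n => ‖f n‖ * t ^ (2 * n + 1)) →
      (∑' n, R n * w ^ (2 * n + 1) + ∑' n, f n * w ^ (2 * n + 1) =
        ∑' n, κ n * R n * w ^ (2 * n + 1) +
          X.α' * ∑' n, κ n * R n * ((X.ν : ℂ) ^ 2 * w) ^ (2 * n + 1)) ∧
      X.εe * (∑' n, R n * w ^ (2 * n + 1) - ∑' n, f n * w ^ (2 * n + 1)) =
        X.εi * (∑' n, κ n * R n * w ^ (2 * n + 1) -
          X.α' * ∑' n, κ n * R n * ((X.ν : ℂ) ^ 2 * w) ^ (2 * n + 1)) := by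
    intro R f w hw hf hRs hfs
    have s1 := summable_odd_series hRs (hwt w hw)
    have s2 := summable_odd_series hfs (hwt w hw)
    have s3 := summable_odd_series (summable_odd_mul ht0.le hκC hRs) (hwt w hw)
    have s4 := summable_odd_series (summable_odd_mul ht0.le hκC hRs) (hν w hw)
    rw [← tsum_mul_left (a := X.α'), ← s1.tsum_add s2, ← s1.tsum_sub s2,
      ← s3.tsum_add (s4.mul_left _), ← s3.tsum_sub (s4.mul_left _), ← tsum_mul_left,
      ← tsum_mul_left]
    have hp : ∀ n : ℕ, ((X.ν : ℂ) ^ 2 * w) ^ (2 * n + 1) =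
        (X.ν : ℂ) ^ (4 * n + 2) * w ^ (2 * n + 1) := fun n => by
      rw [mul_pow, ← pow_mul]; congr 2; ring
    refine ⟨tsum_congr fun n => ?_, tsum_congr fun n => ?_⟩
    · rw [hf n, hp, hκ]
      linear_combination w ^ (2 * n + 1) * (coeff_match n (hden n) (R n)).1
    · rw [hf n, hp, hκ]
      linear_combination w ^ (2 * n + 1) * (coeff_match n (hden n) (R n)).2
  have hvg : ∀ w : ℂ, ‖w‖ = 1 → go (X.a * conj w) =
      X.a * (∑' n, X.incident h q n * conj w ^ (2 * n + 1) + ∑' n, h n * w ^ (2 * n + 1)) :=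
    fun w hw => by
      have := hvf (c := q) (hcw w hw) hhK hhs
      rwa [Complex.conj_conj] at this
  -- Only the dipoles contribute `A P + B P̄` to the increments. In `cg` the coefficients appear
  -- exchanged because `go` is evaluated at `z̄`.
  obtain ⟨u, hu, hval, hE, hD⟩ := exists_potential (X := X) (fo := fo) (go := go) (K := max K₁ K₂)
    (cf := wirtinger (-p + X.a ^ 2 * g 0 * A) (X.a ^ 2 * g 0 * B))
    (cg := wirtinger (X.a ^ 2 * h 0 * B) (-q + X.a ^ 2 * h 0 * A)) ht1
    (differentiableOn_odd_series hA) (differentiableOn_odd_series hA')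
    (fun z hz => ⟨(hK₁ z hz).1, le_max_of_le_left (hK₁ z hz).2⟩)
    (fun z hz => ⟨(hK₂ _ (hco z hz)).1, le_max_of_le_right (hK₂ _ (hco z hz)).2⟩)
    (fun P hP z hz => by
      have := hqf p hgs' P hP z (hso z hz)
      rw [wirtinger_apply] at this ⊢
      rw [hfo]
      linear_combination this)
    (fun P hP z hz => by
      have := hqf q hhs' _ (hΛ P hP) _ (hso _ (hco z hz))
      rw [wirtinger_apply, Complex.conj_conj] at this
      rw [wirtinger_apply, hgo, map_add]
      linear_combination this)
    (fun w hw => by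
      have h1 := (hin hw hh hR hhs).1
      have h2 := (hin (hcw w hw) hg hR' hgs).1
      rw [hvg w hw]
      rw [show fo (X.a * w) = _ from hvf hw hgK hgs]
      linear_combination X.a * h1 + X.a * h2)
    (fun w hw => by
      have h1 := (hin hw hh hR hhs).2
      have h2 := (hin (hcw w hw) hg hR' hgs).2
      rw [hvg w hw]
      rw [show fo (X.a * w) = _ from hvf hw hgK hgs]
      linear_combination -X.a * h1 + X.a * h2)
  refine ⟨u, hu, fun z hz => ⟨(multipole_series ht0 hgs' (hso z hz)).1.of_norm,
    (multipole_series ht0 hhs' (hso _ (hco z hz))).1.of_norm, ?_⟩, ?_, ?_⟩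
  · rw [hval z hz, hfo, hgo]
    ring
  · rw [hE]
    congr 1
    · simp only [wirtinger_apply, map_one]
      ring
    · congr 1
      simp only [wirtinger_apply, Complex.conj_I]
      ring
  · rw [hD]
    congr 1
    · simp only [wirtinger_apply, Complex.conj_I]
      linear_combination -X.εe * (p + q - X.a ^ 2 * (g 0 + h 0) * (A - B)) * Complex.I_mul_I
    · congr 1
      simp only [wirtinger_apply, map_one]
      ring

end TubeArray

/-! ### Superposition of the two systems and the tensor formula -/

namespace TubeArray

variable {X : TubeArray} {x y : ℕ → ℂ} {lam mu : ℂ}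

theorem zetaTerm_eq (g h : ℕ → ℂ) (z : ℂ) (n : ℕ) :
    X.zetaTerm g h z n = g n * X.multipole n z + h n * X.multipole n (conj z) := by
  rw [zetaTerm, multipole, multipole]
  ring

/-- The potential for the applied field `F`, with the averages of its field and displacement. -/
theorem exists_potential_hasZetaExpansion
    (hdis : ∀ P ∈ X.L.lattice, P ≠ 0 → 2 * X.a < ‖P‖) (h1 : X.L.ω₁.im = 0)
    (h2 : 0 < (X.L.ω₂ / X.L.ω₁).im) (hs : ∀ k, 2 ≤ k → (latticeSum X.L k).im = 0)
    (hden : ∀ n, X.γden n ≠ 0) (hx : X.SolvesX x) (hy : X.SolvesY y)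
    (hx0 : x 0 = X.γ 0 * lam) (hy0 : y 0 = X.γ 0 * mu) (F : Fin 2 → ℂ) :
    ∃ u : ℂ → ℂ, X.IsPotential u ∧
      X.HasZetaExpansion u (fun n => (x n - y n) / 2) (fun n => (x n + y n) / 2) F ∧
      X.avgE u = (1 - X.η • (X.Ψ * !![lam, 0; 0, mu])).mulVec F ∧
      X.avgD u = (X.εe • (1 + ((Real.pi : ℂ) * X.η) • !![lam, 0; 0, mu] -
        X.η • (X.Ψ * !![lam, 0; 0, mu]))).mulVec F := by
  obtain ⟨ℓ, hlt, hℓ⟩ := X.exists_min_norm hdis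
  have hℓ0 : 0 < ℓ := by linarith [X.a_pos]
  have hη := X.η₁_im hℓ0 hℓ hs h1
  obtain ⟨A, B, hB, hAB, hT⟩ := X.exists_wirtinger_quasiPeriod h1
  obtain ⟨⟨Kx, hKx⟩, hx⟩ := hx
  obtain ⟨⟨Ky, hKy⟩, hy⟩ := hy
  set p := (F 0 - Complex.I * F 1) / 2 with hp
  set q := (F 0 + Complex.I * F 1) / 2 with hq
  have hpq : p + q = F 0 := by rw [hp, hq]; ring
  have hpq' : Complex.I * (p - q) = F 1 := by
    rw [hp, hq]; linear_combination -F 1 * Complex.I_mul_I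
  set g : ℕ → ℂ := fun n => p * ((x n - y n) / 2) + q * ((x n + y n) / 2) with hgdef
  set h : ℕ → ℂ := fun n => p * ((x n + y n) / 2) + q * ((x n - y n) / 2) with hhdef
  -- Since `g + h = (p + q) x` and `g - h = (q - p) y`, the coupled equations for `g` and `h` split
  -- into the system for `x`, driven by `F₁`, and the one for `y`, driven by `F₂`.
  have hg' : g = fun n => (p + q) / 2 * x n + (q - p) / 2 * y n := by ext n; rw [hgdef]; ring
  have hh' : h = fun n => (p + q) / 2 * x n + (p - q) / 2 * y n := by ext n; rw [hhdef]; ring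
  have hgI : ∀ n, X.interaction g n =
      (p + q) / 2 * X.interaction x n + (q - p) / 2 * X.interaction y n := fun n => by
    rw [hg', interaction_add hℓ hlt hKx hKy]
  have hhI : ∀ n, X.interaction h n =
      (p + q) / 2 * X.interaction x n + (p - q) / 2 * X.interaction y n := fun n => by
    rw [hh', interaction_add hℓ hlt hKx hKy]
  have hbd : ∀ c d : ℂ, ∀ n, ‖c * x n + d * y n‖ ≤ ‖c‖ * Kx + ‖d‖ * Ky := fun c d n => by
    refine (norm_add_le _ _).trans ?_
    rw [norm_mul, norm_mul]
    gcongr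
    exacts [hKx n, hKy n]
  have hgK : ∀ n, ‖g n‖ ≤ ‖(p + q) / 2‖ * Kx + ‖(q - p) / 2‖ * Ky := fun n => by
    rw [hg']; exact hbd _ _ n
  have hhK : ∀ n, ‖h n‖ ≤ ‖(p + q) / 2‖ * Kx + ‖(q - p) / 2‖ * Ky := fun n => by
    rw [hh', show (q - p) / 2 = -((p - q) / 2) by ring, norm_neg]; exact hbd _ _ n
  have hge : ∀ n, g n = -(X.γ n * X.incident h q n) := fun n => by
    have e1 := hx n
    have e2 := hy n
    rw [incident, hhI, hg']
    split_ifs at e1 e2 ⊢ with hn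
    · subst hn
      linear_combination (p + q) / 2 * e1 + (q - p) / 2 * e2
    · linear_combination (p + q) / 2 * e1 + (q - p) / 2 * e2
  have hhe : ∀ n, h n = -(X.γ n * X.incident g p n) := fun n => by
    have e1 := hx n
    have e2 := hy n
    rw [incident, hgI, hh']
    split_ifs at e1 e2 ⊢ with hn
    · subst hn
      linear_combination (p + q) / 2 * e1 + (p - q) / 2 * e2
    · linear_combination (p + q) / 2 * e1 + (p - q) / 2 * e2
  obtain ⟨u, hu, hval, hE, hD⟩ := exists_multipole_potential hℓ hlt
    (fun P hP => conj_mem_lattice hℓ0 hℓ hs hP) hden hT hgK hhK hge hhe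
  have hS := X.area_ne_zero
  have hS' : (X.area : ℂ) = X.L.ω₁ * X.L.ω₂.im := by
    have h3 : X.L.ω₁ = (X.L.ω₁.re : ℂ) := Complex.ext rfl (by simp [h1])
    rw [h3, X.area_eq_of_real h1 h2]
    push_cast
    rfl
  have hη' : X.η₁ = (X.η₁.re : ℂ) := Complex.ext rfl (by simp [hη])
  have hsum : X.area * (A + B) = 2 * (X.η₁.re * X.L.ω₂.im) := by
    rw [hS', ← hη']
    linear_combination (X.L.ω₂.im : ℂ) * hAB
  have hηS : X.area * X.η = 2 * X.a ^ 2 * X.γ 0 := by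
    rw [η]; field_simp
  have e1 : g 0 + h 0 = F 0 * x 0 := by rw [hgdef, hhdef, ← hpq]; ring
  have e2 : Complex.I * (g 0 - h 0) = -(F 1 * y 0) := by rw [hgdef, hhdef, ← hpq']; ring
  -- The mean fields contain `A + B` and `A - B = (A + B) - 2B`. By `S (A + B) = 2 Re η₁ Im ω₂` and
  -- `S B = π` the first gives `Re η₁ Im ω₂`; the second differs from it by `2π / S`, which is the
  -- source of the entry `π - Re η₁ Im ω₂` and of the term `π η M`.
  have k1 : X.a ^ 2 * x 0 * (A + B) = X.η * (X.η₁.re * X.L.ω₂.im) * lam := by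
    refine mul_left_cancel₀ hS ?_
    rw [hx0]
    linear_combination X.a ^ 2 * X.γ 0 * lam * hsum - X.η₁.re * X.L.ω₂.im * lam * hηS
  have k2 : X.a ^ 2 * y 0 * (A + B) = X.η * (X.η₁.re * X.L.ω₂.im) * mu := by
    refine mul_left_cancel₀ hS ?_
    rw [hy0]
    linear_combination X.a ^ 2 * X.γ 0 * mu * hsum - X.η₁.re * X.L.ω₂.im * mu * hηS
  have k3 : 2 * X.a ^ 2 * x 0 * B = Real.pi * X.η * lam := by
    refine mul_left_cancel₀ hS ?_
    rw [hx0]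
    linear_combination 2 * X.a ^ 2 * X.γ 0 * lam * hB - Real.pi * lam * hηS
  have k4 : 2 * X.a ^ 2 * y 0 * B = Real.pi * X.η * mu := by
    refine mul_left_cancel₀ hS ?_
    rw [hy0]
    linear_combination 2 * X.a ^ 2 * X.γ 0 * mu * hB - Real.pi * mu * hηS
  -- At the real half-period `ζ` is real, so the off-diagonal entries of `Ψ` vanish.
  have hΨ : X.Ψ * !![lam, 0; 0, mu] = !![X.η₁.re * X.L.ω₂.im * lam, 0; 0,
      (Real.pi - X.η₁.re * X.L.ω₂.im) * mu] := by
    rw [Ψ, hη]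
    ext i j
    fin_cases i <;> fin_cases j <;> simp [Matrix.mul_apply, Fin.sum_univ_two]
  refine ⟨u, hu, fun z hz => ?_, ?_, ?_⟩
  · obtain ⟨s1, s2, hv⟩ := hval z hz
    have he : X.zetaTerm g h z = fun n => g n * X.multipole n z + h n * X.multipole n (conj z) :=
      funext fun n => zetaTerm_eq g h z n
    change Summable (X.zetaTerm g h z) ∧
      u z = -(p * z + q * conj z) + X.a * ∑' n, X.zetaTerm g h z n
    rw [he]
    exact ⟨s1.add s2, by rw [hv, s1.tsum_add s2]⟩
  · rw [hE, hΨ]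
    ext i
    fin_cases i
    · simp [Matrix.mulVec, dotProduct, Fin.sum_univ_two]
      linear_combination hpq - X.a ^ 2 * (A + B) * e1 - F 0 * k1
    · simp [Matrix.mulVec, dotProduct, Fin.sum_univ_two]
      linear_combination hpq' - X.a ^ 2 * (A - B) * e2 + F 1 * k2 - F 1 * k4
  · rw [hD, hΨ]
    ext i
    fin_cases i
    · simp [Matrix.mulVec, dotProduct, Fin.sum_univ_two]
      linear_combination X.εe * (hpq - X.a ^ 2 * (A - B) * e1 - F 0 * k1 + F 0 * k3)
    · simp [Matrix.mulVec, dotProduct, Fin.sum_univ_two]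
      linear_combination X.εe * (hpq' - X.a ^ 2 * (A + B) * e2 + F 1 * k2)

/-- The matrix of `⟨𝐃⟩` is `c` times the matrix of `⟨𝐄⟩` plus `c π η M`, so the quotient has the
leading term `c I`. -/
theorem isEffectiveTensor_iff_of_expansion {η c π : ℂ} {Ψ M : Matrix (Fin 2) (Fin 2) ℂ}
    (hB : (1 - η • (Ψ * M)).det ≠ 0)
    (h : ∀ F, ∃ u, X.IsPotential u ∧ X.avgE u = (1 - η • (Ψ * M)).mulVec F ∧
      X.avgD u = (c • (1 + (π * η) • M - η • (Ψ * M))).mulVec F) (T : Matrix (Fin 2) (Fin 2) ℂ) :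
    X.IsEffectiveTensor T ↔ T = c • (1 + (π * η) • (M * (1 - η • (Ψ * M))⁻¹)) := by
  rw [X.isEffectiveTensor_iff hB h]
  have h1 : (1 - η • (Ψ * M)) * (1 - η • (Ψ * M))⁻¹ = 1 :=
    Matrix.mul_nonsing_inv _ (isUnit_iff_ne_zero.2 hB)
  have h2 : 1 + (π * η) • M - η • (Ψ * M) = (1 - η • (Ψ * M)) + (π * η) • M := by abel
  rw [h2, Matrix.smul_mul, Matrix.add_mul, h1, Matrix.smul_mul]

end TubeArray

end CoatedTubes
theorem mainTheorem2 (X : CoatedTubes.TubeArray) :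
    -- the tensor formula, for disjoint tubes, `τ₁` real and real lattice sums
    ((∀ P ∈ X.L.lattice, P ≠ 0 → 2 * X.a < ‖P‖) →
      X.L.ω₁.im = 0 → 0 < (X.L.ω₂ / X.L.ω₁).im →
      (∀ k, 2 ≤ k → (CoatedTubes.latticeSum X.L k).im = 0) →
      (∀ n, X.γden n ≠ 0) →
      ∀ (x y : ℕ → ℂ) (lam mu : ℂ), X.SolvesX x → X.SolvesY y →
        x 0 = X.γ 0 * lam → y 0 = X.γ 0 * mu →
        let M : Matrix (Fin 2) (Fin 2) ℂ := !![lam, 0; 0, mu]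
        (∀ F : Fin 2 → ℂ, ∃ u : ℂ → ℂ, X.IsPotential u ∧
          X.HasZetaExpansion u (fun n => (x n - y n) / 2) (fun n => (x n + y n) / 2) F ∧
          X.avgE u = (1 - X.η • (X.Ψ * M)).mulVec F ∧
          X.avgD u = (X.εe • (1 + ((Real.pi : ℂ) * X.η) • M - X.η • (X.Ψ * M))).mulVec F) ∧
        ((1 - X.η • (X.Ψ * M)).det ≠ 0 →
          ∀ T : Matrix (Fin 2) (Fin 2) ℂ, X.IsEffectiveTensor T ↔
            T = X.εe • (1 + ((Real.pi : ℂ) * X.η) • (M * (1 - X.η • (X.Ψ * M))⁻¹)))) ∧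
    -- if `γ₀ = 0`, the medium is isotropic for every lattice and every concentration
    (X.γden 0 ≠ 0 → X.γ 0 = 0 →
      ∀ T : Matrix (Fin 2) (Fin 2) ℂ, X.IsEffectiveTensor T ↔ T = X.εe • 1) ∧
    -- what `γ₀ = 0` means
    (X.εi ≠ X.εc →
      ((X.γden 0 ≠ 0 ∧ X.γ 0 = 0) ↔
        (X.b : ℂ) ^ 2 / (X.a : ℂ) ^ 2
          = ((X.εi - X.εe) * (X.εi + X.εc)) / ((X.εi + X.εe) * (X.εi - X.εc)))) := by
  refine ⟨fun hdis h1 h2 hs hden x y lam mu hx hy hx0 hy0 => ?_,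
    fun h0 hγ T => CoatedTubes.TubeArray.isEffectiveTensor_neutral_iff h0 hγ T,
    fun hic => CoatedTubes.TubeArray.γ_zero_eq_zero_iff hic⟩
  have key := CoatedTubes.TubeArray.exists_potential_hasZetaExpansion hdis h1 h2 hs hden hx hy
    hx0 hy0
  refine ⟨key, fun hdet T =>
    CoatedTubes.TubeArray.isEffectiveTensor_iff_of_expansion hdet (fun F => ?_) T⟩
  obtain ⟨u, hu, -, hE, hD⟩ := key F
  exact ⟨u, hu, hE, hD⟩
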